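/- **Setting.** Agents $k=1,\dots,K$ have losses $Q_k(w;x,y)$, $w\in\mathbb R^M$, $x\in\mathbb R^D$, and training samples $(x_{k,i},y_{k,i})$, $1\le i\le N_k$. For $\epsilon\ge 0$, $p\in[1,\infty]$ put $$J_k(w)=\frac1{N_k}\sum_{i=1}^{N_k}\max_{\|\delta\|_p\le\epsilon}Q_k(w;x_{k,i}+\delta,y_{k,i}),\qquad J(w)=\frac1K\sum_{k=1}^K J_k(w),$$ and let $w^\star$ be a local minimizer of $J$. An attack assigns to agent $k$, model $w$ and sample $i$ a perturbation $\hat\delta_{k,i}(w)$ with $\|\hat\delta_{k,i}(w)\|_p\le\epsilon$ (otherwise arbitrary, measurable in $w$); $\hat x_{k,i}(w)=x_{k,i}+\hat\delta_{k,i}(w)$. Starting from random models $w_{k,-1}$, in each iteration $n\ge 0$ every agent draws $B$ samples uniformly from its training set, independently of everything else, and with the stochastic gradient $g_{k,n}=\frac1B\sum_{b=1}^B\nabla_wQ_k(w_{k,n-1};\hat x_{k,n}^b,y_{k,n}^b)$ and step size $\mu$ the network updates $$w_{k,n}=\sum_{\ell}[A_2]_{\ell k}\Big(\sum_m[A_1]_{m\ell}w_{m,n-1}-\mu\,g_{\ell,n}\Big),$$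 with $(A_1,A_2)=(I,\frac1K\mathbb 1\mathbb 1^{\mathsf T})$ for the centralized, $(A,I)$ for the consensus and $(I,A)$ for the diffusion method. The excess risk is $\mathrm{ER}_n=\frac1K\sum_k\mathbb E J(w_{k,n})-J(w^\star)$. **Assumptions.** The network ($K$, $A$), $M$, $D$, $p$ are fixed; $\mu\to0^+$, and the losses, samples, $\epsilon$, $B$, attack, $w^\star$ and starting points may vary with $\mu$; all constants below are independent of $\mu$. 1. For every $w$ and every sample the maximizing perturbation is unique. 2. $A$ is symmetric with entries in $[0,1]$ and columns summing to $1$; any two agents are joined by a path of positive weights, and some $a_{kk}>0$. 3. $Q_k$ is differentiable in $w$ and in $x$, and $\nabla_wQ_k$, $\nabla_xQ_k$ are $L$-Lipschitz in $w$ and in $x$. Moreover $\frac1{N_k}\sum_i\|\nabla_wQ_k(w^\star;x_{k,i},y_{k,i})\|^4\le O(1)$, and on a ball around $w^\star$ of fixed radius $J_k$ is $C^2$ with $\|\nabla^2J_k(w)-\nabla^2J_k(w^\star)\|\le O(1)\|w-w^\star\|$. 4. $\mathbb E\|w_{k,-1}-w^\star\|^2\le o(\mu/B)+O(\epsilon^{7/4})$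 and $\mathbb E\|w_{k,-1}-w^\star\|^4\le o(\mu^2/B^2)+O(\epsilon^{7/2})$. 5. $\|\nabla^2J_k(w^\star)-\nabla^2J(w^\star)\|\le\rho$ with $\rho$ small, i.e. $\rho\to0$ as $\mu\to0$. 6. $1/B\le O(\mu)$ and $\epsilon\le O(\mu^2)$. **Notation.** $\bar H=\nabla^2J(w^\star)$; $d=\mathrm{col}_k\{\nabla J_k(w^\star)\}$; $\bar R_s$ is the covariance matrix of $\frac1K\sum_k s_k$, where $s_k=\nabla_wQ_k(w^\star;\hat x_{k,i_k}(w^\star),y_{k,i_k})-\frac1{N_k}\sum_j\nabla_wQ_k(w^\star;\hat x_{k,j}(w^\star),y_{k,j})$ with independent uniform indices $i_k$; $A=VPV^{\mathsf T}$ with $V=[\frac1{\sqrt K}\mathbb 1,\ V_\alpha]$ orthogonal and $P=\mathrm{diag}(1,P_\alpha)$ diagonal; $\mathcal V_\alpha=V_\alpha\otimes I_M$, $\mathcal P_\alpha=P_\alpha\otimes I_M$; $\|u\|_\Sigma^2=u^{\mathsf T}\Sigma u$. **Theorem.** Fix $c>0$. As $\mu\to0^+$ the expectations in $\mathrm{ER}_n$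 are finite and, uniformly over $0\le n\le c/\mu$, $$\mathrm{ER}_{n,cen}=\tfrac{\mu}{B}e(n)\pm o(\mu^2),\quad \mathrm{ER}_{n,con}=\tfrac{\mu}{B}e(n)+\mu^2f_{con}(n)\pm o(\mu^2),\quad \mathrm{ER}_{n,dif}=\tfrac{\mu}{B}e(n)+\mu^2f_{dif}(n)\pm o(\mu^2),$$ where $$e(n)=\tfrac14\mathrm{Tr}\big((I-(I-\mu\bar H)^{2(n+1)})\bar R_s\big),$$ $$f_{con}(n)=\tfrac1{2K}\|d^{\mathsf T}\mathcal V_\alpha(I-\mathcal P_\alpha)^{-1}(I-\mathcal P_\alpha^{n+1})\|^2_{I\otimes\bar H},\qquad f_{dif}(n)=\tfrac1{2K}\|d^{\mathsf T}\mathcal V_\alpha\mathcal P_\alpha(I-\mathcal P_\alpha)^{-1}(I-\mathcal P_\alpha^{n+1})\|^2_{I\otimes\bar H}.$$ Consequently $0\le f_{dif}(n)\le f_{con}(n)$, and up to an $o(\mu^2)$ term, uniformly over $0\le n\le c/\mu$, $\mathrm{ER}_{n,cen}\le\mathrm{ER}_{n,dif}\le\mathrm{ER}_{n,con}$. If the network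 is heterogeneous in the sense that $\|d\|^2_{I\otimes\bar H}$ stays bounded away from $0$, then $\mathrm{ER}_{n,dif}\le\mathrm{ER}_{n,con}$ holds exactly for all sufficiently small $\mu$ and all $0\le n\le c/\mu$; if $\|(A\otimes I_M)d\|^2_{I\otimes\bar H}$ stays bounded away from $0$, then $\mathrm{ER}_{n,cen}\le\mathrm{ER}_{n,dif}\le\mathrm{ER}_{n,con}$ holds exactly for all sufficiently small $\mu$ and all $0\le n\le c/\mu$. -/

import Mathlib

open Filter Topology Asymptotics MeasureTheory
open scoped ENNReal Matrix Kronecker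

noncomputable section

namespace AdvNet

/-- `ℝᵈ` with the Euclidean norm. -/
abbrev Vec (d : ℕ) := EuclideanSpace ℝ (Fin d)

/-- The network state: one model `w_k ∈ ℝᴹ` for each of the `K` agents. -/
abbrev State (K M : ℕ) := Fin K → Vec M

/-- Loss functions `Q_k(w; x, y)` and training samples `(x_{k,i}, y_{k,i})`, `i < N_k`,
of the `K` agents. -/
structure Problem (K M D : ℕ) (Y : Type*) where
  Q : Fin K → Vec M → Vec D → Y → ℝ
  N : Fin K → ℕ
  N_pos : ∀ k, 0 < N k
  x : ∀ k, Fin (N k) → Vec D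
  y : ∀ k, Fin (N k) → Y

/-- The `ℓ_p` ball of admissible perturbations, `{δ : ‖δ‖_p ≤ ε}`. -/
def pBall (D : ℕ) (p : ℝ≥0∞) (ε : ℝ) : Set (Vec D) :=
  {δ | ‖(WithLp.toLp p (WithLp.ofLp δ) : PiLp p (fun _ : Fin D => ℝ))‖ ≤ ε}

/-- The second derivative of `f` at `w`, as a bilinear form (with its operator norm). -/
def hess {M : ℕ} (f : Vec M → ℝ) (w : Vec M) : Vec M →L[ℝ] Vec M →L[ℝ] ℝ :=
  fderiv ℝ (fun v => fderiv ℝ f v) w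

/-- The Hessian matrix of `f` at `w`. -/
def hessMatrix {M : ℕ} (f : Vec M → ℝ) (w : Vec M) : Matrix (Fin M) (Fin M) ℝ :=
  Matrix.of fun i j => hess f w (EuclideanSpace.single i 1) (EuclideanSpace.single j 1)

/-- The squared weighted norm `‖u‖²_Σ = uᵀ Σ u`. -/
def wSq {ι : Type*} [Fintype ι] (S : Matrix ι ι ℝ) (u : ι → ℝ) : ℝ :=
  u ⬝ᵥ (S *ᵥ u)

/-! ### The network -/

/-- A combination matrix of a strongly connected graph: weights in `[0,1]`, symmetric, columns
summing to one, a positive-weight path between any two agents, and at least one self-loop. -/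
structure IsCombination {K : ℕ} (A : Matrix (Fin K) (Fin K) ℝ) : Prop where
  mem_Icc : ∀ l k, A l k ∈ Set.Icc (0 : ℝ) 1
  symm : ∀ l k, A l k = A k l
  col_sum : ∀ k, ∑ l, A l k = 1
  connected : ∀ l k, Relation.ReflTransGen (fun i j => 0 < A i j) l k
  self_loop : ∃ k, 0 < A k k

/-- `A = V P Vᵀ` with `V = [K^{-1/2} 𝟙, V_α]` orthogonal and `P = diag(1, P_α)`,
`P_α = diag(lam)`. -/
structure IsSpectral {K : ℕ} (A : Matrix (Fin K) (Fin K) ℝ)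
    (V : Matrix (Fin K) (Fin (K - 1)) ℝ) (lam : Fin (K - 1) → ℝ) : Prop where
  orthonormal : Vᵀ * V = 1
  orth_one : ∀ j, ∑ k, V k j = 0
  decomp : A = Matrix.of (fun _ _ => (1 : ℝ) / K) + V * Matrix.diagonal lam * Vᵀ

/-- The three distributed training strategies. -/
inductive Strategy
  | centralized
  | consensus
  | diffusion

/-- The matrix `A₁` of the unified recursion. -/
def Strategy.A₁ {K : ℕ} (A : Matrix (Fin K) (Fin K) ℝ) : Strategy → Matrix (Fin K) (Fin K) ℝ
  | .centralized => 1
  | .consensus => A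
  | .diffusion => 1

/-- The matrix `A₂` of the unified recursion. -/
def Strategy.A₂ {K : ℕ} (A : Matrix (Fin K) (Fin K) ℝ) : Strategy → Matrix (Fin K) (Fin K) ℝ
  | .centralized => Matrix.of fun _ _ => (1 : ℝ) / K
  | .consensus => 1
  | .diffusion => A

namespace Problem

variable {K M D : ℕ} {Y : Type*} (S : Problem K M D Y)

/-! ### Adversarial risks -/

/-- The gradient `∇_w Q_k(w; x, y)`. -/
def gradW (k : Fin K) (w : Vec M) (x : Vec D) (y : Y) : Vec M :=
  gradient (fun v => S.Q k v x y) w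

/-- The gradient `∇_x Q_k(w; x, y)`. -/
def gradX (k : Fin K) (w : Vec M) (x : Vec D) (y : Y) : Vec D :=
  gradient (fun z => S.Q k w z y) x

/-- The local adversarial risk
`J_k(w) = (1/N_k) ∑_i max_{‖δ‖_p ≤ ε} Q_k(w; x_{k,i} + δ, y_{k,i})`. -/
def localRisk (p : ℝ≥0∞) (ε : ℝ) (k : Fin K) (w : Vec M) : ℝ :=
  (1 / (S.N k : ℝ)) * ∑ i, ⨆ δ : pBall D p ε, S.Q k w (S.x k i + δ) (S.y k i)

/-- The global adversarial risk `J(w) = (1/K) ∑_k J_k(w)`. -/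
def risk (p : ℝ≥0∞) (ε : ℝ) (w : Vec M) : ℝ :=
  (1 / (K : ℝ)) * ∑ k, S.localRisk p ε k w

/-- Uniqueness of the optimal perturbation, for every model and every sample. -/
def UniquePerturbation (p : ℝ≥0∞) (ε : ℝ) : Prop :=
  ∀ (k : Fin K) (i : Fin (S.N k)) (w : Vec M), ∃! δ : Vec D, δ ∈ pBall D p ε ∧
    ∀ δ' ∈ pBall D p ε, S.Q k w (S.x k i + δ') (S.y k i) ≤ S.Q k w (S.x k i + δ) (S.y k i)

/-- The losses are differentiable in `w` and in `x`, and both gradients are Lipschitz in `w` and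
in `x` with constant `L`. -/
structure Smooth (L : ℝ) : Prop where
  diff_w : ∀ k x y, Differentiable ℝ (fun w => S.Q k w x y)
  diff_x : ∀ k w y, Differentiable ℝ (fun x => S.Q k w x y)
  lip_ww : ∀ k w₁ w₂ x y, ‖S.gradW k w₂ x y - S.gradW k w₁ x y‖ ≤ L * ‖w₂ - w₁‖
  lip_wx : ∀ k w x₁ x₂ y, ‖S.gradW k w x₂ y - S.gradW k w x₁ y‖ ≤ L * ‖x₂ - x₁‖
  lip_xw : ∀ k w₁ w₂ x y, ‖S.gradX k w₂ x y - S.gradX k w₁ x y‖ ≤ L * ‖w₂ - w₁‖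
  lip_xx : ∀ k w x₁ x₂ y, ‖S.gradX k w x₂ y - S.gradX k w x₁ y‖ ≤ L * ‖x₂ - x₁‖

/-! ### The algorithms -/

/-- An attack: the perturbation `δ̂` used by agent `k` at the model `w` for the sample `i`. -/
abbrev Attack := ∀ k : Fin K, Vec M → Fin (S.N k) → Vec D

/-- An attack is only required to respect the perturbation bound (and to be measurable). -/
structure IsAttack (p : ℝ≥0∞) (ε : ℝ) (att : S.Attack) : Prop where
  mem_ball : ∀ k w i, att k w i ∈ pBall D p ε
  meas : ∀ k i, Measurable (fun w => att k w i)

/-- `∇_w Q_k(w; x̂_{k,i}, y_{k,i})` with the perturbed sample `x̂_{k,i} = x_{k,i} + δ̂`. -/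
def advGrad (att : S.Attack) (k : Fin K) (w : Vec M) (i : Fin (S.N k)) : Vec M :=
  S.gradW k w (S.x k i + att k w i) (S.y k i)

/-- The mini-batches drawn by all agents in one iteration (sample indices). -/
abbrev Batch (B : ℕ) := ∀ k : Fin K, Fin B → Fin (S.N k)

/-- One iteration with step size `μ`, in unified form:
`w_k ← ∑_ℓ [A₂]_{ℓk} ( ∑_m [A₁]_{mℓ} w_m - (μ/B) ∑_b ∇_w Q_ℓ(w_ℓ; x̂_ℓ^b, y_ℓ^b) )`. -/
def step (att : S.Attack) (A₁ A₂ : Matrix (Fin K) (Fin K) ℝ) (μ : ℝ) (B : ℕ)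
    (W : State K M) (ξ : S.Batch B) : State K M :=
  fun k => ∑ l, A₂ l k • ((∑ m, A₁ m l • W m)
    - (μ / (B : ℝ)) • ∑ b, S.advGrad att l (W l) (ξ l b))

/-- The law of the network state after `m` iterations, when the starting state has law `ν` and in
each iteration all `K * B` samples are drawn uniformly from the training sets (each agent from its
own), independently of each other and of the past. -/
def law (att : S.Attack) (A₁ A₂ : Matrix (Fin K) (Fin K) ℝ) (μ : ℝ) (B : ℕ)
    (ν : Measure (State K M)) : ℕ → Measure (State K M)
  | 0 => ν
  | m + 1 => (law att A₁ A₂ μ B ν m).bind fun W =>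
      (ProbabilityTheory.uniformOn (Set.univ : Set (S.Batch B))).map
        (S.step att A₁ A₂ μ B W)

/-- The law of `(w_{1,n}, …, w_{K,n})` under strategy `s`. The starting point carries the index
`-1`, so that `n + 1` iterations have been made. -/
def iterLaw (att : S.Attack) (A : Matrix (Fin K) (Fin K) ℝ) (s : Strategy) (μ : ℝ) (B : ℕ)
    (ν : Measure (State K M)) (n : ℕ) : Measure (State K M) :=
  S.law att (s.A₁ A) (s.A₂ A) μ B ν (n + 1)

/-- The excess risk (escaping efficiency)
`ER_n = (1/K) ∑_k 𝔼 J(w_{k,n}) - J(w⋆)` of strategy `s`. -/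
def excessRisk (p : ℝ≥0∞) (ε : ℝ) (att : S.Attack) (A : Matrix (Fin K) (Fin K) ℝ)
    (s : Strategy) (μ : ℝ) (B : ℕ) (ν : Measure (State K M)) (wStar : Vec M) (n : ℕ) : ℝ :=
  (1 / (K : ℝ)) * ∑ k, ∫ W, S.risk p ε (W k) ∂(S.iterLaw att A s μ B ν n)
    - S.risk p ε wStar

/-! ### The quantities in the closed forms -/

/-- The gradient noise `s_k(w)` of a single sample `i`. -/
def noise (att : S.Attack) (k : Fin K) (w : Vec M) (i : Fin (S.N k)) : Vec M :=
  S.advGrad att k w i - (1 / (S.N k : ℝ)) • ∑ j, S.advGrad att k w j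

/-- `R̄_s = 𝔼 (1/K ∑_k s_k(w)) (1/K ∑_ℓ s_ℓ(w))ᵀ`, one uniform sample per agent, drawn
independently. -/
def noiseCov (att : S.Attack) (w : Vec M) : Matrix (Fin M) (Fin M) ℝ :=
  (1 / (Fintype.card (∀ k, Fin (S.N k)) : ℝ)) • ∑ i : (∀ k, Fin (S.N k)),
    Matrix.vecMulVec (fun a => ((1 / (K : ℝ)) • ∑ k, S.noise att k w (i k)) a)
      (fun a => ((1 / (K : ℝ)) • ∑ k, S.noise att k w (i k)) a)

/-- `H̄ = ∇² J(w)`. -/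
def Hbar (p : ℝ≥0∞) (ε : ℝ) (w : Vec M) : Matrix (Fin M) (Fin M) ℝ :=
  hessMatrix (S.risk p ε) w

/-- `d = col_k {∇ J_k(w)}`. -/
def dVec (p : ℝ≥0∞) (ε : ℝ) (w : Vec M) : Fin K × Fin M → ℝ :=
  fun q => gradient (S.localRisk p ε q.1) w q.2

/-- `e(n) = (1/4) Tr ((I - (I - μ H̄)^{2(n+1)}) R̄_s)`. -/
def eFun (p : ℝ≥0∞) (ε : ℝ) (att : S.Attack) (μ : ℝ) (wStar : Vec M) (n : ℕ) : ℝ :=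
  (1 / 4) * ((1 - (1 - μ • S.Hbar p ε wStar) ^ (2 * (n + 1))) * S.noiseCov att wStar).trace

/-- `𝒱_α = V_α ⊗ I_M`. -/
def bigV (M : ℕ) (V : Matrix (Fin K) (Fin (K - 1)) ℝ) :
    Matrix (Fin K × Fin M) (Fin (K - 1) × Fin M) ℝ :=
  V ⊗ₖ (1 : Matrix (Fin M) (Fin M) ℝ)

/-- `𝒫_α = P_α ⊗ I_M`. -/
def bigP (M : ℕ) (lam : Fin (K - 1) → ℝ) :
    Matrix (Fin (K - 1) × Fin M) (Fin (K - 1) × Fin M) ℝ :=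
  Matrix.diagonal lam ⊗ₖ (1 : Matrix (Fin M) (Fin M) ℝ)

/-- `f_con(n) = (1/2K) ‖dᵀ 𝒱_α (I - 𝒫_α)⁻¹ (I - 𝒫_α^{n+1})‖²_{I ⊗ H̄}`. -/
def fCon (p : ℝ≥0∞) (ε : ℝ) (V : Matrix (Fin K) (Fin (K - 1)) ℝ) (lam : Fin (K - 1) → ℝ)
    (wStar : Vec M) (n : ℕ) : ℝ :=
  (1 / (2 * (K : ℝ))) *
    wSq ((1 : Matrix (Fin (K - 1)) (Fin (K - 1)) ℝ) ⊗ₖ S.Hbar p ε wStar)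
      (S.dVec p ε wStar ᵥ*
        (bigV M V * (1 - bigP M lam)⁻¹ * (1 - bigP M lam ^ (n + 1))))

/-- `f_dif(n) = (1/2K) ‖dᵀ 𝒱_α 𝒫_α (I - 𝒫_α)⁻¹ (I - 𝒫_α^{n+1})‖²_{I ⊗ H̄}`. -/
def fDif (p : ℝ≥0∞) (ε : ℝ) (V : Matrix (Fin K) (Fin (K - 1)) ℝ) (lam : Fin (K - 1) → ℝ)
    (wStar : Vec M) (n : ℕ) : ℝ :=
  (1 / (2 * (K : ℝ))) *
    wSq ((1 : Matrix (Fin (K - 1)) (Fin (K - 1)) ℝ) ⊗ₖ S.Hbar p ε wStar)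
      (S.dVec p ε wStar ᵥ*
        (bigV M V * bigP M lam * (1 - bigP M lam)⁻¹ * (1 - bigP M lam ^ (n + 1))))

end Problem

end AdvNet

end

open scoped BigOperators RealInnerProductSpace

universe u

/-! Write $u_k=w_k-w^\star$ and split the network error into its centroid (`mean`) and the
deviations from it (`centre`). The combination matrices are doubly stochastic, so the centroid
performs a stochastic gradient step on $J$ up to small errors, and it is a slow variable on the time
scale $1/\mu$. Deviations are contracted in every step by a factor $\theta=\max_j|\lambda_j|<1$
(`IsSpectral.abs_lt_one`), or wiped out in the centralized case.

At $w^\star$ the local gradients $d$ balance but do not vanish. They push the agents apart by a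
deterministic amount $-\mu D_n$, where $D_n$ is `drift`. After subtraction of this amount, a
deviation of second moment $O(\delta^2\mu^2)$ remains, where $\delta\to0$ is a rate with
$\rho\le\delta$ and $\mu\le\delta^2$ (`exists_rate`). The gradient noise adds a variance
$\mu^2/B=O(\mu^3)$ per step, so over $O(1/\mu)$ steps the centroid keeps a second moment $O(\mu^2)$
and a fourth moment $O(\mu^3)$ (`exists_bound_of_recursion`, `exists_moment_bound`).

Now expand $J$ to second order. The average of $\langle\bar Hu_k,u_k\rangle$ is the quadratic form
of the centroid plus the average quadratic form of the deviations (`sum_quadratic_eq`). For the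
centroid, each step replaces a weight $T$ by $(I-\mu\bar H)T(I-\mu\bar H)$ and adds the noise power
of $T$. Unrolling from $T=\bar H$ gives a geometric sum that telescopes to $\frac\mu Be(n)$
(`sum_mul_contraction_pow`, `StepBounds.abs_integral_hessian_sub_le`). The deviations contribute
$\mu^2$ times the energy of $D_n$. In the eigenbasis of $A$ the components of $D_n$ are geometric
sums, which gives $f_{con}$ and $f_{dif}$, and $0$ for the centralized method
(`Strategy.sum_drift_eq`).

Diffusion also mixes the gradients, so each eigencomponent of its drift carries an extra factor
$\lambda_j$. As $\bar H$ is positive semidefinite at a local minimizer, $f_{dif}\le f_{con}$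
follows. The geometric sums are bounded below by $1-\theta$ uniformly in $n$, which makes the gaps
quantitative (`Problem.fDif_bounds`) and the ordering exact once they dominate the $o(\mu^2)$
remainder.

The maximum over perturbations enters only through a comparison: robust risk minus unperturbed risk
is Lipschitz with constant $LD\epsilon=O(\mu^2)$, and every admissible attack changes the gradients
by at most the same amount. -/

namespace AdvNet

/-! ### Scalar inequalities behind the one-step moment bounds -/

section Scalar

theorem add_pow_four_le (a b : ℝ) : (a + b) ^ 4 ≤ 8 * (a ^ 4 + b ^ 4) := by
  have h1 : (a + b) ^ 2 ≤ 2 * (a ^ 2 + b ^ 2) := by nlinarith [sq_nonneg (a - b)]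
  have h2 : ((a + b) ^ 2) ^ 2 ≤ (2 * (a ^ 2 + b ^ 2)) ^ 2 := by gcongr
  nlinarith [sq_nonneg (a ^ 2 - b ^ 2)]

theorem add_add_sq_le (a b c : ℝ) : (a + b + c) ^ 2 ≤ 3 * (a ^ 2 + b ^ 2 + c ^ 2) := by
  nlinarith [sq_nonneg (a - b), sq_nonneg (b - c), sq_nonneg (a - c)]

theorem add_add_pow_four_le (a b c : ℝ) : (a + b + c) ^ 4 ≤ 27 * (a ^ 4 + b ^ 4 + c ^ 4) := by
  have h2 : ((a + b + c) ^ 2) ^ 2 ≤ (3 * (a ^ 2 + b ^ 2 + c ^ 2)) ^ 2 := by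
    gcongr
    exact add_add_sq_le a b c
  nlinarith [add_add_sq_le (a ^ 2) (b ^ 2) (c ^ 2)]

/-- Convexity of the square. -/
theorem convex_add_sq_le {θ y t : ℝ} (h0 : 0 ≤ θ) (h1 : θ ≤ 1) :
    (θ * y + (1 - θ) * t) ^ 2 ≤ θ * y ^ 2 + (1 - θ) * t ^ 2 := by
  nlinarith [mul_nonneg (mul_nonneg h0 (sub_nonneg.2 h1)) (sq_nonneg (y - t))]

theorem convex_add_pow_four_le {θ y t : ℝ} (h0 : 0 ≤ θ) (h1 : θ ≤ 1) :
    (θ * y + (1 - θ) * t) ^ 4 ≤ θ * y ^ 4 + (1 - θ) * t ^ 4 := by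
  have h := convex_add_sq_le (y := y) (t := t) h0 h1
  have h' := convex_add_sq_le (y := y ^ 2) (t := t ^ 2) h0 h1
  calc (θ * y + (1 - θ) * t) ^ 4 = ((θ * y + (1 - θ) * t) ^ 2) ^ 2 := by ring
    _ ≤ (θ * y ^ 2 + (1 - θ) * t ^ 2) ^ 2 := by gcongr
    _ ≤ _ := by nlinarith

variable {C μ x y α Z θ : ℝ}

/-- Here `x` and `y` are the sizes of centroid and deviation, `α` bounds the deterministic part of a
step and `Z` the noise variance. The cross term costs $2C\mu xq\le C\mu(x^2+q^2)$, so $x^2$ is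
multiplied by $1+O(\mu)$ only, which stays bounded over $O(1/\mu)$ steps. -/
theorem centroid_sq_le (hC : 1 ≤ C) (hμ : 0 < μ) (hμ1 : μ ≤ 1) (hx : 0 ≤ x) (hy : 0 ≤ y)
    (hα : 0 ≤ α) (h : α ≤ x + C * μ * (x + y + μ))
    (hZ : Z ≤ C * μ ^ 3 * (1 + (x + y + μ) ^ 2)) :
    α ^ 2 + Z ≤ (1 + 10 * C ^ 2 * μ) * x ^ 2 + 10 * C ^ 2 * μ * y ^ 2 + 10 * C ^ 2 * μ ^ 3 := by
  have hq := add_add_sq_le x y μ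
  set q := x + y + μ with hqdef
  have hq0 : 0 ≤ q := by positivity
  have h1 : α ^ 2 ≤ (x + C * μ * q) ^ 2 := by gcongr
  have h2 : (x + C * μ * q) ^ 2 ≤ x ^ 2 + C * μ * (x ^ 2 + q ^ 2) + C ^ 2 * μ * q ^ 2 := by
    have : (C ^ 2 * q ^ 2 * μ) * μ ≤ (C ^ 2 * q ^ 2 * μ) * 1 := by gcongr
    nlinarith [mul_nonneg (mul_nonneg (zero_le_one.trans hC) hμ.le) (sq_nonneg (x - q))]
  have h3 : Z ≤ C * μ ^ 3 + C * μ * q ^ 2 := by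
    have : μ ^ 3 ≤ μ := by
      calc μ ^ 3 ≤ μ ^ 1 := pow_le_pow_of_le_one hμ.le hμ1 (by norm_num)
        _ = μ := pow_one μ
    have : C * q ^ 2 * μ ^ 3 ≤ C * q ^ 2 * μ := by gcongr
    linarith
  have hCC : C ≤ C ^ 2 := by nlinarith
  have h4 : C * (μ * x ^ 2) ≤ C ^ 2 * (μ * x ^ 2) := by gcongr
  have h5 : C * (μ * q ^ 2) ≤ C ^ 2 * (μ * q ^ 2) := by gcongr
  have h6 : C ^ 2 * (μ * q ^ 2) ≤ C ^ 2 * (μ * (3 * (x ^ 2 + y ^ 2 + μ ^ 2))) := by gcongr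
  have h7 : C * μ ^ 3 ≤ C ^ 2 * μ ^ 3 := by gcongr
  have h8 : 0 ≤ C ^ 2 * (μ * y ^ 2) := by positivity
  linarith

/-- Convexity with weights $\theta$ and $1-\theta$, at the points $y$ and $t=C\mu q/(1-\theta)$,
keeps the contraction factor $\theta$ intact. The perturbation costs only
$(1-\theta)t^2=O(\mu^2q^2)$. -/
theorem deviation_sq_le (hC : 1 ≤ C) (hμ : 0 < μ) (hμ1 : μ ≤ 1) (hx : 0 ≤ x) (hy : 0 ≤ y)
    (hθ0 : 0 ≤ θ) (hθ1 : θ < 1)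
    (hα : 0 ≤ α) (h : α ≤ θ * y + C * μ * (x + y + μ))
    (hZ : Z ≤ C * μ ^ 3 * (1 + (x + y + μ) ^ 2)) :
    α ^ 2 + Z ≤ (θ + 7 * C ^ 2 / (1 - θ) * μ) * y ^ 2 + 7 * C ^ 2 / (1 - θ) * μ * x ^ 2
      + 7 * C ^ 2 / (1 - θ) * μ ^ 3 := by
  have hq := add_add_sq_le x y μ
  set q := x + y + μ with hqdef
  have hq0 : 0 ≤ q := by positivity
  have hg : 0 < 1 - θ := by linarith
  set t := C * μ * q / (1 - θ) with ht
  have ht' : C * μ * q = (1 - θ) * t := by rw [ht]; field_simp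
  set R := C ^ 2 / (1 - θ) with hR
  have hR0 : 0 ≤ R := by positivity
  have hCR : C ≤ R := by
    rw [hR, le_div_iff₀ hg]
    nlinarith [mul_nonneg (zero_le_one.trans hC) hθ0]
  have h1 : α ^ 2 ≤ (θ * y + (1 - θ) * t) ^ 2 := by rw [← ht']; gcongr
  have h2 := h1.trans (convex_add_sq_le hθ0 hθ1.le)
  have h3 : (1 - θ) * t ^ 2 = R * μ * (μ * q ^ 2) := by rw [ht, hR]; field_simp
  have h3' : R * μ * (μ * q ^ 2) ≤ R * μ * (1 * q ^ 2) := by gcongr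
  have h4 : Z ≤ R * μ ^ 3 + R * μ * q ^ 2 := by
    have : μ ^ 3 ≤ μ := by
      calc μ ^ 3 ≤ μ ^ 1 := pow_le_pow_of_le_one hμ.le hμ1 (by norm_num)
        _ = μ := pow_one μ
    have h5 : R * q ^ 2 * μ ^ 3 ≤ R * q ^ 2 * μ := by gcongr
    have h6 : C * (μ ^ 3 * (1 + q ^ 2)) ≤ R * (μ ^ 3 * (1 + q ^ 2)) := by gcongr
    linarith
  have h6 : R * μ * q ^ 2 ≤ R * μ * (3 * (x ^ 2 + y ^ 2 + μ ^ 2)) := by gcongr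
  have e : 7 * C ^ 2 / (1 - θ) = 7 * R := by rw [hR]; ring
  rw [e]
  have h8 : 0 ≤ R * μ * x ^ 2 := by positivity
  have h9 : 0 ≤ R * μ * y ^ 2 := by positivity
  linarith

/-- The noise enters at the level $\mu^4$, which accumulates to fourth moments of order $\mu^3$ over
$O(1/\mu)$ steps. The constant 3000 is a generous rounding. -/
theorem centroid_pow_four_le {Z₂ Z₄ : ℝ} (hC : 1 ≤ C) (hμ : 0 < μ) (hμ1 : μ ≤ 1) (hx : 0 ≤ x)
    (hy : 0 ≤ y) (hα : 0 ≤ α) (h : α ≤ x + C * μ * (x + y + μ))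
    (hZ₂ : Z₂ ≤ C * μ ^ 3 * (1 + (x + y + μ) ^ 2))
    (hZ₄ : Z₄ ≤ C * μ ^ 4 * (1 + (x + y + μ) ^ 4)) :
    α ^ 4 + 8 * α ^ 2 * Z₂ + 3 * Z₄ ≤
      (1 + 3000 * C ^ 5 * μ) * x ^ 4 + 3000 * C ^ 5 * μ * y ^ 4 + 3000 * C ^ 5 * μ ^ 4 := by
  have hq := add_add_pow_four_le x y μ
  set q := x + y + μ with hqdef
  have hq0 : 0 ≤ q := by positivity
  -- Cauchy–Schwarz for $1\cdot x+\sqrt\mu\cdot\sqrt\mu\,Cq$.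
  have hα2 : α ^ 2 ≤ (1 + μ) * (x ^ 2 + μ * (C * q) ^ 2) := by
    calc α ^ 2 ≤ (x + C * μ * q) ^ 2 := by gcongr
      _ ≤ _ := by nlinarith [mul_nonneg hμ.le (sq_nonneg (x - C * q))]
  have hα4 : α ^ 4 ≤ (1 + 7 * μ) * x ^ 4 + 8 * C ^ 4 * (μ * q ^ 4) := by
    have e1 : (x ^ 2 + μ * (C * q) ^ 2) ^ 2 ≤ (1 + μ) * (x ^ 4 + μ * (C * q) ^ 4) := by
      nlinarith [mul_nonneg hμ.le (sq_nonneg (x ^ 2 - (C * q) ^ 2))]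
    have e2 : (1 + μ) ^ 3 ≤ 1 + 7 * μ := by nlinarith [mul_pos hμ hμ]
    have e2' : (1 + μ) ^ 3 ≤ 8 := by linarith
    calc α ^ 4 = (α ^ 2) ^ 2 := by ring
      _ ≤ ((1 + μ) * (x ^ 2 + μ * (C * q) ^ 2)) ^ 2 := by gcongr
      _ = (1 + μ) ^ 2 * (x ^ 2 + μ * (C * q) ^ 2) ^ 2 := by ring
      _ ≤ (1 + μ) ^ 2 * ((1 + μ) * (x ^ 4 + μ * (C * q) ^ 4)) := by gcongr
      _ = (1 + μ) ^ 3 * x ^ 4 + (1 + μ) ^ 3 * (C ^ 4 * (μ * q ^ 4)) := by ring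
      _ ≤ (1 + 7 * μ) * x ^ 4 + 8 * (C ^ 4 * (μ * q ^ 4)) := by gcongr
      _ = _ := by ring
  have m5 : μ ^ 5 ≤ μ ^ 4 := pow_le_pow_of_le_one hμ.le hμ1 (by norm_num)
  have m41 : μ ^ 4 ≤ μ := by
    calc μ ^ 4 ≤ μ ^ 1 := pow_le_pow_of_le_one hμ.le hμ1 (by norm_num)
      _ = μ := pow_one μ
  have m51 : μ ^ 5 ≤ μ := m5.trans m41
  have C0 : 0 ≤ C := by linarith
  have b1 : 8 * α ^ 2 * Z₂ ≤ 8 * C * (μ * α ^ 4) + 4 * C * μ ^ 4 + 4 * C * (μ * q ^ 4) := by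
    have i1 : 8 * α ^ 2 * Z₂ ≤ 8 * α ^ 2 * (C * μ ^ 3 * (1 + q ^ 2)) := by gcongr
    have i2 : 2 * (α ^ 2 * μ ^ 3) ≤ μ * α ^ 4 + μ ^ 5 := by
      linarith [mul_nonneg hμ.le (sq_nonneg (α ^ 2 - μ ^ 2))]
    have i3 : 2 * (α ^ 2 * μ ^ 3 * q ^ 2) ≤ μ * α ^ 4 + μ * q ^ 4 := by
      have j1 : α ^ 2 * q ^ 2 * μ ^ 3 ≤ α ^ 2 * q ^ 2 * μ := by
        gcongr
        calc μ ^ 3 ≤ μ ^ 1 := pow_le_pow_of_le_one hμ.le hμ1 (by norm_num)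
          _ = μ := pow_one μ
      linarith [mul_nonneg hμ.le (sq_nonneg (α ^ 2 - q ^ 2))]
    have i4 := mul_le_mul_of_nonneg_left i2 C0
    have i5 := mul_le_mul_of_nonneg_left i3 C0
    have i6 := mul_le_mul_of_nonneg_left m5 C0
    linarith
  have b2 : 3 * Z₄ ≤ 3 * C * μ ^ 4 + 3 * C * (μ * q ^ 4) := by
    have : C * q ^ 4 * μ ^ 4 ≤ C * q ^ 4 * μ := by gcongr
    linarith
  have c15 : C ≤ C ^ 5 := by
    calc C = C ^ 1 := (pow_one C).symm
      _ ≤ C ^ 5 := pow_le_pow_right₀ hC (by norm_num)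
  have c45 : C ^ 4 ≤ C ^ 5 := pow_le_pow_right₀ hC (by norm_num)
  have one5 : 1 ≤ C ^ 5 := one_le_pow₀ hC
  have b3 : (1 + 8 * C * μ) * α ^ 4 ≤ (1 + 71 * C ^ 5 * μ) * x ^ 4 + 72 * C ^ 5 * (μ * q ^ 4) := by
    have j1 : (1 + 8 * C * μ) * (1 + 7 * μ) ≤ 1 + 71 * C ^ 5 * μ := by
      have : C * μ * μ ≤ C * μ * 1 := by gcongr
      have : C * μ ≤ C ^ 5 * μ := by gcongr
      have : 1 * μ ≤ C ^ 5 * μ := by gcongr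
      linarith
    have j2 : (1 + 8 * C * μ) * (8 * C ^ 4) ≤ 72 * C ^ 5 := by
      have : C ^ 5 * μ ≤ C ^ 5 * 1 := by gcongr
      linarith
    calc (1 + 8 * C * μ) * α ^ 4
        ≤ (1 + 8 * C * μ) * ((1 + 7 * μ) * x ^ 4 + 8 * C ^ 4 * (μ * q ^ 4)) := by gcongr
      _ = (1 + 8 * C * μ) * (1 + 7 * μ) * x ^ 4
          + (1 + 8 * C * μ) * (8 * C ^ 4) * (μ * q ^ 4) := by ring
      _ ≤ _ := by gcongr
  have b4 : C * (μ * q ^ 4) ≤ C ^ 5 * (μ * q ^ 4) := by gcongr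
  have b5 : C ^ 5 * (μ * q ^ 4) ≤ C ^ 5 * (μ * (27 * (x ^ 4 + y ^ 4 + μ ^ 4))) := by gcongr
  have b6 : C * μ ^ 4 ≤ C ^ 5 * μ ^ 4 := by gcongr
  have b7 : C ^ 5 * μ ^ 5 ≤ C ^ 5 * μ ^ 4 := by gcongr
  have b8 : 0 ≤ C ^ 5 * (μ * y ^ 4) := by positivity
  have b9 : 0 ≤ C ^ 5 * (μ * x ^ 4) := by positivity
  have b10 : 0 ≤ C ^ 5 * μ ^ 4 := by positivity
  linarith

theorem deviation_pow_four_le {S₄ : ℝ} (hC : 1 ≤ C) (hμ : 0 < μ) (hμ1 : μ ≤ 1) (hx : 0 ≤ x)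
    (hy : 0 ≤ y) (hθ1 : θ < 1)
    (hS : S₄ ≤ C * (1 + (x + y + μ) ^ 4)) :
    θ * y ^ 4 + 8 * μ ^ 4 / (1 - θ) ^ 3 * ((C * (x + y + μ)) ^ 4 + S₄) ≤
      (θ + 448 * C ^ 4 / (1 - θ) ^ 3 * μ) * y ^ 4 + 448 * C ^ 4 / (1 - θ) ^ 3 * μ * x ^ 4
        + 448 * C ^ 4 / (1 - θ) ^ 3 * μ ^ 4 := by
  have hq := add_add_pow_four_le x y μ
  set q := x + y + μ with hqdef
  have hq0 : 0 ≤ q := by positivity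
  have hg : 0 < 1 - θ := by linarith
  set R := C ^ 4 / (1 - θ) ^ 3 with hR
  have hR0 : 0 ≤ R := by positivity
  have e : 448 * C ^ 4 / (1 - θ) ^ 3 = 448 * R := by rw [hR]; ring
  rw [e]
  have c14 : C ≤ C ^ 4 := by
    calc C = C ^ 1 := (pow_one C).symm
      _ ≤ C ^ 4 := pow_le_pow_right₀ hC (by norm_num)
  have h1 : (C * q) ^ 4 + S₄ ≤ 2 * C ^ 4 * (1 + q ^ 4) := by
    have : C * (1 + q ^ 4) ≤ C ^ 4 * (1 + q ^ 4) := by gcongr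
    have : 0 ≤ C ^ 4 := by positivity
    rw [mul_pow]
    linarith
  have h2 : 8 * μ ^ 4 / (1 - θ) ^ 3 * ((C * q) ^ 4 + S₄) ≤ 16 * R * (μ ^ 4 * (1 + q ^ 4)) := by
    calc _ ≤ 8 * μ ^ 4 / (1 - θ) ^ 3 * (2 * C ^ 4 * (1 + q ^ 4)) := by gcongr
      _ = _ := by rw [hR]; ring
  have m41 : μ ^ 4 ≤ μ := by
    calc μ ^ 4 ≤ μ ^ 1 := pow_le_pow_of_le_one hμ.le hμ1 (by norm_num)
      _ = μ := pow_one μ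
  have h3 : μ ^ 4 * (1 + q ^ 4) ≤ 28 * (μ * x ^ 4 + μ * y ^ 4 + μ ^ 4) := by
    have i1 : μ ^ 4 * q ^ 4 ≤ μ ^ 4 * (27 * (x ^ 4 + y ^ 4 + μ ^ 4)) := by gcongr
    have i2 : μ ^ 4 * x ^ 4 ≤ μ * x ^ 4 := by gcongr
    have i3 : μ ^ 4 * y ^ 4 ≤ μ * y ^ 4 := by gcongr
    have i4 : μ ^ 4 * μ ^ 4 ≤ 1 * μ ^ 4 := by gcongr ?_ * _; exact m41.trans hμ1
    have : 0 ≤ μ * x ^ 4 := by positivity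
    have : 0 ≤ μ * y ^ 4 := by positivity
    linarith
  have h4 : R * (μ ^ 4 * (1 + q ^ 4)) ≤ R * (28 * (μ * x ^ 4 + μ * y ^ 4 + μ ^ 4)) := by gcongr
  linarith

end Scalar

/-! ### Averages over finite and product sample spaces -/

section Average

variable {F : Type*} [NormedAddCommGroup F] [InnerProductSpace ℝ F]

theorem expect_nonneg' {Ω : Type*} [Fintype Ω] {f : Ω → ℝ} (h : ∀ i, 0 ≤ f i) : 0 ≤ 𝔼 i, f i :=
  Finset.expect_nonneg fun i _ => h i

theorem expect_mono {Ω : Type*} [Fintype Ω] {f g : Ω → ℝ} (h : ∀ i, f i ≤ g i) :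
    𝔼 i, f i ≤ 𝔼 i, g i :=
  Finset.expect_le_expect fun i _ => h i

theorem abs_expect_le {Ω : Type*} [Fintype Ω] (f : Ω → ℝ) : |𝔼 i, f i| ≤ 𝔼 i, |f i| := by
  rw [abs_le, ← Finset.expect_neg_distrib]
  exact ⟨expect_mono fun i => neg_abs_le _, expect_mono fun i => le_abs_self _⟩

theorem norm_average_le {Ω : Type*} [Fintype Ω] (f : Ω → F) :
    ‖(1 / (Fintype.card Ω : ℝ)) • ∑ i, f i‖ ≤ 𝔼 i, ‖f i‖ := by
  rw [norm_smul, Fintype.expect_eq_sum_div_card, Real.norm_of_nonneg (by positivity),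
    one_div, ← inv_mul_eq_div]
  gcongr
  exact norm_sum_le _ _

theorem expect_inner_eq_zero {Ω : Type*} [Fintype Ω] (f : Ω → F) (hf : ∑ i, f i = 0) (x : F) :
    𝔼 i, ⟪f i, x⟫ = 0 := by
  rw [Fintype.expect_eq_sum_div_card, ← sum_inner, hf, inner_zero_left, zero_div]

theorem expect_inner_eq_zero' {Ω : Type*} [Fintype Ω] (f : Ω → F) (hf : ∑ i, f i = 0) (x : F) :
    𝔼 i, ⟪x, f i⟫ = 0 := by
  rw [Fintype.expect_eq_sum_div_card, ← inner_sum, hf, inner_zero_right, zero_div]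

theorem expect_quadratic_add {Ω : Type*} [Fintype Ω] [Nonempty Ω] (T : F →L[ℝ] F) (a : F)
    (z : Ω → F) (hz : ∑ i, z i = 0) :
    𝔼 i, ⟪T (a + z i), a + z i⟫ = ⟪T a, a⟫ + 𝔼 i, ⟪T (z i), z i⟫ := by
  have h : ∀ i, ⟪T (a + z i), a + z i⟫
      = ⟪T a, a⟫ + (⟪T a, z i⟫ + ⟪T (z i), a⟫) + ⟪T (z i), z i⟫ := by
    intro i
    rw [map_add, inner_add_left, inner_add_right, inner_add_right]
    ring
  simp_rw [h]
  rw [Finset.expect_add_distrib, Finset.expect_add_distrib, Finset.expect_add_distrib,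
    expect_inner_eq_zero' z hz, expect_inner_eq_zero (fun i => T (z i)) (by rw [← map_sum, hz, map_zero]),
    Finset.expect_const Finset.univ_nonempty]
  ring

theorem expect_norm_add_sq {Ω : Type*} [Fintype Ω] [Nonempty Ω] (a : F)
    (z : Ω → F) (hz : ∑ i, z i = 0) :
    𝔼 i, ‖a + z i‖ ^ 2 = ‖a‖ ^ 2 + 𝔼 i, ‖z i‖ ^ 2 := by
  have := expect_quadratic_add (ContinuousLinearMap.id ℝ F) a z hz
  simpa using this

/-- After the square of $\|a+z\|^2$ is expanded, Young's inequality absorbs the cubic term, and the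
only odd term left is linear in $z$, with mean zero. -/
theorem expect_norm_add_pow_four_le {Ω : Type*} [Fintype Ω] [Nonempty Ω] (a : F)
    (z : Ω → F) (hz : ∑ i, z i = 0) :
    𝔼 i, ‖a + z i‖ ^ 4 ≤ ‖a‖ ^ 4 + 8 * ‖a‖ ^ 2 * (𝔼 i, ‖z i‖ ^ 2) + 3 * 𝔼 i, ‖z i‖ ^ 4 := by
  have h : ∀ i, ‖a + z i‖ ^ 4 ≤ ‖a‖ ^ 4 + 4 * ‖a‖ ^ 2 * ⟪a, z i⟫ + 8 * ‖a‖ ^ 2 * ‖z i‖ ^ 2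
      + 3 * ‖z i‖ ^ 4 := by
    intro i
    have h1 : ‖a + z i‖ ^ 2 = ‖a‖ ^ 2 + 2 * ⟪a, z i⟫ + ‖z i‖ ^ 2 := norm_add_sq_real a (z i)
    have h2 : ⟪a, z i⟫ ^ 2 ≤ ‖a‖ ^ 2 * ‖z i‖ ^ 2 := by
      rw [← mul_pow]
      exact sq_le_sq' (neg_le_of_abs_le (abs_real_inner_le_norm a (z i)))
        (real_inner_le_norm a (z i))
    have h3 : ‖a + z i‖ ^ 4 = (‖a‖ ^ 2 + 2 * ⟪a, z i⟫ + ‖z i‖ ^ 2) ^ 2 := by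
      rw [← h1]; ring
    rw [h3]
    nlinarith [sq_nonneg (⟪a, z i⟫ - ‖z i‖ ^ 2)]
  refine (expect_mono h).trans ?_
  rw [Finset.expect_add_distrib, Finset.expect_add_distrib, Finset.expect_add_distrib,
    Finset.expect_const Finset.univ_nonempty, ← Finset.mul_expect, ← Finset.mul_expect,
    ← Finset.mul_expect, expect_inner_eq_zero' z hz]
  linarith

variable {ι : Type*} [Fintype ι] [DecidableEq ι] {Ω : ι → Type*} [∀ i, Fintype (Ω i)]

/-- Resampling one coordinate does not change an average over a product space. -/
theorem expect_update [∀ i, Nonempty (Ω i)] (i : ι) (f : (∀ j, Ω j) → ℝ) :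
    𝔼 ω, 𝔼 x, f (Function.update ω i x) = 𝔼 ω, f ω := by
  -- Splitting off coordinate `i` writes the average as an iterated one; resampling that coordinate
  -- then only renames the inner variable.
  have key : ∀ g : (∀ j, Ω j) → ℝ, 𝔼 ω, g ω
      = 𝔼 x, 𝔼 η : (∀ j : {j // j ≠ i}, Ω j), g ((Equiv.piSplitAt i Ω).symm (x, η)) := by
    intro g
    rw [Fintype.expect_equiv (Equiv.piSplitAt i Ω) g
      (fun y => g ((Equiv.piSplitAt i Ω).symm y)) (fun ω => by rw [Equiv.symm_apply_apply])]
    rw [← Finset.univ_product_univ, Finset.expect_product]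
  have upd : ∀ (x y : Ω i) (η : ∀ j : {j // j ≠ i}, Ω j),
      Function.update ((Equiv.piSplitAt i Ω).symm (y, η)) i x
        = (Equiv.piSplitAt i Ω).symm (x, η) := by
    intro x y η
    funext j
    by_cases h : j = i
    · subst h; simp [Equiv.piSplitAt]
    · simp [Equiv.piSplitAt, h]
  rw [key f, key]
  simp_rw [upd]
  rw [Finset.expect_const Finset.univ_nonempty, Finset.expect_comm]

theorem expect_apply [∀ i, Nonempty (Ω i)] (i : ι) (f : Ω i → ℝ) :
    𝔼 ω : (∀ j, Ω j), f (ω i) = 𝔼 x, f x := by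
  rw [← expect_update i]
  simp [Finset.expect_const Finset.univ_nonempty]

theorem expect_inner_apply_of_ne [∀ i, Nonempty (Ω i)] {i j : ι} (hij : i ≠ j) (f : Ω i → F)
    (g : Ω j → F) (hf : ∑ x, f x = 0) :
    𝔼 ω : (∀ j, Ω j), ⟪f (ω i), g (ω j)⟫ = 0 := by
  rw [← expect_update i]
  simp [Function.update_of_ne hij.symm, expect_inner_eq_zero f hf]

/-- Independent centred vectors are orthogonal. -/
theorem expect_quadratic_sum [∀ i, Nonempty (Ω i)] (T : F →L[ℝ] F) (f : ∀ i, Ω i → F)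
    (hf : ∀ i, ∑ x, f i x = 0) :
    𝔼 ω : (∀ j, Ω j), ⟪T (∑ i, f i (ω i)), ∑ i, f i (ω i)⟫ = ∑ i, 𝔼 x, ⟪T (f i x), f i x⟫ := by
  simp_rw [map_sum, sum_inner, inner_sum]
  rw [Finset.expect_sum_comm]
  refine Finset.sum_congr rfl fun i _ => ?_
  rw [Finset.expect_sum_comm, Finset.sum_eq_single i]
  · exact expect_apply i (fun x => ⟪T (f i x), f i x⟫)
  · intro j _ hj
    exact expect_inner_apply_of_ne hj.symm (fun x => T (f i x)) (f j)
      (by rw [← map_sum, hf, map_zero])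
  · simp

/-- Testing against arbitrary vectors reduces the claim to scalar averages, where the marginal of a
product is uniform. -/
theorem sum_pi_apply_eq_zero [∀ i, Nonempty (Ω i)] (i : ι) (f : Ω i → F) (hf : ∑ x, f x = 0) :
    ∑ ω : (∀ j, Ω j), f (ω i) = 0 := by
  refine ext_inner_right ℝ fun x => ?_
  have h := expect_apply i (fun y => ⟪f y, x⟫)
  rw [expect_inner_eq_zero f hf, Fintype.expect_eq_sum_div_card, div_eq_zero_iff] at h
  rw [sum_inner, inner_zero_left]
  rcases h with h | h
  · exact h
  · exact absurd h (Nat.cast_ne_zero.2 Fintype.card_ne_zero)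

end Average


/-! ### Centroid, deviations and combination of network states -/

section Network

theorem norm_net_le_sum {K : ℕ} {F : Type*} [NormedAddCommGroup F]
    (u : PiLp 2 (fun _ : Fin K => F)) : ‖u‖ ≤ ∑ k, ‖u k‖ := by
  refine le_of_sq_le_sq ?_ (Finset.sum_nonneg fun k _ => norm_nonneg _)
  rw [PiLp.norm_sq_eq_of_L2]
  exact Finset.sum_sq_le_sq_sum_of_nonneg fun k _ => norm_nonneg _

variable {K : ℕ} {F : Type*} [NormedAddCommGroup F] [InnerProductSpace ℝ F]

/-- Network states with the `ℓ₂` norm. -/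
abbrev Net (K : ℕ) (F : Type*) [NormedAddCommGroup F] := PiLp 2 (fun _ : Fin K => F)

/-- Combination of the agents' models with the weights of `A`. -/
noncomputable def mix (A : Matrix (Fin K) (Fin K) ℝ) : Net K F →ₗ[ℝ] Net K F where
  toFun u := WithLp.toLp 2 fun k => ∑ l, A l k • u l
  map_add' u v := by
    ext k; simp [Finset.sum_add_distrib]
  map_smul' c u := by
    ext k; simp [Finset.smul_sum, smul_comm c]

/-- The centroid of a network state. -/
noncomputable def mean : Net K F →ₗ[ℝ] F where
  toFun u := (1 / (K : ℝ)) • ∑ k, u k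
  map_add' u v := by simp [Finset.sum_add_distrib]
  map_smul' c u := by simp [← Finset.smul_sum, smul_comm c]

/-- The deviation of a network state from its centroid. -/
noncomputable def centre : Net K F →ₗ[ℝ] Net K F where
  toFun u := WithLp.toLp 2 fun k => u k - mean u
  map_add' u v := by
    ext k; simp [add_sub_add_comm]
  map_smul' c u := by
    ext k; simp [smul_sub]

@[simp] theorem mix_apply (A : Matrix (Fin K) (Fin K) ℝ) (u : Net K F) (k : Fin K) :
    mix A u k = ∑ l, A l k • u l := rfl

theorem mean_apply (u : Net K F) : mean u = (1 / (K : ℝ)) • ∑ k, u k := rfl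

@[simp] theorem centre_apply (u : Net K F) (k : Fin K) : centre u k = u k - mean u := rfl

theorem sum_eq_smul_mean [NeZero K] (u : Net K F) : ∑ k, u k = (K : ℝ) • mean u := by
  rw [mean_apply, smul_smul, mul_one_div_cancel (NeZero.ne _), one_smul]

theorem sum_centre [NeZero K] (u : Net K F) : ∑ k, centre u k = 0 := by
  simp [Finset.sum_sub_distrib, sum_eq_smul_mean, ← Nat.cast_smul_eq_nsmul ℝ]

theorem mean_centre [NeZero K] (u : Net K F) : mean (centre u) = 0 := by
  rw [mean_apply, sum_centre, smul_zero]

theorem centre_eq_self {u : Net K F} (h : mean u = 0) : centre u = u := by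
  ext k; simp [h]

/-- The cross terms vanish because deviations from the centroid sum to zero. This identity separates
the noise contribution to the risk from the heterogeneity contribution. -/
theorem sum_quadratic_eq [NeZero K] (T : F →L[ℝ] F) (u : Net K F) :
    ∑ k, ⟪T (u k), u k⟫ = K * ⟪T (mean u), mean u⟫ + ∑ k, ⟪T (centre u k), centre u k⟫ := by
  have h : ∀ k, ⟪T (u k), u k⟫ = ⟪T (mean u), mean u⟫ + ⟪T (mean u), centre u k⟫
      + ⟪T (centre u k), mean u⟫ + ⟪T (centre u k), centre u k⟫ := by
    intro k
    have : u k = mean u + centre u k := by simp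
    conv_lhs => rw [this, map_add, inner_add_left, inner_add_right, inner_add_right]
    ring
  rw [Finset.sum_congr rfl fun k _ => h k, Finset.sum_add_distrib, Finset.sum_add_distrib,
    Finset.sum_add_distrib, ← inner_sum Finset.univ (fun k => centre u k),
    ← sum_inner Finset.univ (fun k => T (centre u k)), ← map_sum T, sum_centre]
  simp

theorem norm_sq_eq [NeZero K] (u : Net K F) : ‖u‖ ^ 2 = K * ‖mean u‖ ^ 2 + ‖centre u‖ ^ 2 := by
  rw [PiLp.norm_sq_eq_of_L2, PiLp.norm_sq_eq_of_L2]
  simpa using sum_quadratic_eq (ContinuousLinearMap.id ℝ F) u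

theorem one_le_cast_of_neZero [NeZero K] : (1 : ℝ) ≤ K :=
  Nat.one_le_cast.2 (Nat.one_le_iff_ne_zero.2 (NeZero.ne K))

theorem norm_centre_le [NeZero K] (u : Net K F) : ‖centre u‖ ≤ ‖u‖ := by
  refine le_of_sq_le_sq ?_ (norm_nonneg u)
  rw [norm_sq_eq u]
  have : 0 ≤ (K : ℝ) * ‖mean u‖ ^ 2 := by positivity
  linarith

theorem norm_mean_le [NeZero K] (u : Net K F) : ‖mean u‖ ≤ ‖u‖ := by
  refine le_of_sq_le_sq ?_ (norm_nonneg u)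
  rw [norm_sq_eq u]
  have h1 : (1 : ℝ) * ‖mean u‖ ^ 2 ≤ K * ‖mean u‖ ^ 2 := by
    gcongr; exact one_le_cast_of_neZero
  nlinarith [sq_nonneg ‖centre u‖]

theorem norm_le_mean_add_centre [NeZero K] (u : Net K F) :
    ‖u‖ ≤ K * ‖mean u‖ + ‖centre u‖ := by
  refine le_of_sq_le_sq ?_ (by positivity)
  rw [norm_sq_eq u]
  have hK : (1 : ℝ) ≤ K := one_le_cast_of_neZero
  have : (K : ℝ) * ‖mean u‖ ^ 2 ≤ K * (K * ‖mean u‖ ^ 2) := by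
    gcongr
    nlinarith [sq_nonneg ‖mean u‖]
  nlinarith [mul_nonneg (mul_nonneg (zero_le_one.trans hK) (norm_nonneg (mean u)))
    (norm_nonneg (centre u))]

theorem mean_mix {A : Matrix (Fin K) (Fin K) ℝ} (hA : ∀ l, ∑ k, A l k = 1) (u : Net K F) :
    mean (mix A u) = mean u := by
  simp only [mean_apply, mix_apply]
  rw [Finset.sum_comm]
  simp_rw [← Finset.sum_smul, hA, one_smul]

theorem mix_centre {A : Matrix (Fin K) (Fin K) ℝ} (hA : ∀ l, ∑ k, A l k = 1)
    (hA' : ∀ k, ∑ l, A l k = 1) (u : Net K F) :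
    centre (mix A u) = mix A (centre u) := by
  ext k
  simp only [centre_apply, mean_mix hA, mix_apply, smul_sub, Finset.sum_sub_distrib,
    ← Finset.sum_smul, hA', one_smul]

theorem mix_one (u : Net K F) : mix (1 : Matrix (Fin K) (Fin K) ℝ) u = u := by
  ext k
  simp [Matrix.one_apply]

theorem mix_uniform (u : Net K F) (hu : mean u = 0) :
    mix (Matrix.of fun _ _ => (1 : ℝ) / K) u = 0 := by
  ext k
  simpa [mean_apply, Finset.smul_sum] using hu

end Network

/-! ### Eigenstructure of the combination matrix -/

section Spectral

variable {K : ℕ} {A : Matrix (Fin K) (Fin K) ℝ} {V : Matrix (Fin K) (Fin (K - 1)) ℝ}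
  {lam : Fin (K - 1) → ℝ}

theorem IsCombination.neZero (hA : IsCombination A) : NeZero K := by
  obtain ⟨k, -⟩ := hA.self_loop
  exact ⟨fun h => by subst h; exact k.elim0⟩

theorem IsCombination.row_sum (hA : IsCombination A) (l : Fin K) : ∑ k, A l k = 1 := by
  rw [← hA.col_sum l]
  exact Finset.sum_congr rfl fun k _ => hA.symm l k

theorem IsSpectral.sum_mul (hV : IsSpectral A V lam) (i j : Fin (K - 1)) :
    ∑ k, V k i * V k j = if i = j then 1 else 0 := by
  have := congrFun (congrFun hV.orthonormal i) j
  simpa [Matrix.mul_apply, Matrix.one_apply] using this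

theorem IsSpectral.entry (hV : IsSpectral A V lam) (l k : Fin K) :
    A l k = 1 / K + ∑ j, V l j * lam j * V k j := by
  have := congrFun (congrFun hV.decomp l) k
  simpa [Matrix.mul_apply, Matrix.diagonal_apply] using this

theorem IsSpectral.mulVec (hV : IsSpectral A V lam) (j : Fin (K - 1)) (l : Fin K) :
    ∑ k, A l k * V k j = lam j * V l j := by
  simp_rw [hV.entry, add_mul, Finset.sum_add_distrib, ← Finset.mul_sum, hV.orth_one, mul_zero,
    zero_add, Finset.sum_mul]
  rw [Finset.sum_comm, Finset.sum_eq_single j]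
  · simp_rw [mul_assoc, ← Finset.mul_sum, hV.sum_mul]
    simp [mul_comm]
  · intro i _ hi
    simp_rw [mul_assoc, ← Finset.mul_sum, hV.sum_mul]
    simp [hi]
  · simp

/-- The columns of $V$ together with $K^{-1/2}\mathbb 1$ form a square matrix with orthonormal
columns, so its rows are orthonormal too. -/
theorem IsSpectral.complete [NeZero K] (hV : IsSpectral A V lam) (k l : Fin K) :
    ∑ j, V k j * V l j = (if k = l then 1 else 0) - 1 / K := by
  have hK : (0 : ℝ) < K := Nat.cast_pos.2 (Nat.pos_of_ne_zero (NeZero.ne K))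
  let U : Matrix (Fin K) (Fin (K - 1) ⊕ Unit) ℝ :=
    Matrix.fromCols V (Matrix.of fun _ _ => 1 / Real.sqrt K)
  have hs : Real.sqrt K * Real.sqrt K = K := Real.mul_self_sqrt hK.le
  have hs0 : Real.sqrt K ≠ 0 := (Real.sqrt_pos.2 hK).ne'
  have h1 : Uᵀ * U = 1 := by
    ext i j
    rcases i with i | i <;> rcases j with j | j
    · simp [U, Matrix.mul_apply, Matrix.one_apply, hV.sum_mul]
    · simp [U, Matrix.mul_apply, ← Finset.sum_mul, hV.orth_one]
    · simp [U, Matrix.mul_apply, ← Finset.mul_sum, hV.orth_one]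
    · simp only [U, Matrix.mul_apply, Matrix.transpose_apply, Matrix.fromCols_apply_inr,
        Matrix.of_apply, Finset.sum_const, Finset.card_univ, Fintype.card_fin, nsmul_eq_mul,
        Matrix.one_apply]
      simp only [if_true]
      field_simp
      rw [sq, hs]
  have hcard : Fintype.card (Fin (K - 1) ⊕ Unit) = Fintype.card (Fin K) := by
    have := Nat.pos_of_ne_zero (NeZero.ne K)
    simp; omega
  have h2 : U * Uᵀ = 1 := (Matrix.mul_eq_one_comm_of_card_eq _ _ _ hcard).1 h1
  have h3 := congrFun (congrFun h2 k) l
  simp only [U, Matrix.mul_apply, Matrix.transpose_apply, Fintype.sum_sum_type,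
    Matrix.fromCols_apply_inl, Matrix.fromCols_apply_inr, Matrix.of_apply, Finset.univ_unique,
    Finset.sum_singleton, Matrix.one_apply] at h3
  have h4 : 1 / Real.sqrt K * (1 / Real.sqrt K) = 1 / (K : ℝ) := by
    rw [div_mul_div_comm, one_mul, hs]
  linarith

/-- A signed Dirichlet form of the graph, evaluated on an eigenvector. The sign $s=1$ measures the
distance of the eigenvalue from $1$, and $s=-1$ its distance from $-1$. -/
theorem IsSpectral.dirichlet (hA : IsCombination A) (hV : IsSpectral A V lam) (j : Fin (K - 1))
    {s : ℝ} (hs : s ^ 2 = 1) :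
    ∑ l, ∑ k, A l k * (V l j - s * V k j) ^ 2 = 2 * (1 - s * lam j) := by
  have h : ∀ l k, A l k * (V l j - s * V k j) ^ 2
      = A l k * (V l j * V l j) - 2 * s * (V l j * (A l k * V k j)) + A l k * (V k j * V k j) := by
    intro l k
    have : A l k * (V l j - s * V k j) ^ 2 = A l k * (V l j * V l j)
      - 2 * s * (V l j * (A l k * V k j)) + s ^ 2 * (A l k * (V k j * V k j)) := by ring
    rw [this, hs, one_mul]
  simp_rw [h, Finset.sum_add_distrib, Finset.sum_sub_distrib, ← Finset.mul_sum, hV.mulVec,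
    ← Finset.sum_mul, hA.row_sum, one_mul]
  rw [Finset.sum_comm (f := fun l k => A l k * (V k j * V k j))]
  simp_rw [← Finset.sum_mul, hA.col_sum, one_mul, hV.sum_mul, mul_left_comm _ (lam j),
    ← Finset.mul_sum, hV.sum_mul]
  simp
  ring

theorem IsSpectral.eq_of_edge (hA : IsCombination A) (hV : IsSpectral A V lam) (j : Fin (K - 1))
    {s : ℝ} (hs : s ^ 2 = 1) (h : s * lam j = 1) (l k : Fin K) (hlk : 0 < A l k) :
    V l j = s * V k j := by
  have h0 := hV.dirichlet hA j hs
  rw [h, sub_self, mul_zero] at h0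
  have hnn : ∀ l k, 0 ≤ A l k * (V l j - s * V k j) ^ 2 := fun l k =>
    mul_nonneg (hA.mem_Icc l k).1 (sq_nonneg _)
  have h1 := (Finset.sum_eq_zero_iff_of_nonneg fun l _ =>
    Finset.sum_nonneg fun k _ => hnn l k).1 h0 l (Finset.mem_univ _)
  have h2 := (Finset.sum_eq_zero_iff_of_nonneg fun k _ => hnn l k).1 h1 k (Finset.mem_univ _)
  have h3 := (mul_eq_zero.1 h2).resolve_left hlk.ne'
  exact sub_eq_zero.1 (pow_eq_zero_iff (two_ne_zero)|>.1 h3)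

theorem IsSpectral.exists_ne_zero (hV : IsSpectral A V lam) (j : Fin (K - 1)) :
    ∃ k, V k j ≠ 0 := by
  by_contra! h
  have := hV.sum_mul j j
  simp [h] at this

/-- Both Dirichlet forms are nonnegative, so only equality has to be excluded. An eigenvalue $1$
would make the eigenvector constant along edges, hence constant by connectedness, against
orthogonality to $\mathbb 1$. An eigenvalue $-1$ would flip the sign along every edge, so the
eigenvector vanishes at the self-loop and then everywhere. -/
theorem IsSpectral.abs_lt_one (hA : IsCombination A) (hV : IsSpectral A V lam)
    (j : Fin (K - 1)) : |lam j| < 1 := by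
  have hnn : ∀ s : ℝ, 0 ≤ ∑ l, ∑ k, A l k * (V l j - s * V k j) ^ 2 := fun s =>
    Finset.sum_nonneg fun l _ => Finset.sum_nonneg fun k _ =>
      mul_nonneg (hA.mem_Icc l k).1 (sq_nonneg _)
  have h1 := hnn 1
  have h2 := hnn (-1)
  rw [hV.dirichlet hA j (by norm_num)] at h1 h2
  obtain ⟨k, hk⟩ := hV.exists_ne_zero j
  rw [abs_lt]
  constructor
  · refine lt_of_le_of_ne (by linarith) fun h => hk ?_
    have edge := hV.eq_of_edge hA j (s := -1) (by norm_num) (by linarith)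
    obtain ⟨i, hi⟩ := hA.self_loop
    have h0 : V i j = 0 := by
      have := edge i i hi
      linarith
    have := hA.connected i k
    induction this with
    | refl => exact h0
    | tail _ hbc ih =>
      have := edge _ _ hbc
      by_contra hne
      exact ih (by intro h; apply hne; linarith) |> fun h => hne (by linarith)
  · refine lt_of_le_of_ne (by linarith) fun h => hk ?_
    have edge := hV.eq_of_edge hA j (s := 1) (by norm_num) (by linarith)
    have hconst : ∀ l, V l j = V k j := by
      intro l
      have := hA.connected l k
      clear hk
      induction this with
      | refl => rfl
      | tail _ hbc ih => rw [ih, edge _ _ hbc, one_mul]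
    have h0 := hV.orth_one j
    simp only [hconst, Finset.sum_const, Finset.card_univ, Fintype.card_fin, nsmul_eq_mul] at h0
    have := hA.neZero
    exact (mul_eq_zero.1 h0).resolve_left (NeZero.ne _)

/-- A spectral radius bound on the space of deviations. -/
theorem IsSpectral.exists_bound (hA : IsCombination A) (hV : IsSpectral A V lam) :
    ∃ θ : ℝ, 0 ≤ θ ∧ θ < 1 ∧ ∀ j, |lam j| ≤ θ := by
  rcases isEmpty_or_nonempty (Fin (K - 1)) with h | h
  · exact ⟨0, le_rfl, zero_lt_one, fun j => h.elim j⟩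
  · obtain ⟨j, hj⟩ := Finite.exists_max fun j => |lam j|
    exact ⟨|lam j|, abs_nonneg _, hV.abs_lt_one hA j, hj⟩

variable {F : Type*} [NormedAddCommGroup F] [InnerProductSpace ℝ F]

/-- Synthesis of a deviation from its coefficients in the eigenbasis. -/
noncomputable def synth (V : Matrix (Fin K) (Fin (K - 1)) ℝ) (c : Fin (K - 1) → F) : Net K F :=
  WithLp.toLp 2 fun k => ∑ j, V k j • c j

/-- The coefficients of a network state in the eigenbasis. -/
noncomputable def coeffs (V : Matrix (Fin K) (Fin (K - 1)) ℝ) (u : Net K F) (j : Fin (K - 1)) : F :=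
  ∑ k, V k j • u k

theorem IsSpectral.sum_quadratic_synth (hV : IsSpectral A V lam) (T : F →L[ℝ] F)
    (c : Fin (K - 1) → F) :
    ∑ k, ⟪T (synth V c k), synth V c k⟫ = ∑ j, ⟪T (c j), c j⟫ := by
  have : ∀ k, ⟪T (synth V c k), synth V c k⟫
      = ∑ i, ∑ j, (V k i * V k j) * ⟪T (c i), c j⟫ := by
    intro k
    simp only [synth, map_sum, map_smul, sum_inner, inner_sum, real_inner_smul_left,
      real_inner_smul_right]
    rw [Finset.sum_comm]
    refine Finset.sum_congr rfl fun i _ => Finset.sum_congr rfl fun j _ => by ring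
  simp_rw [this]
  rw [Finset.sum_comm]
  refine Finset.sum_congr rfl fun i _ => ?_
  rw [Finset.sum_comm]
  simp_rw [← Finset.sum_mul, hV.sum_mul]
  simp

theorem IsSpectral.synth_coeffs [NeZero K] (hV : IsSpectral A V lam) {u : Net K F}
    (hu : mean u = 0) : synth V (coeffs V u) = u := by
  ext k
  simp only [synth, coeffs, Finset.smul_sum, smul_smul]
  rw [Finset.sum_comm]
  simp_rw [← Finset.sum_smul, hV.complete, sub_smul, Finset.sum_sub_distrib, ← Finset.smul_sum,
    ← mean_apply, hu]
  simp

theorem IsSpectral.mix_synth (hA : IsCombination A) (hV : IsSpectral A V lam)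
    (c : Fin (K - 1) → F) : mix A (synth V c) = synth V fun j => lam j • c j := by
  ext k
  simp only [mix_apply, synth, Finset.smul_sum, smul_smul]
  rw [Finset.sum_comm]
  refine Finset.sum_congr rfl fun j _ => ?_
  rw [← Finset.sum_smul]
  congr 1
  simp_rw [hA.symm _ k]
  rw [hV.mulVec, mul_comm]

theorem IsSpectral.norm_synth_sq (hV : IsSpectral A V lam) (c : Fin (K - 1) → F) :
    ‖synth V c‖ ^ 2 = ∑ j, ‖c j‖ ^ 2 := by
  rw [PiLp.norm_sq_eq_of_L2]
  simpa using hV.sum_quadratic_synth (ContinuousLinearMap.id ℝ F) c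

/-- In the eigenbasis `mix A` acts on states of zero mean by the diagonal factors $\lambda_j$, and
synthesis is isometric. -/
theorem IsSpectral.norm_mix_le (hA : IsCombination A) (hV : IsSpectral A V lam) {θ : ℝ}
    (hθ : ∀ j, |lam j| ≤ θ) (hθ0 : 0 ≤ θ) {u : Net K F} (hu : mean u = 0) :
    ‖mix A u‖ ≤ θ * ‖u‖ := by
  have := hA.neZero
  refine le_of_sq_le_sq ?_ (by positivity)
  rw [← hV.synth_coeffs hu, hV.mix_synth hA, mul_pow, hV.norm_synth_sq, hV.norm_synth_sq,
    Finset.mul_sum]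
  refine Finset.sum_le_sum fun j _ => ?_
  rw [norm_smul, mul_pow, Real.norm_eq_abs]
  gcongr
  exact hθ j

end Spectral


/-! ### Stochastic gradients: mean field, noise and its moments -/

section Gradients

variable {K B : ℕ} {N : Fin K → ℕ} {F : Type*} [NormedAddCommGroup F] [InnerProductSpace ℝ F]

/-- The full-batch gradient of agent `k` at `w`. -/
noncomputable def meanField (g : ∀ k, F → Fin (N k) → F) (k : Fin K) (w : F) : F :=
  (1 / (N k : ℝ)) • ∑ i, g k w i

/-- The single-sample gradient noise of agent `k` at `w`. -/
noncomputable def sampleNoise (g : ∀ k, F → Fin (N k) → F) (k : Fin K) (w : F) (i : Fin (N k)) : F :=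
  g k w i - meanField g k w

/-- The full-batch gradients of all agents. -/
noncomputable def field (g : ∀ k, F → Fin (N k) → F) (W : Fin K → F) : Net K F :=
  WithLp.toLp 2 fun k => meanField g k (W k)

/-- The mini-batch gradient noise of all agents. -/
noncomputable def batchNoise (g : ∀ k, F → Fin (N k) → F) (W : Fin K → F)
    (ξ : ∀ k, Fin B → Fin (N k)) : Net K F :=
  WithLp.toLp 2 fun k => (1 / (B : ℝ)) • ∑ b, sampleNoise g k (W k) (ξ k b)

/-- The stochastic gradient step of the network. -/
noncomputable def gradStep (g : ∀ k, F → Fin (N k) → F) (A₁ A₂ : Matrix (Fin K) (Fin K) ℝ) (μ : ℝ)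
    (W : Fin K → F) (ξ : ∀ k, Fin B → Fin (N k)) : Fin K → F :=
  fun k => ∑ l, A₂ l k • ((∑ m, A₁ m l • W m) - (μ / (B : ℝ)) • ∑ b, g l (W l) (ξ l b))

/-- The error of the network state with respect to `w₀`. -/
noncomputable def netError (w₀ : F) (W : Fin K → F) : Net K F := WithLp.toLp 2 fun k => W k - w₀

/-- Second moment of the averaged single-sample noise, weighted by `T`. -/
noncomputable def noisePower (g : ∀ k, F → Fin (N k) → F) (W : Fin K → F) (T : F →L[ℝ] F) : ℝ :=
  (1 / (K : ℝ)) ^ 2 * ∑ k, 𝔼 i, ⟪T (sampleNoise g k (W k) i), sampleNoise g k (W k) i⟫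

/-- Quantitative regularity of the stochastic gradients near `w₀`: `d k`, `Hk k` are gradient and
Hessian of the local risks at `w₀`, and `H` is the Hessian of the global risk. -/
structure GradBounds (g : ∀ k, F → Fin (N k) → F) (w₀ : F) (d : Net K F) (H : F →L[ℝ] F)
    (Hk : Fin K → F →L[ℝ] F) (C δ μ : ℝ) : Prop where
  one_le : 1 ≤ C
  sum_d : ∑ k, d k = 0
  norm_d : ∀ k, ‖d k‖ ≤ C
  norm_H : ‖H‖ ≤ C
  sum_H : ∑ k, Hk k = (K : ℝ) • H
  dist_H : ∀ k, ‖Hk k - H‖ ≤ δ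
  lip : ∀ k w, ‖meanField g k w - d k‖ ≤ C * (‖w - w₀‖ + μ ^ 2)
  quad : ∀ k w, ‖meanField g k w - d k - Hk k (w - w₀)‖ ≤ C * (‖w - w₀‖ ^ 2 + μ ^ 2)
  pow_four : ∀ k w, 𝔼 i, ‖g k w i‖ ^ 4 ≤ C * (1 + ‖w - w₀‖ ^ 4)
  lip_sample : ∀ k w i, ‖g k w i - g k w₀ i‖ ≤ C * (‖w - w₀‖ + μ ^ 2)

variable {g : ∀ k, F → Fin (N k) → F} {w₀ : F} {d : Net K F} {H : F →L[ℝ] F}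
  {Hk : Fin K → F →L[ℝ] F} {C δ μ θ : ℝ}

theorem sum_sampleNoise [∀ k, NeZero (N k)] (g : ∀ k, F → Fin (N k) → F) (k : Fin K) (w : F) :
    ∑ i, sampleNoise g k w i = 0 := by
  have : (N k : ℝ) ≠ 0 := Nat.cast_ne_zero.2 (NeZero.ne _)
  simp [sampleNoise, meanField, Finset.sum_sub_distrib, ← Nat.cast_smul_eq_nsmul ℝ, smul_smul, this]

theorem sum_batchNoise [∀ k, NeZero (N k)] (g : ∀ k, F → Fin (N k) → F) (W : Fin K → F) :
    ∑ ξ : (∀ k, Fin B → Fin (N k)), batchNoise g W ξ = 0 := by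
  ext k
  simp only [batchNoise, WithLp.ofLp_sum, Finset.sum_apply, PiLp.zero_apply]
  rw [← Finset.smul_sum,
    sum_pi_apply_eq_zero (Ω := fun k => Fin B → Fin (N k)) k
      (fun η => ∑ b, sampleNoise g k (W k) (η b)), smul_zero]
  rw [Finset.sum_comm]
  exact Finset.sum_eq_zero fun b _ => sum_pi_apply_eq_zero b _ (sum_sampleNoise g k (W k))

theorem batchNoise_add_field (hB : 1 ≤ B) (g : ∀ k, F → Fin (N k) → F) (W : Fin K → F)
    (ξ : ∀ k, Fin B → Fin (N k)) (k : Fin K) :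
    (1 / (B : ℝ)) • ∑ b, g k (W k) (ξ k b) = field g W k + batchNoise g W ξ k := by
  have : (B : ℝ) ≠ 0 := Nat.cast_ne_zero.2 (by omega)
  simp [batchNoise, field, sampleNoise, Finset.sum_sub_distrib, smul_sub,
    ← Nat.cast_smul_eq_nsmul ℝ, smul_smul, this]

/-- Unit column sums let the constant reference point pass through both combinations, so the error
obeys the same recursion as the models. -/
theorem netError_gradStep (hB : 1 ≤ B) (g : ∀ k, F → Fin (N k) → F)
    {A₁ A₂ : Matrix (Fin K) (Fin K) ℝ} (h₁ : ∀ k, ∑ l, A₁ l k = 1) (h₂ : ∀ k, ∑ l, A₂ l k = 1)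
    (μ : ℝ) (w₀ : F) (W : Fin K → F) (ξ : ∀ k, Fin B → Fin (N k)) :
    netError w₀ (gradStep g A₁ A₂ μ W ξ) =
      mix A₂ (mix A₁ (netError w₀ W) - μ • (field g W + batchNoise g W ξ)) := by
  ext k
  have e : ∀ l, (mix A₁ (netError w₀ W) - μ • (field g W + batchNoise g W ξ)) l
      = ((∑ m, A₁ m l • W m) - (μ / (B : ℝ)) • ∑ b, g l (W l) (ξ l b)) - w₀ := by
    intro l
    have h := batchNoise_add_field hB g W ξ l
    simp only [PiLp.sub_apply, PiLp.smul_apply, PiLp.add_apply, mix_apply, netError, ← h,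
      smul_sub, Finset.sum_sub_distrib, ← Finset.sum_smul, h₁, one_smul, smul_smul,
      mul_one_div]
    abel
  rw [mix_apply]
  simp_rw [e, smul_sub, Finset.sum_sub_distrib, ← Finset.sum_smul, h₂, one_smul]
  simp [netError, gradStep, smul_sub, Finset.sum_sub_distrib]

theorem expect_norm_sampleNoise_sq_le [∀ k, NeZero (N k)] (hg : GradBounds g w₀ d H Hk C δ μ)
    (k : Fin K) (w : F) : 𝔼 i, ‖sampleNoise g k w i‖ ^ 2 ≤ C * (1 + ‖w - w₀‖ ^ 2) := by
  have h1 : 𝔼 i, ‖g k w i‖ ^ 2 = ‖meanField g k w‖ ^ 2 + 𝔼 i, ‖sampleNoise g k w i‖ ^ 2 := by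
    rw [← expect_norm_add_sq _ _ (sum_sampleNoise g k w)]
    simp [sampleNoise]
  set T := 1 + ‖w - w₀‖ ^ 2 with hT
  have hT0 : 0 < T := by positivity
  -- Young's inequality at the scale `T` passes from fourth to second moments without square roots.
  have h2 : 2 * T * 𝔼 i, ‖g k w i‖ ^ 2 ≤ T ^ 2 + 𝔼 i, ‖g k w i‖ ^ 4 := by
    rw [Finset.mul_expect, ← Finset.expect_const (s := (Finset.univ : Finset (Fin (N k))))
        Finset.univ_nonempty (T ^ 2),
      ← Finset.expect_add_distrib]
    exact expect_mono fun i => by nlinarith [sq_nonneg (T - ‖g k w i‖ ^ 2)]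
  have h3 := hg.pow_four k w
  have hC := hg.one_le
  have h4 : 1 + ‖w - w₀‖ ^ 4 ≤ T ^ 2 := by rw [hT]; nlinarith [sq_nonneg ‖w - w₀‖]
  have h5 : C * (1 + ‖w - w₀‖ ^ 4) ≤ C * T ^ 2 := by gcongr
  have h6 : 1 * T ^ 2 ≤ C * T ^ 2 := by gcongr
  have h7 : T * (𝔼 i, ‖g k w i‖ ^ 2) ≤ T * (C * T) := by nlinarith
  have h8 := le_of_mul_le_mul_left h7 hT0
  nlinarith [sq_nonneg ‖meanField g k w‖]

theorem expect_norm_sampleNoise_pow_four_le [∀ k, NeZero (N k)]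
    (hg : GradBounds g w₀ d H Hk C δ μ) (k : Fin K) (w : F) :
    𝔼 i, ‖sampleNoise g k w i‖ ^ 4 ≤ 16 * C * (1 + ‖w - w₀‖ ^ 4) := by
  have h1 : ‖meanField g k w‖ ^ 4 ≤ 𝔼 i, ‖g k w i‖ ^ 4 := by
    have h := expect_norm_add_sq (meanField g k w) _ (sum_sampleNoise g k w)
    have h' : ‖meanField g k w‖ ^ 2 ≤ 𝔼 i, ‖g k w i‖ ^ 2 := by
      simp only [sampleNoise, add_sub_cancel] at h
      rw [h]
      linarith [expect_nonneg' fun i => sq_nonneg ‖g k w i - meanField g k w‖]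
    set T := ‖meanField g k w‖ ^ 2 with hT
    have h2 : 2 * T * 𝔼 i, ‖g k w i‖ ^ 2 ≤ T ^ 2 + 𝔼 i, ‖g k w i‖ ^ 4 := by
      rw [Finset.mul_expect, ← Finset.expect_const (s := (Finset.univ : Finset (Fin (N k))))
        Finset.univ_nonempty (T ^ 2),
        ← Finset.expect_add_distrib]
      exact expect_mono fun i => by nlinarith [sq_nonneg (T - ‖g k w i‖ ^ 2)]
    have h3 : T * T ≤ T * 𝔼 i, ‖g k w i‖ ^ 2 := by gcongr
    calc ‖meanField g k w‖ ^ 4 = T * T := by rw [hT]; ring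
      _ ≤ _ := by nlinarith
  have h2 : 𝔼 i, ‖sampleNoise g k w i‖ ^ 4
      ≤ 8 * (𝔼 i, ‖g k w i‖ ^ 4) + 8 * ‖meanField g k w‖ ^ 4 := by
    rw [Finset.mul_expect, ← Finset.expect_const (s := (Finset.univ : Finset (Fin (N k))))
      Finset.univ_nonempty (8 * ‖meanField g k w‖ ^ 4), ← Finset.expect_add_distrib]
    refine expect_mono fun i => ?_
    have := add_pow_four_le ‖g k w i‖ ‖meanField g k w‖
    have h3 : ‖sampleNoise g k w i‖ ^ 4 ≤ (‖g k w i‖ + ‖meanField g k w‖) ^ 4 := by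
      gcongr; exact norm_sub_le _ _
    linarith
  linarith [hg.pow_four k w]

/-- Averaging `B` independent centred vectors divides quadratic moments by `B`. -/
theorem expect_quadratic_batch [∀ k, NeZero (N k)] (hB : 1 ≤ B) (g : ∀ k, F → Fin (N k) → F)
    (W : Fin K → F) (k : Fin K) (T : F →L[ℝ] F) :
    𝔼 η : Fin B → Fin (N k), ⟪T ((1 / (B : ℝ)) • ∑ b, sampleNoise g k (W k) (η b)),
        (1 / (B : ℝ)) • ∑ b, sampleNoise g k (W k) (η b)⟫
      = (1 / (B : ℝ)) * 𝔼 i, ⟪T (sampleNoise g k (W k) i), sampleNoise g k (W k) i⟫ := by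
  have hB0 : (B : ℝ) ≠ 0 := Nat.cast_ne_zero.2 (by omega)
  simp only [map_smul, real_inner_smul_left, real_inner_smul_right]
  rw [← Finset.mul_expect, ← Finset.mul_expect, expect_quadratic_sum T
    (fun _ : Fin B => sampleNoise g k (W k)) fun _ => sum_sampleNoise g k (W k)]
  rw [Finset.sum_const, Finset.card_univ, Fintype.card_fin, nsmul_eq_mul]
  field_simp

/-- Independence across the agents and inside each mini-batch removes all cross terms, so the factor
$1/B$ is exact. At $w^\star$ the remaining quantity is the trace against $\bar R_s$; see
`trace_mul_noiseCov`. -/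
theorem expect_quadratic_mean_batchNoise [∀ k, NeZero (N k)] (hB : 1 ≤ B)
    (g : ∀ k, F → Fin (N k) → F) (W : Fin K → F) (T : F →L[ℝ] F) :
    𝔼 ξ : (∀ k, Fin B → Fin (N k)), ⟪T (mean (batchNoise g W ξ)), mean (batchNoise g W ξ)⟫
      = (1 / (B : ℝ)) * noisePower g W T := by
  simp only [mean_apply, map_smul, real_inner_smul_left, real_inner_smul_right, batchNoise]
  rw [← Finset.mul_expect, ← Finset.mul_expect, expect_quadratic_sum T
    (fun k (η : Fin B → Fin (N k)) => (1 / (B : ℝ)) • ∑ b, sampleNoise g k (W k) (η b))]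
  · simp_rw [expect_quadratic_batch hB]
    rw [← Finset.mul_sum, noisePower]
    ring
  · intro k
    rw [← Finset.smul_sum, Finset.sum_comm, Finset.sum_eq_zero, smul_zero]
    exact fun b _ => sum_pi_apply_eq_zero b _ (sum_sampleNoise g k (W k))

theorem expect_norm_batchNoise_sq_le [∀ k, NeZero (N k)] (hB : 1 ≤ B)
    (hg : GradBounds g w₀ d H Hk C δ μ) (W : Fin K → F) :
    𝔼 ξ : (∀ k, Fin B → Fin (N k)), ‖batchNoise g W ξ‖ ^ 2
      ≤ (1 / (B : ℝ)) * (K * C * (1 + ‖netError w₀ W‖ ^ 2)) := by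
  simp_rw [PiLp.norm_sq_eq_of_L2 _ (batchNoise g W _)]
  rw [Finset.expect_sum_comm]
  have h : ∀ k ∈ Finset.univ, 𝔼 ξ : (∀ k, Fin B → Fin (N k)), ‖batchNoise g W ξ k‖ ^ 2
      ≤ (1 / (B : ℝ)) * (C * (1 + ‖netError w₀ W‖ ^ 2)) := by
    intro k _
    have e := expect_quadratic_batch hB g W k (ContinuousLinearMap.id ℝ F)
    have e' := expect_apply (Ω := fun k => Fin B → Fin (N k)) k
      (fun η => ‖(1 / (B : ℝ)) • ∑ b, sampleNoise g k (W k) (η b)‖ ^ 2)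
    simp only [ContinuousLinearMap.id_apply, real_inner_self_eq_norm_sq] at e
    calc _ = _ := e'
      _ = _ := e
      _ ≤ (1 / (B : ℝ)) * (C * (1 + ‖W k - w₀‖ ^ 2)) := by
        gcongr; exact expect_norm_sampleNoise_sq_le hg k (W k)
      _ ≤ _ := by
        have := hg.one_le
        gcongr
        exact PiLp.norm_apply_le (netError w₀ W) k
  refine (Finset.sum_le_sum h).trans (le_of_eq ?_)
  simp
  ring

/-- Jensen's inequality over the batch. No decay in $B$ is extracted: the noise is multiplied by
$\mu$, and $\mu^4$ times a bounded fourth moment is small enough. -/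
theorem expect_norm_batchNoise_pow_four_le [NeZero K] [∀ k, NeZero (N k)] (hB : 1 ≤ B)
    (hg : GradBounds g w₀ d H Hk C δ μ) (W : Fin K → F) :
    𝔼 ξ : (∀ k, Fin B → Fin (N k)), ‖batchNoise g W ξ‖ ^ 4
      ≤ 16 * K ^ 2 * C * (1 + ‖netError w₀ W‖ ^ 4) := by
  have hB0 : (0 : ℝ) < B := Nat.cast_pos.2 (by omega)
  have h1 : ∀ ξ : (∀ k, Fin B → Fin (N k)), ‖batchNoise g W ξ‖ ^ 4
      ≤ K * ∑ k, (1 / (B : ℝ)) * ∑ b, ‖sampleNoise g k (W k) (ξ k b)‖ ^ 4 := by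
    intro ξ
    have e : ‖batchNoise g W ξ‖ ^ 4 = (∑ k, ‖batchNoise g W ξ k‖ ^ 2) ^ 2 := by
      rw [← PiLp.norm_sq_eq_of_L2 _ (batchNoise g W ξ)]; ring
    rw [e]
    refine (sq_sum_le_card_mul_sum_sq).trans ?_
    rw [Finset.card_univ, Fintype.card_fin]
    gcongr with k
    have e2 : ‖batchNoise g W ξ k‖ ≤ (1 / (B : ℝ)) * ∑ b, ‖sampleNoise g k (W k) (ξ k b)‖ := by
      simp only [batchNoise]
      rw [norm_smul, Real.norm_of_nonneg (by positivity)]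
      gcongr
      exact norm_sum_le _ _
    calc (‖batchNoise g W ξ k‖ ^ 2) ^ 2 = ‖batchNoise g W ξ k‖ ^ 4 := by ring
      _ ≤ ((1 / (B : ℝ)) * ∑ b, ‖sampleNoise g k (W k) (ξ k b)‖) ^ 4 := by gcongr
      _ = (∑ b, (1 / (B : ℝ)) * ‖sampleNoise g k (W k) (ξ k b)‖) ^ 4 := by rw [Finset.mul_sum]
      _ ≤ ∑ b, (1 / (B : ℝ)) * ‖sampleNoise g k (W k) (ξ k b)‖ ^ 4 :=
        Real.pow_arith_mean_le_arith_mean_pow _ _ _ (fun _ _ => by positivity)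
          (by simp [hB0.ne']) (fun _ _ => norm_nonneg _) 4
      _ = _ := by rw [Finset.mul_sum]
  refine (expect_mono h1).trans ?_
  rw [← Finset.mul_expect, Finset.expect_sum_comm]
  have herr : ∀ k, ‖W k - w₀‖ ≤ ‖netError w₀ W‖ := fun k =>
    PiLp.norm_apply_le (netError w₀ W) k
  have h2 : ∀ k, 𝔼 ξ : (∀ k, Fin B → Fin (N k)),
      (1 / (B : ℝ)) * ∑ b, ‖sampleNoise g k (W k) (ξ k b)‖ ^ 4
        ≤ 16 * C * (1 + ‖netError w₀ W‖ ^ 4) := by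
    intro k
    have e : ∀ b : Fin B, 𝔼 η : Fin B → Fin (N k), ‖sampleNoise g k (W k) (η b)‖ ^ 4
        = 𝔼 i, ‖sampleNoise g k (W k) i‖ ^ 4 := fun b =>
      expect_apply (Ω := fun _ : Fin B => Fin (N k)) b fun i => ‖sampleNoise g k (W k) i‖ ^ 4
    have e1 := expect_apply (Ω := fun k => Fin B → Fin (N k)) k
      (fun η => (1 / (B : ℝ)) * ∑ b, ‖sampleNoise g k (W k) (η b)‖ ^ 4)
    have e2 : 𝔼 η : Fin B → Fin (N k), (1 / (B : ℝ)) * ∑ b, ‖sampleNoise g k (W k) (η b)‖ ^ 4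
        = 𝔼 i, ‖sampleNoise g k (W k) i‖ ^ 4 := by
      rw [← Finset.mul_expect, Finset.expect_sum_comm, Finset.sum_congr rfl fun b _ => e b,
        Finset.sum_const, Finset.card_univ, Fintype.card_fin, nsmul_eq_mul, ← mul_assoc,
        one_div_mul_cancel hB0.ne', one_mul]
    refine (e1.trans e2).trans_le ?_
    refine (expect_norm_sampleNoise_pow_four_le hg k (W k)).trans ?_
    have := hg.one_le
    have := pow_le_pow_left₀ (norm_nonneg _) (herr k) 4
    gcongr
  refine (mul_le_mul_of_nonneg_left (Finset.sum_le_sum fun k _ => h2 k)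
    (Nat.cast_nonneg K)).trans (le_of_eq ?_)
  rw [Finset.sum_const, Finset.card_univ, Fintype.card_fin, nsmul_eq_mul]
  ring

/-- The weighted noise power is continuous in the models. -/
theorem abs_noisePower_sub_le [NeZero K] [∀ k, NeZero (N k)] (hg : GradBounds g w₀ d H Hk C δ μ)
    (W : Fin K → F) (T : F →L[ℝ] F) :
    |noisePower g W T - noisePower g (fun _ => w₀) T|
      ≤ ‖T‖ * (8 * C ^ 2 * K) * ((‖netError w₀ W‖ + μ ^ 2) * (1 + ‖netError w₀ W‖ + μ ^ 2)) := by
  have hC := hg.one_le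
  set U := ‖netError w₀ W‖ + μ ^ 2 with hU
  have hU0 : 0 ≤ U := by positivity
  have hUk : ∀ k, ‖W k - w₀‖ + μ ^ 2 ≤ U := fun k => by
    rw [hU]; gcongr; exact PiLp.norm_apply_le (netError w₀ W) k
  have hmf : ∀ k, ‖meanField g k (W k) - meanField g k w₀‖ ≤ C * U := by
    intro k
    have e : meanField g k (W k) - meanField g k w₀
        = (1 / (Fintype.card (Fin (N k)) : ℝ)) • ∑ i, (g k (W k) i - g k w₀ i) := by
      simp [meanField, Finset.sum_sub_distrib, smul_sub]
    rw [e]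
    refine (norm_average_le _).trans ?_
    refine (expect_mono fun i => hg.lip_sample k (W k) i).trans ?_
    rw [Finset.expect_const Finset.univ_nonempty]
    gcongr
    exact hUk k
  have hdiff : ∀ k i, ‖sampleNoise g k (W k) i - sampleNoise g k w₀ i‖ ≤ 2 * C * U := by
    intro k i
    have e : sampleNoise g k (W k) i - sampleNoise g k w₀ i
        = (g k (W k) i - g k w₀ i) - (meanField g k (W k) - meanField g k w₀) := by
      simp only [sampleNoise]; abel
    rw [e]
    refine (norm_sub_le _ _).trans ?_
    have h1 := (hg.lip_sample k (W k) i).trans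
      (mul_le_mul_of_nonneg_left (hUk k) (zero_le_one.trans hC))
    linarith [hmf k]
  have hterm : ∀ k, |(𝔼 i, ⟪T (sampleNoise g k (W k) i), sampleNoise g k (W k) i⟫)
      - 𝔼 i, ⟪T (sampleNoise g k w₀ i), sampleNoise g k w₀ i⟫|
      ≤ ‖T‖ * (8 * C ^ 2) * (U * (1 + U)) := by
    intro k
    rw [← Finset.expect_sub_distrib]
    refine (abs_expect_le _).trans ?_
    have hpt : ∀ i, |⟪T (sampleNoise g k (W k) i), sampleNoise g k (W k) i⟫
        - ⟪T (sampleNoise g k w₀ i), sampleNoise g k w₀ i⟫|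
        ≤ ‖T‖ * (2 * C * U) * (2 * C * U + (1 + ‖sampleNoise g k w₀ i‖ ^ 2)) := by
      intro i
      set a := sampleNoise g k (W k) i
      set b := sampleNoise g k w₀ i
      have hab : ‖a - b‖ ≤ 2 * C * U := hdiff k i
      -- A difference of quadratic forms is linear in $a-b$, so the estimate needs only second
      -- moments of the noise at `w₀`.
      have e : ⟪T a, a⟫ - ⟪T b, b⟫ = ⟪T (a - b), a⟫ + ⟪T b, a - b⟫ := by
        rw [map_sub, inner_sub_left, inner_sub_right]; ring
      have ha : ‖a‖ ≤ 2 * C * U + ‖b‖ := by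
        have := norm_add_le (a - b) b
        rw [sub_add_cancel] at this
        linarith
      rw [e]
      calc |⟪T (a - b), a⟫ + ⟪T b, a - b⟫| ≤ |⟪T (a - b), a⟫| + |⟪T b, a - b⟫| := abs_add_le _ _
        _ ≤ ‖T‖ * ‖a - b‖ * ‖a‖ + ‖T‖ * ‖b‖ * ‖a - b‖ := by
          refine add_le_add ((abs_real_inner_le_norm _ _).trans ?_)
            ((abs_real_inner_le_norm _ _).trans ?_)
          · gcongr; exact T.le_opNorm _
          · gcongr; exact T.le_opNorm _
        _ = ‖T‖ * ‖a - b‖ * (‖a‖ + ‖b‖) := by ring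
        _ ≤ ‖T‖ * (2 * C * U) * (2 * C * U + (1 + ‖b‖ ^ 2)) := by
          refine mul_le_mul (mul_le_mul_of_nonneg_left hab (norm_nonneg _)) ?_
            (by positivity) (by positivity)
          nlinarith [sq_nonneg (‖b‖ - 1)]
    refine (expect_mono hpt).trans ?_
    rw [← Finset.mul_expect, Finset.expect_add_distrib, Finset.expect_add_distrib,
      Finset.expect_const Finset.univ_nonempty, Finset.expect_const Finset.univ_nonempty]
    have h2 := expect_norm_sampleNoise_sq_le hg k w₀
    rw [sub_self, norm_zero] at h2
    calc _ ≤ ‖T‖ * (2 * C * U) * (2 * C * U + (1 + C)) := by gcongr; linarith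
      _ ≤ ‖T‖ * (2 * C * U) * (4 * C * (1 + U)) := by
        gcongr
        nlinarith
      _ = _ := by ring
  have hK : (1 : ℝ) ≤ K := one_le_cast_of_neZero
  rw [noisePower, noisePower, ← mul_sub, ← Finset.sum_sub_distrib, abs_mul,
    abs_of_nonneg (by positivity)]
  calc _ ≤ 1 * ∑ k : Fin K, ‖T‖ * (8 * C ^ 2) * (U * (1 + U)) := by
        gcongr
        · refine pow_le_one₀ (by positivity) ?_
          rw [div_le_one (by linarith)]; exact hK
        · refine (Finset.abs_sum_le_sum_abs _ _).trans (Finset.sum_le_sum fun k _ => hterm k)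
    _ = _ := by simp [hU]; ring

end Gradients


/-! ### One step of the network: centroid and corrected deviation -/

section OneStep

variable {K B : ℕ} {N : Fin K → ℕ} {F : Type*} [NormedAddCommGroup F] [InnerProductSpace ℝ F]

/-- Doubly stochastic combination matrices that contract deviations by the factor `θ`. -/
structure Mixing (F : Type*) [NormedAddCommGroup F] [InnerProductSpace ℝ F]
    (A₁ A₂ : Matrix (Fin K) (Fin K) ℝ) (θ : ℝ) : Prop where
  col₁ : ∀ k, ∑ l, A₁ l k = 1
  row₁ : ∀ l, ∑ k, A₁ l k = 1
  col₂ : ∀ k, ∑ l, A₂ l k = 1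
  row₂ : ∀ l, ∑ k, A₂ l k = 1
  nonneg : 0 ≤ θ
  lt_one : θ < 1
  contr : ∀ u : Net K F, mean u = 0 → ‖mix A₂ (mix A₁ u)‖ ≤ θ * ‖u‖
  nonexp : ∀ u : Net K F, mean u = 0 → ‖mix A₂ u‖ ≤ ‖u‖

/-- The deviations caused by the heterogeneity of the agents, in units of `-μ`. -/
noncomputable def drift (A₁ A₂ : Matrix (Fin K) (Fin K) ℝ) (d : Net K F) : ℕ → Net K F
  | 0 => 0
  | n + 1 => mix A₂ (mix A₁ (drift A₁ A₂ d n)) + mix A₂ d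

/-- The deviation from the centroid, corrected by the heterogeneity drift. -/
noncomputable def deviation (w₀ : F) (μ : ℝ) (D : Net K F) (W : Fin K → F) : Net K F :=
  centre (netError w₀ W) + μ • D

/-- The size of the error of a network state. -/
noncomputable def size (w₀ : F) (μ : ℝ) (D : Net K F) (W : Fin K → F) : ℝ :=
  ‖mean (netError w₀ W)‖ + ‖deviation w₀ μ D W‖ + μ

/-- Everything that is assumed about one step of the network. -/
structure StepBounds (g : ∀ k, F → Fin (N k) → F) (A₁ A₂ : Matrix (Fin K) (Fin K) ℝ) (w₀ : F)
    (d : Net K F) (H : F →L[ℝ] F) (Hk : Fin K → F →L[ℝ] F) (C θ δ μ : ℝ) (B : ℕ) : Prop where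
  grad : GradBounds g w₀ d H Hk C δ μ
  mixing : Mixing F A₁ A₂ θ
  one_le_batch : 1 ≤ B
  batch : 1 / (B : ℝ) ≤ C * μ
  pos : 0 < μ
  le_sq : μ ≤ δ ^ 2
  δ_pos : 0 < δ
  δ_le : δ ≤ 1

variable {g : ∀ k, F → Fin (N k) → F} {w₀ : F} {d : Net K F} {H : F →L[ℝ] F}
  {Hk : Fin K → F →L[ℝ] F} {C δ μ θ : ℝ} {A₁ A₂ : Matrix (Fin K) (Fin K) ℝ}

theorem StepBounds.le_one (h : StepBounds g A₁ A₂ w₀ d H Hk C θ δ μ B) : μ ≤ 1 :=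
  h.le_sq.trans (pow_le_one₀ h.δ_pos.le h.δ_le)

theorem StepBounds.mean_d (h : StepBounds g A₁ A₂ w₀ d H Hk C θ δ μ B) : mean d = 0 := by
  rw [mean_apply, h.grad.sum_d, smul_zero]

/-- The gain $P=KC/(1-\theta)$ dominates the elementary constants of a step; the later constants are
powers of it up to numerical factors. -/
theorem StepBounds.one_le_gain [NeZero K] (h : StepBounds g A₁ A₂ w₀ d H Hk C θ δ μ B) :
    K * C ≤ K * C / (1 - θ) ∧ C ≤ K * C / (1 - θ) ∧ 1 ≤ K * C / (1 - θ) := by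
  have hθ := h.mixing.lt_one
  have hθ0 := h.mixing.nonneg
  have hC := h.grad.one_le
  have hK : (1 : ℝ) ≤ K := one_le_cast_of_neZero
  have h1 : K * C ≤ K * C / (1 - θ) := by
    rw [le_div_iff₀ (by linarith)]
    nlinarith [mul_nonneg (mul_nonneg (zero_le_one.trans hK) (zero_le_one.trans hC)) hθ0]
  have h2 : C ≤ K * C := by nlinarith
  exact ⟨h1, h2.trans h1, (hC.trans h2).trans h1⟩

theorem StepBounds.mean_drift (h : StepBounds g A₁ A₂ w₀ d H Hk C θ δ μ B) (n : ℕ) :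
    mean (drift A₁ A₂ d n) = 0 := by
  induction n with
  | zero => simp [drift]
  | succ n ih => rw [drift, map_add, mean_mix h.mixing.row₂, mean_mix h.mixing.row₁, ih,
      mean_mix h.mixing.row₂, h.mean_d, add_zero]

theorem StepBounds.norm_d_le (h : StepBounds g A₁ A₂ w₀ d H Hk C θ δ μ B) : ‖d‖ ≤ K * C :=
  (norm_net_le_sum d).trans
    ((Finset.sum_le_sum fun k _ => h.grad.norm_d k).trans (le_of_eq (by simp)))

theorem StepBounds.norm_drift_le (h : StepBounds g A₁ A₂ w₀ d H Hk C θ δ μ B) (n : ℕ) :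
    ‖drift A₁ A₂ d n‖ ≤ K * C / (1 - θ) := by
  have hθ := h.mixing.lt_one
  have hC := h.grad.one_le
  induction n with
  | zero => simp only [drift, norm_zero]; exact div_nonneg (by positivity) (by linarith)
  | succ n ih =>
    rw [drift]
    refine (norm_add_le _ _).trans ?_
    have h1 := h.mixing.contr _ (h.mean_drift n)
    have h2 := h.mixing.nonexp _ h.mean_d
    have h3 := mul_le_mul_of_nonneg_left ih h.mixing.nonneg
    -- The claimed bound is the fixed point of $b\mapsto\theta b+KC$.
    have h4 : K * C / (1 - θ) = θ * (K * C / (1 - θ)) + K * C := by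
      have : 1 - θ ≠ 0 := by linarith
      field_simp
      ring
    linarith [h.norm_d_le]

theorem StepBounds.mean_deviation [NeZero K] (h : StepBounds g A₁ A₂ w₀ d H Hk C θ δ μ B) (n : ℕ)
    (W : Fin K → F) : mean (deviation w₀ μ (drift A₁ A₂ d n) W) = 0 := by
  rw [deviation, map_add, map_smul, mean_centre, h.mean_drift, smul_zero, add_zero]

theorem StepBounds.norm_centre_le [NeZero K] (h : StepBounds g A₁ A₂ w₀ d H Hk C θ δ μ B) (n : ℕ)
    (W : Fin K → F) : ‖centre (netError w₀ W)‖
      ≤ ‖deviation w₀ μ (drift A₁ A₂ d n) W‖ + μ * (K * C / (1 - θ)) := by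
  have e : centre (netError w₀ W)
      = deviation w₀ μ (drift A₁ A₂ d n) W - μ • drift A₁ A₂ d n := by
    rw [deviation, add_sub_cancel_right]
  rw [e]
  refine (norm_sub_le _ _).trans ?_
  rw [norm_smul, Real.norm_of_nonneg h.pos.le]
  have := mul_le_mul_of_nonneg_left (h.norm_drift_le n) h.pos.le
  linarith

theorem StepBounds.norm_centre_le_size [NeZero K] (h : StepBounds g A₁ A₂ w₀ d H Hk C θ δ μ B)
    (n : ℕ) (W : Fin K → F) : ‖centre (netError w₀ W)‖
      ≤ K * C / (1 - θ) * size w₀ μ (drift A₁ A₂ d n) W := by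
  have h1 := h.norm_centre_le n W
  obtain ⟨-, -, hP⟩ := h.one_le_gain
  set P := K * C / (1 - θ)
  rw [size]
  have := norm_nonneg (mean (netError w₀ W))
  have := norm_nonneg (deviation w₀ μ (drift A₁ A₂ d n) W)
  nlinarith

theorem StepBounds.norm_netError_le [NeZero K] (h : StepBounds g A₁ A₂ w₀ d H Hk C θ δ μ B) (n : ℕ)
    (W : Fin K → F) : ‖netError w₀ W‖
      ≤ K * C / (1 - θ) * size w₀ μ (drift A₁ A₂ d n) W := by
  have h1 := h.norm_centre_le n W
  have h2 := norm_le_mean_add_centre (netError w₀ W)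
  obtain ⟨hP1, -, hP⟩ := h.one_le_gain
  have hK : (1 : ℝ) ≤ K := one_le_cast_of_neZero
  have hKP : (K : ℝ) ≤ K * C / (1 - θ) := by nlinarith [h.grad.one_le]
  set P := K * C / (1 - θ)
  rw [size]
  have := norm_nonneg (mean (netError w₀ W))
  have := norm_nonneg (deviation w₀ μ (drift A₁ A₂ d n) W)
  nlinarith

theorem le_size (w₀ : F) (μ : ℝ) (D : Net K F) (W : Fin K → F) : μ ≤ size w₀ μ D W := by
  rw [size]
  have := norm_nonneg (mean (netError w₀ W))
  have := norm_nonneg (deviation w₀ μ D W)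
  linarith

/-- The argument yields $2P^2$. The larger $16P^6$ is also the constant of the two noise bounds, so
that one constant feeds the scalar inequalities. -/
theorem StepBounds.norm_field_sub_le [NeZero K] (h : StepBounds g A₁ A₂ w₀ d H Hk C θ δ μ B)
    (n : ℕ) (W : Fin K → F) : ‖field g W - d‖
      ≤ 16 * (K * C / (1 - θ)) ^ 6 * size w₀ μ (drift A₁ A₂ d n) W := by
  have h1 := h.norm_netError_le n W
  have hq := le_size w₀ μ (drift A₁ A₂ d n) W
  obtain ⟨hP1, hCP, hP⟩ := h.one_le_gain
  have hμ1 := h.le_one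
  have hμ := h.pos
  have hC := h.grad.one_le
  set P := K * C / (1 - θ)
  set q := size w₀ μ (drift A₁ A₂ d n) W
  have hk : ∀ k, ‖(field g W - d) k‖ ≤ C * (2 * P * q) := by
    intro k
    refine (h.grad.lip k (W k)).trans ?_
    have h2 : ‖W k - w₀‖ ≤ P * q := (PiLp.norm_apply_le (netError w₀ W) k).trans h1
    have h3 : μ ^ 2 ≤ P * q := by nlinarith
    gcongr
    linarith
  calc ‖field g W - d‖ ≤ ∑ k : Fin K, C * (2 * P * q) :=
        (norm_net_le_sum _).trans (Finset.sum_le_sum fun k _ => hk k)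
    _ = K * C * (2 * P * q) := by simp; ring
    _ ≤ P * (2 * P * q) := by
      have hq0 : 0 ≤ q := hμ.le.trans hq
      gcongr
    _ = 2 * P ^ 2 * q := by ring
    _ ≤ 16 * P ^ 6 * q := by
      have : P ^ 2 ≤ P ^ 6 := pow_le_pow_right₀ hP (by norm_num)
      have hq0 : 0 ≤ q := hμ.le.trans hq
      gcongr
      norm_num

theorem StepBounds.noise_sq_le [NeZero K] [∀ k, NeZero (N k)]
    (h : StepBounds g A₁ A₂ w₀ d H Hk C θ δ μ B) (n : ℕ) (W : Fin K → F) :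
    𝔼 ξ : (∀ k, Fin B → Fin (N k)), ‖batchNoise g W ξ‖ ^ 2
      ≤ 16 * (K * C / (1 - θ)) ^ 6 * μ * (1 + size w₀ μ (drift A₁ A₂ d n) W ^ 2) := by
  refine (expect_norm_batchNoise_sq_le h.one_le_batch h.grad W).trans ?_
  have h1 := h.norm_netError_le n W
  have hq := le_size w₀ μ (drift A₁ A₂ d n) W
  obtain ⟨hP1, hCP, hP⟩ := h.one_le_gain
  have hμ := h.pos
  have hC := h.grad.one_le
  set P := K * C / (1 - θ)
  set q := size w₀ μ (drift A₁ A₂ d n) W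
  calc 1 / (B : ℝ) * (K * C * (1 + ‖netError w₀ W‖ ^ 2))
      ≤ C * μ * (P * (1 + (P * q) ^ 2)) := by
        gcongr
        exact h.batch
    _ ≤ P * μ * (P * (P ^ 2 + (P * q) ^ 2)) := by
        gcongr
        exact one_le_pow₀ hP
    _ = P ^ 4 * (μ * (1 + q ^ 2)) := by ring
    _ ≤ 16 * P ^ 6 * (μ * (1 + q ^ 2)) := by
      have : P ^ 4 ≤ P ^ 6 := pow_le_pow_right₀ hP (by norm_num)
      gcongr
      linarith [pow_nonneg (zero_le_one.trans hP) 6]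
    _ = _ := by ring

theorem StepBounds.noise_pow_four_le [NeZero K] [∀ k, NeZero (N k)]
    (h : StepBounds g A₁ A₂ w₀ d H Hk C θ δ μ B) (n : ℕ) (W : Fin K → F) :
    𝔼 ξ : (∀ k, Fin B → Fin (N k)), ‖batchNoise g W ξ‖ ^ 4
      ≤ 16 * (K * C / (1 - θ)) ^ 6 * (1 + size w₀ μ (drift A₁ A₂ d n) W ^ 4) := by
  refine (expect_norm_batchNoise_pow_four_le h.one_le_batch h.grad W).trans ?_
  have h1 := h.norm_netError_le n W
  have hq := le_size w₀ μ (drift A₁ A₂ d n) W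
  obtain ⟨hP1, hCP, hP⟩ := h.one_le_gain
  have hμ := h.pos
  have hC := h.grad.one_le
  set P := K * C / (1 - θ)
  set q := size w₀ μ (drift A₁ A₂ d n) W
  have hKC : K ^ 2 * C ≤ P ^ 2 := by
    calc K ^ 2 * C ≤ K ^ 2 * C ^ 2 := by gcongr; nlinarith
      _ = (K * C) ^ 2 := by ring
      _ ≤ P ^ 2 := by gcongr
  calc 16 * K ^ 2 * C * (1 + ‖netError w₀ W‖ ^ 4)
      = 16 * (K ^ 2 * C * (1 + ‖netError w₀ W‖ ^ 4)) := by ring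
    _ ≤ 16 * (P ^ 2 * (P ^ 4 + (P * q) ^ 4)) := by
        gcongr
        exact one_le_pow₀ hP
    _ = _ := by ring

/-- Subtracting `d` inside the mean is free because the local gradients at `w₀` balance. The result
is a deterministic part plus centred noise. -/
theorem StepBounds.mean_step [NeZero K] (h : StepBounds g A₁ A₂ w₀ d H Hk C θ δ μ B)
    (W : Fin K → F) (ξ : ∀ k, Fin B → Fin (N k)) :
    mean (netError w₀ (gradStep g A₁ A₂ μ W ξ))
      = (mean (netError w₀ W) - μ • mean (field g W - d)) + (-μ) • mean (batchNoise g W ξ) := by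
  rw [netError_gradStep h.one_le_batch g h.mixing.col₁ h.mixing.col₂, mean_mix h.mixing.row₂,
    map_sub, mean_mix h.mixing.row₁, map_smul, map_add, map_sub, h.mean_d, sub_zero, smul_add,
    neg_smul]
  abel

/-- The recursion of `drift` is made to cancel the constant forcing $-\mu A_2d$ exactly. Only the
difference `field g W - d`, which is small near `w₀`, still drives the corrected deviation. -/
theorem StepBounds.deviation_step [NeZero K] (h : StepBounds g A₁ A₂ w₀ d H Hk C θ δ μ B) (n : ℕ)
    (W : Fin K → F) (ξ : ∀ k, Fin B → Fin (N k)) :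
    deviation w₀ μ (drift A₁ A₂ d (n + 1)) (gradStep g A₁ A₂ μ W ξ)
      = (mix A₂ (mix A₁ (deviation w₀ μ (drift A₁ A₂ d n) W))
          - μ • mix A₂ (centre (field g W - d)))
        + (-μ) • mix A₂ (centre (batchNoise g W ξ)) := by
  rw [deviation, netError_gradStep h.one_le_batch g h.mixing.col₁ h.mixing.col₂,
    mix_centre h.mixing.row₂ h.mixing.col₂, map_sub, mix_centre h.mixing.row₁ h.mixing.col₁,
    deviation, drift]
  have hd := centre_eq_self h.mean_d
  simp only [map_sub, map_add, map_smul, hd, smul_add, smul_sub, neg_smul]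
  abel

variable [NeZero K] [∀ k, NeZero (N k)]

theorem StepBounds.expect_mean_sq_le (h : StepBounds g A₁ A₂ w₀ d H Hk C θ δ μ B) (n : ℕ)
    (W : Fin K → F) :
    𝔼 ξ : (∀ k, Fin B → Fin (N k)), ‖mean (netError w₀ (gradStep g A₁ A₂ μ W ξ))‖ ^ 2 ≤
      (1 + 10 * (16 * (K * C / (1 - θ)) ^ 6) ^ 2 * μ) * ‖mean (netError w₀ W)‖ ^ 2
        + 10 * (16 * (K * C / (1 - θ)) ^ 6) ^ 2 * μ * ‖deviation w₀ μ (drift A₁ A₂ d n) W‖ ^ 2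
        + 10 * (16 * (K * C / (1 - θ)) ^ 6) ^ 2 * μ ^ 3 := by
  have hG := h.norm_field_sub_le n W
  have hS := h.noise_sq_le n W
  have hP := h.one_le_gain.2.2
  have hC₁ : (1 : ℝ) ≤ 16 * (K * C / (1 - θ)) ^ 6 := by linarith [one_le_pow₀ (n := 6) hP]
  set C₁ := 16 * (K * C / (1 - θ)) ^ 6
  have hμ := h.pos
  simp_rw [h.mean_step W]
  rw [expect_norm_add_sq]
  · refine centroid_sq_le hC₁ hμ h.le_one (norm_nonneg _) (norm_nonneg _) (norm_nonneg _) ?_ ?_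
    · refine (norm_sub_le _ _).trans ?_
      rw [norm_smul, Real.norm_of_nonneg hμ.le]
      have := mul_le_mul_of_nonneg_left ((norm_mean_le (field g W - d)).trans hG) hμ.le
      rw [size] at this
      linarith
    · have h1 : ∀ ξ : (∀ k, Fin B → Fin (N k)), ‖(-μ) • mean (batchNoise g W ξ)‖ ^ 2
          ≤ μ ^ 2 * ‖batchNoise g W ξ‖ ^ 2 := by
        intro ξ
        rw [norm_smul, norm_neg, Real.norm_of_nonneg hμ.le, mul_pow]
        gcongr
        exact norm_mean_le _
      refine (expect_mono h1).trans ?_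
      rw [← Finset.mul_expect]
      have := mul_le_mul_of_nonneg_left hS (sq_nonneg μ)
      rw [size] at this
      linarith
  · rw [← Finset.smul_sum, ← map_sum, sum_batchNoise, map_zero, smul_zero]

theorem StepBounds.expect_mean_pow_four_le (h : StepBounds g A₁ A₂ w₀ d H Hk C θ δ μ B) (n : ℕ)
    (W : Fin K → F) :
    𝔼 ξ : (∀ k, Fin B → Fin (N k)), ‖mean (netError w₀ (gradStep g A₁ A₂ μ W ξ))‖ ^ 4 ≤
      (1 + 3000 * (16 * (K * C / (1 - θ)) ^ 6) ^ 5 * μ) * ‖mean (netError w₀ W)‖ ^ 4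
        + 3000 * (16 * (K * C / (1 - θ)) ^ 6) ^ 5 * μ * ‖deviation w₀ μ (drift A₁ A₂ d n) W‖ ^ 4
        + 3000 * (16 * (K * C / (1 - θ)) ^ 6) ^ 5 * μ ^ 4 := by
  have hG := h.norm_field_sub_le n W
  have hS := h.noise_sq_le n W
  have hS4 := h.noise_pow_four_le n W
  have hP := h.one_le_gain.2.2
  have hC₁ : (1 : ℝ) ≤ 16 * (K * C / (1 - θ)) ^ 6 := by linarith [one_le_pow₀ (n := 6) hP]
  set C₁ := 16 * (K * C / (1 - θ)) ^ 6
  have hμ := h.pos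
  simp_rw [h.mean_step W]
  refine (expect_norm_add_pow_four_le _ _ ?_).trans
    (centroid_pow_four_le hC₁ hμ h.le_one (norm_nonneg _) (norm_nonneg _) (norm_nonneg _)
      ?_ ?_ ?_)
  · rw [← Finset.smul_sum, ← map_sum, sum_batchNoise, map_zero, smul_zero]
  · refine (norm_sub_le _ _).trans ?_
    rw [norm_smul, Real.norm_of_nonneg hμ.le]
    have := mul_le_mul_of_nonneg_left ((norm_mean_le (field g W - d)).trans hG) hμ.le
    rw [size] at this
    linarith
  · have h1 : ∀ ξ : (∀ k, Fin B → Fin (N k)), ‖(-μ) • mean (batchNoise g W ξ)‖ ^ 2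
        ≤ μ ^ 2 * ‖batchNoise g W ξ‖ ^ 2 := by
      intro ξ
      rw [norm_smul, norm_neg, Real.norm_of_nonneg hμ.le, mul_pow]
      gcongr
      exact norm_mean_le _
    refine (expect_mono h1).trans ?_
    rw [← Finset.mul_expect]
    have := mul_le_mul_of_nonneg_left hS (sq_nonneg μ)
    rw [size] at this
    linarith
  · have h1 : ∀ ξ : (∀ k, Fin B → Fin (N k)), ‖(-μ) • mean (batchNoise g W ξ)‖ ^ 4
        ≤ μ ^ 4 * ‖batchNoise g W ξ‖ ^ 4 := by
      intro ξ
      rw [norm_smul, norm_neg, Real.norm_of_nonneg hμ.le, mul_pow]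
      gcongr
      exact norm_mean_le _
    refine (expect_mono h1).trans ?_
    rw [← Finset.mul_expect]
    have := mul_le_mul_of_nonneg_left hS4 (pow_nonneg hμ.le 4)
    rw [size] at this
    linarith

omit [∀ k, NeZero (N k)] in
theorem StepBounds.norm_noise_part_le (h : StepBounds g A₁ A₂ w₀ d H Hk C θ δ μ B)
    (W : Fin K → F) (ξ : ∀ k, Fin B → Fin (N k)) :
    ‖(-μ) • mix A₂ (centre (batchNoise g W ξ))‖ ≤ μ * ‖batchNoise g W ξ‖ := by
  rw [norm_smul, norm_neg, Real.norm_of_nonneg h.pos.le]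
  have := h.pos
  gcongr
  exact (h.mixing.nonexp _ (mean_centre _)).trans (AdvNet.norm_centre_le _)

omit [∀ k, NeZero (N k)] in
theorem StepBounds.norm_drift_part_le (h : StepBounds g A₁ A₂ w₀ d H Hk C θ δ μ B) (n : ℕ)
    (W : Fin K → F) :
    ‖mix A₂ (mix A₁ (deviation w₀ μ (drift A₁ A₂ d n) W)) - μ • mix A₂ (centre (field g W - d))‖
      ≤ θ * ‖deviation w₀ μ (drift A₁ A₂ d n) W‖
        + 16 * (K * C / (1 - θ)) ^ 6 * μ * size w₀ μ (drift A₁ A₂ d n) W := by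
  have hG := h.norm_field_sub_le n W
  refine (norm_sub_le _ _).trans ?_
  rw [norm_smul, Real.norm_of_nonneg h.pos.le]
  have h1 := h.mixing.contr _ (h.mean_deviation n W)
  have h2 := (h.mixing.nonexp _ (mean_centre (field g W - d))).trans (AdvNet.norm_centre_le _)
  have := mul_le_mul_of_nonneg_left (h2.trans hG) h.pos.le
  linarith

theorem StepBounds.expect_deviation_sq_le (h : StepBounds g A₁ A₂ w₀ d H Hk C θ δ μ B) (n : ℕ)
    (W : Fin K → F) :
    𝔼 ξ : (∀ k, Fin B → Fin (N k)),
        ‖deviation w₀ μ (drift A₁ A₂ d (n + 1)) (gradStep g A₁ A₂ μ W ξ)‖ ^ 2 ≤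
      (θ + 7 * (16 * (K * C / (1 - θ)) ^ 6) ^ 2 / (1 - θ) * μ)
          * ‖deviation w₀ μ (drift A₁ A₂ d n) W‖ ^ 2
        + 7 * (16 * (K * C / (1 - θ)) ^ 6) ^ 2 / (1 - θ) * μ * ‖mean (netError w₀ W)‖ ^ 2
        + 7 * (16 * (K * C / (1 - θ)) ^ 6) ^ 2 / (1 - θ) * μ ^ 3 := by
  have hD := h.norm_drift_part_le n W
  have hS := h.noise_sq_le n W
  have hP := h.one_le_gain.2.2
  have hC₁ : (1 : ℝ) ≤ 16 * (K * C / (1 - θ)) ^ 6 := by linarith [one_le_pow₀ (n := 6) hP]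
  set C₁ := 16 * (K * C / (1 - θ)) ^ 6
  have hμ := h.pos
  simp_rw [h.deviation_step n W]
  rw [expect_norm_add_sq]
  · refine deviation_sq_le hC₁ hμ h.le_one (norm_nonneg _) (norm_nonneg _) h.mixing.nonneg
      h.mixing.lt_one (norm_nonneg _) hD ?_
    refine (expect_mono fun ξ => pow_le_pow_left₀ (norm_nonneg _) (h.norm_noise_part_le W ξ)
      2).trans ?_
    simp_rw [mul_pow]
    rw [← Finset.mul_expect]
    have := mul_le_mul_of_nonneg_left hS (sq_nonneg μ)
    rw [size] at this
    linarith
  · rw [← Finset.smul_sum, ← map_sum, ← map_sum, sum_batchNoise, map_zero, map_zero, smul_zero]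

/-- The noise is bounded in norm here, without use of its vanishing mean: convexity with weights
$\theta$, $1-\theta$ absorbs any perturbation of size $O(\mu)$ into an $O(\mu^4)$ term. -/
theorem StepBounds.expect_deviation_pow_four_le (h : StepBounds g A₁ A₂ w₀ d H Hk C θ δ μ B)
    (n : ℕ) (W : Fin K → F) :
    𝔼 ξ : (∀ k, Fin B → Fin (N k)),
        ‖deviation w₀ μ (drift A₁ A₂ d (n + 1)) (gradStep g A₁ A₂ μ W ξ)‖ ^ 4 ≤
      (θ + 448 * (16 * (K * C / (1 - θ)) ^ 6) ^ 4 / (1 - θ) ^ 3 * μ)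
          * ‖deviation w₀ μ (drift A₁ A₂ d n) W‖ ^ 4
        + 448 * (16 * (K * C / (1 - θ)) ^ 6) ^ 4 / (1 - θ) ^ 3 * μ * ‖mean (netError w₀ W)‖ ^ 4
        + 448 * (16 * (K * C / (1 - θ)) ^ 6) ^ 4 / (1 - θ) ^ 3 * μ ^ 4 := by
  have hD := h.norm_drift_part_le n W
  have hS := h.noise_pow_four_le n W
  have hP := h.one_le_gain.2.2
  have hC₁ : (1 : ℝ) ≤ 16 * (K * C / (1 - θ)) ^ 6 := by linarith [one_le_pow₀ (n := 6) hP]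
  have hθ1 := h.mixing.lt_one
  have hθ0 := h.mixing.nonneg
  have hμ := h.pos
  rw [size] at hS
  refine le_trans ?_ (deviation_pow_four_le hC₁ hμ h.le_one (norm_nonneg _) (norm_nonneg _)
    hθ1 hS)
  set C₁ := 16 * (K * C / (1 - θ)) ^ 6
  set y := ‖deviation w₀ μ (drift A₁ A₂ d n) W‖ with hy
  set q := ‖mean (netError w₀ W)‖ + y + μ with hq
  have hg : 0 < 1 - θ := by linarith
  have hpt : ∀ ξ : (∀ k, Fin B → Fin (N k)),
      ‖deviation w₀ μ (drift A₁ A₂ d (n + 1)) (gradStep g A₁ A₂ μ W ξ)‖ ^ 4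
        ≤ θ * y ^ 4 + 8 * μ ^ 4 / (1 - θ) ^ 3 * ((C₁ * q) ^ 4 + ‖batchNoise g W ξ‖ ^ 4) := by
    intro ξ
    set σ := ‖batchNoise g W ξ‖
    -- Chosen so that `(1 - θ) * t` is the whole perturbation of the contraction.
    set t := μ * (C₁ * q + σ) / (1 - θ) with ht
    have e1 : ‖deviation w₀ μ (drift A₁ A₂ d (n + 1)) (gradStep g A₁ A₂ μ W ξ)‖
        ≤ θ * y + (1 - θ) * t := by
      rw [h.deviation_step n W]
      refine (norm_add_le _ _).trans ?_
      have e2 : (1 - θ) * t = μ * (C₁ * q + σ) := by rw [ht]; field_simp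
      rw [e2]
      have := h.norm_noise_part_le W ξ
      rw [size] at hD
      linarith
    calc _ ≤ (θ * y + (1 - θ) * t) ^ 4 := by gcongr
      _ ≤ θ * y ^ 4 + (1 - θ) * t ^ 4 := convex_add_pow_four_le hθ0 hθ1.le
      _ = θ * y ^ 4 + μ ^ 4 / (1 - θ) ^ 3 * (C₁ * q + σ) ^ 4 := by rw [ht]; field_simp
      _ ≤ θ * y ^ 4 + μ ^ 4 / (1 - θ) ^ 3 * (8 * ((C₁ * q) ^ 4 + σ ^ 4)) := by
        gcongr
        exact add_pow_four_le _ _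
      _ = _ := by ring
  refine (expect_mono hpt).trans (le_of_eq ?_)
  rw [Finset.expect_add_distrib, Finset.expect_const Finset.univ_nonempty, ← Finset.mul_expect,
    Finset.expect_add_distrib, Finset.expect_const Finset.univ_nonempty]

-- Averaging $H_ku_k$ gives $H$ at the centroid plus the average of $(H_k-H)$ applied to the
-- deviations. The Hessian disagreement makes the latter of order $\delta$ times the error size; the
-- linearization error is quadratic.
omit [∀ k, NeZero (N k)] in
theorem StepBounds.norm_residual_le (h : StepBounds g A₁ A₂ w₀ d H Hk C θ δ μ B) (n : ℕ)
    (W : Fin K → F) :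
    ‖mean (field g W - d) - H (mean (netError w₀ W))‖
      ≤ 2 * (K * C / (1 - θ)) ^ 3 * (δ * size w₀ μ (drift A₁ A₂ d n) W
        + size w₀ μ (drift A₁ A₂ d n) W ^ 2) := by
  have h1 := h.norm_netError_le n W
  have h2 := h.norm_centre_le_size n W
  have hq := le_size w₀ μ (drift A₁ A₂ d n) W
  obtain ⟨hP1, hCP, hP⟩ := h.one_le_gain
  have hμ1 := h.le_one
  have hμ := h.pos
  have hδ := h.δ_pos
  have hC := h.grad.one_le
  set P := K * C / (1 - θ)
  set q := size w₀ μ (drift A₁ A₂ d n) W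
  set u := netError w₀ W with hu
  have hK : (1 : ℝ) ≤ K := one_le_cast_of_neZero
  have hq0 : 0 < q := hμ.trans_le hq
  have e : mean (field g W - d) - H (mean u) = (1 / (K : ℝ)) • (∑ k, ((meanField g k (W k) - d k
      - Hk k (u k)) + (Hk k - H) (centre u k))) := by
    have e1 : ∑ k, (Hk k - H) (centre u k) = ∑ k, Hk k (u k) - (K : ℝ) • H (mean u) := by
      have e2 : ∑ k, Hk k (mean u) = (K : ℝ) • H (mean u) := by
        have := congrArg (fun T : F →L[ℝ] F => T (mean u)) h.grad.sum_H
        simpa using this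
      simp only [_root_.sub_apply, centre_apply, map_sub, Finset.sum_sub_distrib, e2]
      rw [← map_sum H, sum_eq_smul_mean]
      simp [← Nat.cast_smul_eq_nsmul ℝ]
    rw [Finset.sum_add_distrib, e1, mean_apply]
    have hK0 : (K : ℝ) ≠ 0 := by linarith
    simp only [Finset.sum_sub_distrib, PiLp.sub_apply, field, smul_add, smul_sub, smul_smul,
      one_div_mul_cancel hK0, one_smul]
    abel
  rw [e, norm_smul, Real.norm_of_nonneg (by positivity)]
  have hterm : ∀ k ∈ Finset.univ, ‖(meanField g k (W k) - d k - Hk k (u k))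
      + (Hk k - H) (centre u k)‖ ≤ 2 * P ^ 3 * (δ * q + q ^ 2) := by
    intro k _
    have t1 : ‖meanField g k (W k) - d k - Hk k (u k)‖ ≤ C * (‖u k‖ ^ 2 + μ ^ 2) :=
      h.grad.quad k (W k)
    have t2 : ‖(Hk k - H) (centre u k)‖ ≤ δ * ‖centre u k‖ :=
      ((Hk k - H).le_opNorm _).trans
        (mul_le_mul_of_nonneg_right (h.grad.dist_H k) (norm_nonneg _))
    have t3 : ‖u k‖ ≤ P * q := (PiLp.norm_apply_le u k).trans h1
    have t4 : ‖centre u k‖ ≤ P * q := (PiLp.norm_apply_le (centre u) k).trans h2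
    have p3 : P ≤ P ^ 3 := by
      calc P = P ^ 1 := (pow_one P).symm
        _ ≤ P ^ 3 := pow_le_pow_right₀ hP (by norm_num)
    have t5 : C * (‖u k‖ ^ 2 + μ ^ 2) ≤ P * ((P * q) ^ 2 + (P * q) ^ 2) := by
      have : μ ≤ P * q := by nlinarith
      gcongr
    have t6 : δ * ‖centre u k‖ ≤ P ^ 3 * (δ * q) := by
      calc δ * ‖centre u k‖ ≤ δ * (P * q) := by gcongr
        _ = P * (δ * q) := by ring
        _ ≤ _ := by gcongr
    have : 0 ≤ P ^ 3 * (δ * q) := by positivity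
    refine (norm_add_le _ _).trans ?_
    linarith
  calc 1 / (K : ℝ) * ‖∑ k, ((meanField g k (W k) - d k - Hk k (u k)) + (Hk k - H) (centre u k))‖
      ≤ 1 / (K : ℝ) * ∑ k : Fin K, 2 * P ^ 3 * (δ * q + q ^ 2) := by
        gcongr
        exact (norm_sum_le _ _).trans (Finset.sum_le_sum hterm)
    _ = _ := by
      rw [Finset.sum_const, Finset.card_univ, Fintype.card_fin, nsmul_eq_mul]
      field_simp

/-- Freezes the noise covariance at `w₀`. A crude bound is enough because the weight $\mu^2/B$ is
already $O(\mu^3)$, while the error size `q` is at least $\mu$. -/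
theorem StepBounds.abs_noise_sub_le (h : StepBounds g A₁ A₂ w₀ d H Hk C θ δ μ B)
    (n : ℕ) (W : Fin K → F) (T : F →L[ℝ] F) :
    |μ ^ 2 * (1 / (B : ℝ)) * (noisePower g W T - noisePower g (fun _ => w₀) T)|
      ≤ ‖T‖ * μ * (64 * (K * C / (1 - θ)) ^ 6 * (δ * size w₀ μ (drift A₁ A₂ d n) W ^ 2
        + size w₀ μ (drift A₁ A₂ d n) W ^ 4 / δ)) := by
  have hU := h.norm_netError_le n W
  have hq := le_size w₀ μ (drift A₁ A₂ d n) W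
  have hnp := abs_noisePower_sub_le h.grad W T
  obtain ⟨hP1, hCP, hP⟩ := h.one_le_gain
  have hμ1 := h.le_one
  have hμ := h.pos
  have hδ := h.δ_pos
  have hδ1 := h.δ_le
  have hC := h.grad.one_le
  set P := K * C / (1 - θ)
  set q := size w₀ μ (drift A₁ A₂ d n) W
  have hq0 : 0 < q := hμ.trans_le hq
  have hP56 : P ^ 5 ≤ P ^ 6 := pow_le_pow_right₀ hP (by norm_num)
  rw [abs_mul, abs_of_nonneg (by positivity)]
  set U := ‖netError w₀ W‖ + μ ^ 2 with hUdef
  have hU2 : U ≤ 2 * P * q := by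
    have : μ ^ 2 ≤ 1 * q := by nlinarith
    have : 1 * q ≤ P * q := by gcongr
    linarith
  have hU0 : 0 ≤ U := by positivity
  have hKC : C * (C ^ 2 * K) ≤ P ^ 3 := by
    calc C * (C ^ 2 * K) = C * C * (K * C) := by ring
      _ ≤ P * P * P := by gcongr
      _ = P ^ 3 := by ring
  have hμq : μ ^ 2 * (q + q ^ 2) ≤ 2 * (δ * q ^ 2) := by
    have j0 : μ ≤ δ := h.le_sq.trans (by nlinarith)
    have j1 : μ * μ * q ≤ δ * q * q := by gcongr
    have j2 : μ * μ * q ^ 2 ≤ δ * 1 * q ^ 2 := by gcongr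
    linarith
  calc _ ≤ μ ^ 2 * (C * μ) * (‖T‖ * (8 * C ^ 2 * K) * (U * (1 + ‖netError w₀ W‖ + μ ^ 2))) := by
        gcongr
        exact h.batch
    _ = ‖T‖ * μ * (8 * (C * (C ^ 2 * K)) * (μ ^ 2 * (U * (1 + U)))) := by rw [hUdef]; ring
    _ ≤ ‖T‖ * μ * (8 * P ^ 3 * (μ ^ 2 * (2 * P * q * (P + 2 * P * q)))) := by gcongr
    _ ≤ ‖T‖ * μ * (32 * P ^ 5 * (μ ^ 2 * (q + q ^ 2))) := by
      have : 0 ≤ P ^ 5 * (μ ^ 2 * q) := by positivity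
      refine mul_le_mul_of_nonneg_left ?_ (by positivity)
      linarith
    _ ≤ ‖T‖ * μ * (32 * P ^ 6 * (2 * (δ * q ^ 2 + q ^ 4 / δ))) := by
      have : 0 ≤ q ^ 4 / δ := by positivity
      gcongr ‖T‖ * μ * (32 * ?_ * ?_)
      linarith
    _ = _ := by ring

/-- One step of the weighted second moment of the centroid, to leading order. -/
theorem StepBounds.abs_expect_quadratic_sub_le (h : StepBounds g A₁ A₂ w₀ d H Hk C θ δ μ B)
    (n : ℕ) (W : Fin K → F) (T : F →L[ℝ] F) :
    |(𝔼 ξ : (∀ k, Fin B → Fin (N k)), ⟪T (mean (netError w₀ (gradStep g A₁ A₂ μ W ξ))),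
          mean (netError w₀ (gradStep g A₁ A₂ μ W ξ))⟫)
        - ⟪T ((1 - μ • H) (mean (netError w₀ W))), (1 - μ • H) (mean (netError w₀ W))⟫
        - μ ^ 2 * (1 / (B : ℝ)) * noisePower g (fun _ => w₀) T|
      ≤ 100 * (K * C / (1 - θ)) ^ 6 * ‖T‖ * μ * (δ * size w₀ μ (drift A₁ A₂ d n) W ^ 2
        + size w₀ μ (drift A₁ A₂ d n) W ^ 4 / δ) := by
  have hr := h.norm_residual_le n W
  have hU := h.norm_netError_le n W
  have hq := le_size w₀ μ (drift A₁ A₂ d n) W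
  have hx : ‖mean (netError w₀ W)‖ ≤ size w₀ μ (drift A₁ A₂ d n) W := by
    rw [size]
    linarith [norm_nonneg (deviation w₀ μ (drift A₁ A₂ d n) W), h.pos]
  obtain ⟨hP1, hCP, hP⟩ := h.one_le_gain
  have hμ1 := h.le_one
  have hμ := h.pos
  have hδ := h.δ_pos
  have hδ1 := h.δ_le
  have hC := h.grad.one_le
  simp_rw [h.mean_step W]
  rw [expect_quadratic_add]
  swap
  · rw [← Finset.smul_sum, ← map_sum, sum_batchNoise, map_zero, smul_zero]
  simp only [map_smul, real_inner_smul_left, real_inner_smul_right]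
  rw [← Finset.mul_expect, ← Finset.mul_expect, expect_quadratic_mean_batchNoise h.one_le_batch]
  set m := mean (netError w₀ W) with hm
  set r := mean (field g W - d) - H m with hrdef
  set P := K * C / (1 - θ)
  set q := size w₀ μ (drift A₁ A₂ d n) W
  have hq0 : 0 < q := hμ.trans_le hq
  set b := (1 - μ • H) m with hb
  -- The deterministic part is the linear contraction of the centroid, minus $\mu$ times the
  -- residual of `norm_residual_le`.
  have ha : m - μ • mean (field g W - d) = b - μ • r := by
    rw [hb, hrdef]
    simp [smul_sub]
  rw [ha]
  have hbn : ‖b‖ ≤ 2 * P * q := by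
    have : ‖b‖ ≤ ‖m‖ + μ * (C * ‖m‖) := by
      rw [hb]
      simp only [_root_.sub_apply, one_apply_eq_self,
        _root_.smul_apply]
      refine (norm_sub_le _ _).trans ?_
      rw [norm_smul, Real.norm_of_nonneg hμ.le]
      gcongr
      exact (H.le_opNorm m).trans (by gcongr; exact h.grad.norm_H)
    have h1 : μ * (C * ‖m‖) ≤ 1 * (P * q) := by gcongr
    have h2 : 1 * q ≤ P * q := by gcongr
    linarith
  have e : ⟪T (b - μ • r), b - μ • r⟫ + -μ * (-μ * (1 / (B : ℝ) * noisePower g W T)) - ⟪T b, b⟫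
      - μ ^ 2 * (1 / (B : ℝ)) * noisePower g (fun _ => w₀) T
      = (-μ * ⟪T r, b⟫ + -μ * ⟪T b, r⟫ + μ ^ 2 * ⟪T r, r⟫)
        + μ ^ 2 * (1 / (B : ℝ)) * (noisePower g W T - noisePower g (fun _ => w₀) T) := by
    simp only [map_sub, map_smul, inner_sub_left, inner_sub_right, real_inner_smul_left,
      real_inner_smul_right]
    ring
  rw [e]
  have hTi : ∀ x y : F, |⟪T x, y⟫| ≤ ‖T‖ * ‖x‖ * ‖y‖ := fun x y =>
    (abs_real_inner_le_norm _ _).trans (by gcongr; exact T.le_opNorm x)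
  have t1 : |-μ * ⟪T r, b⟫ + -μ * ⟪T b, r⟫ + μ ^ 2 * ⟪T r, r⟫|
      ≤ ‖T‖ * μ * (2 * ‖r‖ * ‖b‖ + ‖r‖ ^ 2) := by
    refine (abs_add_le _ _).trans ((add_le_add_left (abs_add_le _ _) _).trans ?_)
    simp only [abs_mul, abs_neg, abs_of_pos hμ, abs_of_pos (pow_pos hμ 2)]
    have i1 := mul_le_mul_of_nonneg_left (hTi r b) hμ.le
    have i2 := mul_le_mul_of_nonneg_left (hTi b r) hμ.le
    have i3 : μ ^ 2 * |⟪T r, r⟫| ≤ μ * (‖T‖ * ‖r‖ * ‖r‖) := by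
      have : μ ^ 2 ≤ μ := by nlinarith
      exact mul_le_mul this (hTi r r) (abs_nonneg _) hμ.le
    linarith
  -- Cubic errors are traded by the inequality of means for `q ^ 2` and `q ^ 4`, the two powers
  -- whose expectations are controlled. The weight `δ` makes both contributions $O(\delta\mu^2)$ on
  -- average.
  have hq3 : q ^ 3 ≤ δ * q ^ 2 + q ^ 4 / δ := by
    rw [← sub_nonneg]
    have : δ * q ^ 2 + q ^ 4 / δ - q ^ 3 = q ^ 2 / δ * (δ ^ 2 - δ * q + q ^ 2) := by
      field_simp
      ring
    rw [this]
    have : 0 ≤ δ ^ 2 - δ * q + q ^ 2 := by nlinarith [sq_nonneg (δ - q)]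
    positivity
  have hq4 : q ^ 4 ≤ q ^ 4 / δ := le_div_self (by positivity) hδ hδ1
  have hP46 : P ^ 4 ≤ P ^ 6 := pow_le_pow_right₀ hP (by norm_num)
  have t2 : 2 * ‖r‖ * ‖b‖ + ‖r‖ ^ 2 ≤ 32 * P ^ 6 * (δ * q ^ 2 + q ^ 4 / δ) := by
    have i1 : 2 * ‖r‖ * ‖b‖ ≤ 2 * (2 * P ^ 3 * (δ * q + q ^ 2)) * (2 * P * q) := by gcongr
    have i2 : ‖r‖ ^ 2 ≤ (2 * P ^ 3 * (δ * q + q ^ 2)) ^ 2 := by gcongr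
    have i3 : (δ * q + q ^ 2) ^ 2 ≤ 2 * (δ * q ^ 2 + q ^ 4 / δ) := by
      have : δ ^ 2 ≤ δ := by nlinarith
      have : δ ^ 2 * q ^ 2 ≤ δ * q ^ 2 := by gcongr
      linarith [sq_nonneg (δ * q - q ^ 2)]
    have i4 : (δ * q + q ^ 2) * q ≤ 2 * (δ * q ^ 2 + q ^ 4 / δ) := by
      have : 0 ≤ q ^ 4 / δ := by positivity
      linarith
    have i5 : P ^ 4 * ((δ * q + q ^ 2) * q) ≤ P ^ 6 * (2 * (δ * q ^ 2 + q ^ 4 / δ)) := by gcongr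
    have i6 : P ^ 6 * (δ * q + q ^ 2) ^ 2 ≤ P ^ 6 * (2 * (δ * q ^ 2 + q ^ 4 / δ)) := by gcongr
    have : 0 ≤ P ^ 6 * (δ * q ^ 2 + q ^ 4 / δ) := by positivity
    linarith
  have t3 := h.abs_noise_sub_le n W T
  refine (abs_add_le _ _).trans ((add_le_add t1 t3).trans ?_)
  have t4 := mul_le_mul_of_nonneg_left t2 (by positivity : 0 ≤ ‖T‖ * μ)
  have : 0 ≤ ‖T‖ * μ * (P ^ 6 * (δ * q ^ 2 + q ^ 4 / δ)) := by positivity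
  linarith

end OneStep


/-! ### Uniform random maps as finite mixtures of pushforwards -/

section RandomMaps

variable {X Ξ : Type*} [MeasurableSpace X] [Fintype Ξ] [MeasurableSpace Ξ]
  [MeasurableSingletonClass Ξ]

theorem map_uniformOn_univ (f : Ξ → X) (hf : Measurable f) :
    (ProbabilityTheory.uniformOn (Set.univ : Set Ξ)).map f
      = ∑ ξ, ((Fintype.card Ξ : ℝ≥0∞)⁻¹) • Measure.dirac (f ξ) := by
  ext s hs
  rw [Measure.map_apply hf hs, ProbabilityTheory.uniformOn_univ, Measure.finsetSum_apply]
  simp only [Measure.smul_apply, Measure.dirac_apply' _ hs, smul_eq_mul]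
  rw [← Finset.mul_sum, ENNReal.div_eq_inv_mul]
  congr 1
  rw [← MeasureTheory.lintegral_indicator_one (hf hs), lintegral_count, tsum_fintype]
  rfl

/-- The law of a uniformly chosen random map applied to a random point. -/
theorem bind_map_uniformOn (m : Measure X) (f : X → Ξ → X) (hf : ∀ ξ, Measurable fun x => f x ξ)
    (hf' : ∀ x, Measurable (f x)) :
    m.bind (fun x => (ProbabilityTheory.uniformOn (Set.univ : Set Ξ)).map (f x))
      = ∑ ξ, ((Fintype.card Ξ : ℝ≥0∞)⁻¹) • m.map fun x => f x ξ := by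
  have h : (fun x => (ProbabilityTheory.uniformOn (Set.univ : Set Ξ)).map (f x))
      = fun x => ∑ ξ, ((Fintype.card Ξ : ℝ≥0∞)⁻¹) • Measure.dirac (f x ξ) :=
    funext fun x => map_uniformOn_univ (f x) (hf' x)
  have hval : ∀ (s : Set X), MeasurableSet s → ∀ x,
      (∑ ξ, ((Fintype.card Ξ : ℝ≥0∞)⁻¹) • Measure.dirac (f x ξ)) s
        = ∑ ξ, ((Fintype.card Ξ : ℝ≥0∞)⁻¹) * ((fun x => f x ξ) ⁻¹' s).indicator 1 x := by
    intro s hs x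
    rw [Measure.finsetSum_apply]
    simp only [Measure.smul_apply, Measure.dirac_apply' _ hs, smul_eq_mul]
    rfl
  have hmeas : ∀ (s : Set X), MeasurableSet s → ∀ ξ,
      Measurable (((fun x => f x ξ) ⁻¹' s).indicator (1 : X → ℝ≥0∞)) := fun s hs ξ =>
    measurable_one.indicator (hf ξ hs)
  have hm : Measurable fun x => ∑ ξ, ((Fintype.card Ξ : ℝ≥0∞)⁻¹) • Measure.dirac (f x ξ) := by
    refine Measure.measurable_of_measurable_coe _ fun s hs => ?_
    simp_rw [hval s hs]
    exact Finset.measurable_sum _ fun ξ _ => (hmeas s hs ξ).const_mul _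
  rw [h]
  ext s hs
  rw [Measure.bind_apply hs hm.aemeasurable, Measure.finsetSum_apply]
  simp_rw [hval s hs]
  rw [lintegral_finsetSum _ fun ξ _ => (hmeas s hs ξ).const_mul _]
  refine Finset.sum_congr rfl fun ξ _ => ?_
  rw [lintegral_const_mul _ (hmeas s hs ξ), lintegral_indicator_one (hf ξ hs),
    Measure.smul_apply, Measure.map_apply (hf ξ) hs, smul_eq_mul]

/-- The new law is a finite convex combination of pushforwards, so integrals against it are finite
averages of ordinary integrals. -/
theorem integrable_bind_map_uniformOn [Nonempty Ξ] {m : Measure X} {f : X → Ξ → X}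
    (hf : ∀ ξ, Measurable fun x => f x ξ) (hf' : ∀ x, Measurable (f x)) {φ : X → ℝ}
    (hφ : Measurable φ) (hi : ∀ ξ, Integrable (fun x => φ (f x ξ)) m) :
    Integrable φ (m.bind fun x => (ProbabilityTheory.uniformOn (Set.univ : Set Ξ)).map (f x)) ∧
    ∫ x, φ x ∂(m.bind fun x => (ProbabilityTheory.uniformOn (Set.univ : Set Ξ)).map (f x))
      = ∫ x, 𝔼 ξ, φ (f x ξ) ∂m := by
  have hmap : ∀ ξ ∈ Finset.univ, Integrable φ (((Fintype.card Ξ : ℝ≥0∞)⁻¹) • m.map fun x => f x ξ) := by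
    intro ξ _
    refine Integrable.smul_measure ?_ (by simp [Fintype.card_ne_zero])
    exact (integrable_map_measure hφ.aestronglyMeasurable (hf ξ).aemeasurable).2 (hi ξ)
  rw [bind_map_uniformOn m f hf hf']
  refine ⟨integrable_finsetSum_measure.2 hmap, ?_⟩
  rw [integral_finsetSum_measure hmap]
  simp_rw [Fintype.expect_eq_sum_div_card, integral_div]
  rw [integral_finsetSum _ fun ξ _ => hi ξ, Finset.sum_div]
  refine Finset.sum_congr rfl fun ξ _ => ?_
  rw [integral_smul_measure, integral_map (hf ξ).aemeasurable hφ.aestronglyMeasurable]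
  simp [div_eq_inv_mul]

end RandomMaps

/-! ### A discrete Grönwall inequality with two time scales -/

section Recursion

/-- A slow variable `a` and a contracting variable `b`, coupled with strength `O(μ)`, over
`O(1/μ)` steps. -/
theorem exists_bound_of_recursion {Γ θ c : ℝ} (hΓ : 0 ≤ Γ) (hθ0 : 0 ≤ θ) (hθ1 : θ < 1)
    (hc : 0 ≤ c) :
    ∃ Γ' μ₀ : ℝ, 1 ≤ Γ' ∧ 0 < μ₀ ∧ ∀ μ t : ℝ, 0 < μ → μ ≤ μ₀ → 0 ≤ t → ∀ a b : ℕ → ℝ,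
      (∀ n, 0 ≤ a n) → (∀ n, 0 ≤ b n) →
      (∀ n, a (n + 1) ≤ (1 + Γ * μ) * a n + Γ * μ * b n + Γ * μ * t) →
      (∀ n, b (n + 1) ≤ (θ + Γ * μ) * b n + Γ * μ * a n + Γ * μ * t) →
      ∀ n : ℕ, (n : ℝ) ≤ c / μ + 1 →
        a n ≤ Γ' * (a 0 + b 0 + t) ∧ b n ≤ Γ' * (b 0 + μ * (a 0 + b 0 + t)) := by
  set g := (1 - θ) / 2 with hg
  have hg0 : 0 < g := by rw [hg]; linarith
  set κ := Γ / g with hκ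
  have hκ0 : 0 ≤ κ := by positivity
  have hκg : κ * g = Γ := by rw [hκ]; field_simp
  set Γ₂ := Γ * (1 + κ) with hΓ₂
  have hΓ₂0 : 0 ≤ Γ₂ := by positivity
  set E := Real.exp (Γ₂ * (c + 1)) * (1 + κ) with hE
  have hE1 : 1 ≤ E := by
    have : 1 ≤ Real.exp (Γ₂ * (c + 1)) := Real.one_le_exp (by positivity)
    rw [hE]; nlinarith
  refine ⟨E + κ * (E + 1), min 1 (g / (Γ + 1)), ?_, by positivity, ?_⟩
  · have : 0 ≤ κ * (E + 1) := by positivity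
    linarith
  intro μ t hμ hμ₀ ht a b ha hb hra hrb
  have hμ1 : μ ≤ 1 := hμ₀.trans (min_le_left _ _)
  have hΓμ : Γ * μ ≤ g := by
    have h1 : μ ≤ g / (Γ + 1) := hμ₀.trans (min_le_right _ _)
    rw [le_div_iff₀ (by linarith)] at h1
    nlinarith
  have hrb' : ∀ n, b (n + 1) ≤ (1 - g) * b n + Γ * μ * (a n + t) := by
    intro n
    have h1 : (θ + Γ * μ) * b n ≤ (1 - g) * b n := by
      refine mul_le_mul_of_nonneg_right ?_ (hb n)
      rw [hg] at hΓμ ⊢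
      linarith
    linarith [hrb n]
  -- A Lyapunov function. With $\kappa g=\Gamma$, the contraction gain $\kappa\mu g\,b$ cancels the
  -- coupling term $\Gamma\mu\,b$ of the slow variable, so only growth by a factor $1+O(\mu)$
  -- remains.
  have hΦ : ∀ n, a (n + 1) + κ * μ * b (n + 1) + t ≤ (1 + Γ₂ * μ) * (a n + κ * μ * b n + t) := by
    intro n
    have h1 := mul_le_mul_of_nonneg_left (hrb' n) (by positivity : 0 ≤ κ * μ)
    have h2 : κ * μ * ((1 - g) * b n) = κ * μ * b n - Γ * μ * b n := by rw [← hκg]; ring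
    have h3 : κ * μ * (Γ * μ * (a n + t)) ≤ κ * Γ * μ * (a n + t) := by
      have : 0 ≤ κ * Γ * μ * (a n + t) := by
        have := ha n
        positivity
      nlinarith
    have h4 : 0 ≤ Γ₂ * μ * (κ * μ * b n) := by
      have := hb n
      positivity
    have h5 : Γ₂ * μ * (a n + t) = Γ * μ * (a n + t) + κ * Γ * μ * (a n + t) := by rw [hΓ₂]; ring
    linarith [hra n]
  have hΦn : ∀ n : ℕ, a n + κ * μ * b n + t ≤ (1 + Γ₂ * μ) ^ n * (a 0 + κ * μ * b 0 + t) := by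
    intro n
    induction n with
    | zero => simp
    | succ n ih =>
      refine (hΦ n).trans ?_
      rw [pow_succ', mul_assoc (1 + Γ₂ * μ)]
      exact mul_le_mul_of_nonneg_left ih (by positivity)
  have hS0 : 0 ≤ a 0 + b 0 + t := by linarith [ha 0, hb 0]
  have hA : ∀ n : ℕ, (n : ℝ) ≤ c / μ + 1 → a n ≤ E * (a 0 + b 0 + t) := by
    intro n hn
    have h1 : (1 + Γ₂ * μ) ^ n ≤ Real.exp (Γ₂ * (c + 1)) := by
      have h2 : (1 + Γ₂ * μ) ^ n ≤ Real.exp (Γ₂ * μ) ^ n := by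
        gcongr
        linarith [Real.add_one_le_exp (Γ₂ * μ)]
      refine h2.trans ?_
      rw [← Real.exp_nat_mul]
      refine Real.exp_le_exp.2 ?_
      have h3 : n * μ ≤ c + 1 := by
        have := mul_le_mul_of_nonneg_right hn hμ.le
        rw [add_mul, div_mul_cancel₀ _ hμ.ne'] at this
        linarith
      calc n * (Γ₂ * μ) = Γ₂ * (n * μ) := by ring
        _ ≤ _ := by gcongr
    have h2 : a 0 + κ * μ * b 0 + t ≤ (1 + κ) * (a 0 + b 0 + t) := by
      have : κ * μ * b 0 ≤ κ * 1 * b 0 := by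
        have := hb 0
        gcongr
      nlinarith [ha 0, hb 0, mul_nonneg hκ0 (ha 0), mul_nonneg hκ0 ht]
    have h3 : 0 ≤ a 0 + κ * μ * b 0 + t := by
      have := ha 0
      have := hb 0
      positivity
    calc a n ≤ a n + κ * μ * b n + t := by
          have : 0 ≤ κ * μ * b n := by
            have := hb n
            positivity
          linarith
      _ ≤ (1 + Γ₂ * μ) ^ n * (a 0 + κ * μ * b 0 + t) := hΦn n
      _ ≤ Real.exp (Γ₂ * (c + 1)) * ((1 + κ) * (a 0 + b 0 + t)) := by gcongr
      _ = _ := by rw [hE]; ring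
  -- Once `a` is bounded, the forcing of `b` is exactly `g` times the added level, so the bound
  -- reproduces itself. It is smaller than the bound for `a` by a factor $\mu$, up to the initial
  -- value.
  have hB : ∀ n : ℕ, (n : ℝ) ≤ c / μ + 1 → b n ≤ b 0 + κ * (E + 1) * (μ * (a 0 + b 0 + t)) := by
    intro n
    induction n with
    | zero =>
      intro _
      have : 0 ≤ κ * (E + 1) * (μ * (a 0 + b 0 + t)) := by positivity
      linarith
    | succ n ih =>
      intro hn
      have hn' : (n : ℝ) ≤ c / μ + 1 := by
        push_cast at hn
        linarith
      have h1 := ih hn'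
      have h2 := hA n hn'
      have h3 : a n + t ≤ (E + 1) * (a 0 + b 0 + t) := by linarith [ha 0, hb 0]
      have h4 : Γ * μ * (a n + t) ≤ Γ * μ * ((E + 1) * (a 0 + b 0 + t)) := by gcongr
      have hg1 : 0 ≤ 1 - g := by rw [hg]; linarith
      have h5 := mul_le_mul_of_nonneg_left h1 hg1
      have h6 : Γ * μ * ((E + 1) * (a 0 + b 0 + t))
          = g * (κ * (E + 1) * (μ * (a 0 + b 0 + t))) := by rw [← hκg]; ring
      have h7 : 0 ≤ g * b 0 := mul_nonneg hg0.le (hb 0)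
      linarith [hrb' n]
  intro n hn
  have hpos : 0 ≤ μ * (a 0 + b 0 + t) := by positivity
  constructor
  · have := hA n hn
    have : 0 ≤ κ * (E + 1) * (a 0 + b 0 + t) := by positivity
    linarith
  · have h1 := hB n hn
    have h2 : 0 ≤ κ * (E + 1) * b 0 := mul_nonneg (by positivity) (hb 0)
    have h3 : 1 * b 0 ≤ E * b 0 := mul_le_mul_of_nonneg_right hE1 (hb 0)
    have h4 : 0 ≤ E * (μ * (a 0 + b 0 + t)) := by positivity
    linarith

end Recursion


/-! ### Expectations under the law of the iterates -/

section Law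

variable {K M D : ℕ} {Y : Type*} {S : Problem K M D Y} {att : S.Attack}
  {A₁ A₂ : Matrix (Fin K) (Fin K) ℝ} {μ : ℝ} {B : ℕ} {ν : Measure (State K M)}

instance Problem.neZero_N (S : Problem K M D Y) (k : Fin K) : NeZero (S.N k) :=
  ⟨(S.N_pos k).ne'⟩

theorem Problem.measurable_step (hm : ∀ k i, Measurable fun w => S.advGrad att k w i)
    (ξ : S.Batch B) : Measurable fun W => S.step att A₁ A₂ μ B W ξ := by
  refine measurable_pi_iff.2 fun k => ?_
  unfold Problem.step
  refine Finset.measurable_sum _ fun l _ => ?_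
  have h1 : Measurable fun W : State K M => ∑ m, A₁ m l • W m :=
    Finset.measurable_sum _ fun m _ => by
      have h : Measurable fun W : State K M => W m := measurable_pi_apply m
      exact h.const_smul (A₁ m l)
  have h2 : Measurable fun W : State K M => ∑ b, S.advGrad att l (W l) (ξ l b) :=
    Finset.measurable_sum _ fun b _ => (hm l (ξ l b)).comp (measurable_pi_apply l)
  exact (h1.sub (h2.const_smul (μ / (B : ℝ)))).const_smul (A₂ l k)

theorem Problem.law_integral (hm : ∀ k i, Measurable fun w => S.advGrad att k w i) (n : ℕ)
    {φ : State K M → ℝ} (hφ : Measurable φ)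
    (hi : ∀ ξ : S.Batch B, Integrable (fun W => φ (gradStep (S.advGrad att) A₁ A₂ μ W ξ))
      (S.law att A₁ A₂ μ B ν n)) :
    Integrable φ (S.law att A₁ A₂ μ B ν (n + 1)) ∧
    ∫ W, φ W ∂(S.law att A₁ A₂ μ B ν (n + 1))
      = ∫ W, 𝔼 ξ : S.Batch B, φ (gradStep (S.advGrad att) A₁ A₂ μ W ξ)
          ∂(S.law att A₁ A₂ μ B ν n) :=
  integrable_bind_map_uniformOn (f := S.step att A₁ A₂ μ B) (S.measurable_step hm)
    (fun _ => measurable_of_countable _) hφ hi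

theorem Problem.isProbabilityMeasure_law [IsProbabilityMeasure ν]
    (hm : ∀ k i, Measurable fun w => S.advGrad att k w i) (n : ℕ) :
    IsProbabilityMeasure (S.law att A₁ A₂ μ B ν n) := by
  induction n with
  | zero => simpa [Problem.law]
  | succ n ih =>
    rw [Problem.law, bind_map_uniformOn _ _ (S.measurable_step hm) fun _ => measurable_of_countable _]
    refine ⟨?_⟩
    rw [Measure.finsetSum_apply]
    have : ∀ ξ : S.Batch B, (((Fintype.card (S.Batch B) : ℝ≥0∞)⁻¹) • (S.law att A₁ A₂ μ B ν n).map
        fun W => S.step att A₁ A₂ μ B W ξ) Set.univ = (Fintype.card (S.Batch B) : ℝ≥0∞)⁻¹ := by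
      intro ξ
      rw [Measure.smul_apply, Measure.map_apply (S.measurable_step hm ξ) MeasurableSet.univ]
      simp
    rw [Finset.sum_congr rfl fun ξ _ => this ξ, Finset.sum_const, Finset.card_univ, nsmul_eq_mul]
    exact ENNReal.mul_inv_cancel (Nat.cast_ne_zero.2 Fintype.card_ne_zero)
      (ENNReal.natCast_ne_top _)

/-- Turns a bound on the average over all batches into one for each single batch; this is how
conditional moment bounds yield integrability. -/
theorem le_card_mul_expect {Ξ : Type*} [Fintype Ξ] [Nonempty Ξ] {f : Ξ → ℝ} (hf : ∀ ξ, 0 ≤ f ξ)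
    (ξ : Ξ) : f ξ ≤ Fintype.card Ξ * 𝔼 η, f η := by
  rw [Fintype.expect_eq_sum_div_card,
    mul_div_cancel₀ _ (Nat.cast_ne_zero.2 Fintype.card_ne_zero)]
  exact Finset.single_le_sum (fun η _ => hf η) (Finset.mem_univ ξ)

theorem Problem.measurable_comp_gradStep (hm : ∀ k i, Measurable fun w => S.advGrad att k w i)
    {φ : State K M → ℝ} (hφ : Measurable φ) (ξ : S.Batch B) :
    Measurable fun W => φ (gradStep (S.advGrad att) A₁ A₂ μ W ξ) :=
  hφ.comp (S.measurable_step hm ξ)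

theorem integrable_expect {X Ξ : Type*} [MeasurableSpace X] [Fintype Ξ] {m : Measure X}
    {f : Ξ → X → ℝ} (hf : ∀ ξ, Integrable (f ξ) m) : Integrable (fun x => 𝔼 ξ, f ξ x) m := by
  simp_rw [Fintype.expect_eq_sum_div_card]
  exact (integrable_finsetSum _ fun ξ _ => hf ξ).div_const _

theorem Problem.integrable_comp_gradStep (hm : ∀ k i, Measurable fun w => S.advGrad att k w i)
    (n : ℕ) {φ φ' ψ : State K M → ℝ} (hφ : Measurable φ) (hφ' : ∀ W, |φ W| ≤ φ' W)
    (hψ : Integrable ψ (S.law att A₁ A₂ μ B ν n))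
    (h : ∀ W, 𝔼 ξ : S.Batch B, φ' (gradStep (S.advGrad att) A₁ A₂ μ W ξ) ≤ ψ W)
    (ξ : S.Batch B) : Integrable (fun W => φ (gradStep (S.advGrad att) A₁ A₂ μ W ξ))
      (S.law att A₁ A₂ μ B ν n) := by
  refine (hψ.const_mul (Fintype.card (S.Batch B) : ℝ)).mono'
    (S.measurable_comp_gradStep hm hφ ξ).aestronglyMeasurable (Eventually.of_forall fun W => ?_)
  refine (hφ' _).trans ((le_card_mul_expect
    (fun η => (abs_nonneg _).trans (hφ' (gradStep (S.advGrad att) A₁ A₂ μ W η))) ξ).trans ?_)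
  exact mul_le_mul_of_nonneg_left (h W) (Nat.cast_nonneg _)

/-- Moments after a step from a conditional moment bound. -/
theorem Problem.law_integral_le (hm : ∀ k i, Measurable fun w => S.advGrad att k w i) (n : ℕ)
    {φ ψ : State K M → ℝ} (hφ : Measurable φ) (hφ0 : ∀ W, 0 ≤ φ W)
    (hψ : Integrable ψ (S.law att A₁ A₂ μ B ν n))
    (h : ∀ W, 𝔼 ξ : S.Batch B, φ (gradStep (S.advGrad att) A₁ A₂ μ W ξ) ≤ ψ W) :
    Integrable φ (S.law att A₁ A₂ μ B ν (n + 1)) ∧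
    ∫ W, φ W ∂(S.law att A₁ A₂ μ B ν (n + 1)) ≤ ∫ W, ψ W ∂(S.law att A₁ A₂ μ B ν n) := by
  have hi := S.integrable_comp_gradStep (A₁ := A₁) (A₂ := A₂) (μ := μ) (ν := ν) hm n hφ
    (fun W => (abs_of_nonneg (hφ0 W)).le) hψ h
  obtain ⟨h1, h2⟩ := S.law_integral hm n hφ hi
  refine ⟨h1, h2.trans_le ?_⟩
  exact integral_mono (integrable_expect hi) hψ h

theorem Problem.law_integral_le_affine [IsProbabilityMeasure ν]
    (hm : ∀ k i, Measurable fun w => S.advGrad att k w i) (n : ℕ)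
    {φ f₁ f₂ : State K M → ℝ} (hφ : Measurable φ) (hφ0 : ∀ W, 0 ≤ φ W)
    (h₁ : Integrable f₁ (S.law att A₁ A₂ μ B ν n)) (h₂ : Integrable f₂ (S.law att A₁ A₂ μ B ν n))
    {α β γ : ℝ} (h : ∀ W, 𝔼 ξ : S.Batch B, φ (gradStep (S.advGrad att) A₁ A₂ μ W ξ)
      ≤ α * f₁ W + β * f₂ W + γ) :
    ∫ W, φ W ∂(S.law att A₁ A₂ μ B ν (n + 1)) ≤ α * ∫ W, f₁ W ∂(S.law att A₁ A₂ μ B ν n)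
      + β * ∫ W, f₂ W ∂(S.law att A₁ A₂ μ B ν n) + γ := by
  have := S.isProbabilityMeasure_law (A₁ := A₁) (A₂ := A₂) (μ := μ) (B := B) (ν := ν) hm n
  have i₁ := h₁.const_mul α
  have i₂ := h₂.const_mul β
  have i₁₂ : Integrable (fun W => α * f₁ W + β * f₂ W) (S.law att A₁ A₂ μ B ν n) := i₁.add i₂
  refine (S.law_integral_le hm n hφ hφ0 (ψ := fun W => α * f₁ W + β * f₂ W + γ)
    (i₁₂.add (integrable_const γ)) h).2.trans (le_of_eq ?_)
  rw [integral_add i₁₂ (integrable_const γ), integral_add i₁ i₂, integral_const_mul,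
    integral_const_mul]
  simp

theorem Problem.abs_law_integral_sub_le (hm : ∀ k i, Measurable fun w => S.advGrad att k w i)
    (n : ℕ) {φ ψ η : State K M → ℝ} (hφ : Measurable φ)
    (hi : ∀ ξ : S.Batch B, Integrable (fun W => φ (gradStep (S.advGrad att) A₁ A₂ μ W ξ))
      (S.law att A₁ A₂ μ B ν n))
    (hψ : Integrable ψ (S.law att A₁ A₂ μ B ν n)) (hη : Integrable η (S.law att A₁ A₂ μ B ν n))
    (h : ∀ W, |(𝔼 ξ : S.Batch B, φ (gradStep (S.advGrad att) A₁ A₂ μ W ξ)) - ψ W| ≤ η W) :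
    |∫ W, φ W ∂(S.law att A₁ A₂ μ B ν (n + 1)) - ∫ W, ψ W ∂(S.law att A₁ A₂ μ B ν n)|
      ≤ ∫ W, η W ∂(S.law att A₁ A₂ μ B ν n) := by
  rw [(S.law_integral hm n hφ hi).2, ← integral_sub (integrable_expect hi) hψ]
  exact (abs_integral_le_integral_abs).trans
    (integral_mono ((integrable_expect hi).sub hψ).abs hη h)

end Law

/-! ### Second and fourth moments over the horizon -/

section Moments

variable {K M D : ℕ} {Y : Type*} {S : Problem K M D Y} {att : S.Attack}
  {A₁ A₂ : Matrix (Fin K) (Fin K) ℝ} {w₀ : Vec M} {d : Net K (Vec M)} {H : Vec M →L[ℝ] Vec M}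
  {Hk : Fin K → Vec M →L[ℝ] Vec M} {C θ δ μ : ℝ} {B : ℕ} {ν : Measure (State K M)}

theorem continuous_netError (w₀ : Vec M) : Continuous (netError w₀ : State K M → Net K (Vec M)) :=
  (PiLp.continuous_toLp 2 _).comp (by fun_prop)

theorem continuous_mean_netError (w₀ : Vec M) :
    Continuous fun W : State K M => mean (netError w₀ W) := by
  have : (fun W : State K M => mean (netError w₀ W))
      = fun W => (1 / (K : ℝ)) • ∑ k, (W k - w₀) := rfl
  rw [this]
  fun_prop

theorem continuous_deviation (w₀ : Vec M) (μ : ℝ) (E : Net K (Vec M)) :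
    Continuous fun W : State K M => deviation w₀ μ E W := by
  have h := continuous_mean_netError (K := K) w₀
  refine (PiLp.continuous_toLp 2 _).comp (continuous_pi fun k => ?_)
  have : (fun W : State K M => (centre (netError w₀ W) + μ • E).ofLp k)
      = fun W => W k - w₀ - mean (netError w₀ W) + μ • E k := rfl
  exact this ▸ (((continuous_apply k).sub continuous_const).sub h).add continuous_const

variable [NeZero K]

/-- The conditional fourth-moment bounds dominate the next iterate by integrable functions of the
present one, so finiteness propagates by induction. -/
theorem StepBounds.integrable_pow_four
    (h : StepBounds (S.advGrad att) A₁ A₂ w₀ d H Hk C θ δ μ B)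
    (hm : ∀ k i, Measurable fun w => S.advGrad att k w i) [IsProbabilityMeasure ν]
    (hν : Integrable (fun W => ‖netError w₀ W‖ ^ 4) ν) (n : ℕ) :
    Integrable (fun W => ‖mean (netError w₀ W)‖ ^ 4) (S.law att A₁ A₂ μ B ν n) ∧
    Integrable (fun W => ‖deviation w₀ μ (drift A₁ A₂ d n) W‖ ^ 4)
      (S.law att A₁ A₂ μ B ν n) := by
  have mx : Measurable fun W : State K M => ‖mean (netError w₀ W)‖ ^ 4 :=
    ((continuous_mean_netError w₀).norm.pow 4).measurable
  have my : ∀ n, Measurable fun W : State K M => ‖deviation w₀ μ (drift A₁ A₂ d n) W‖ ^ 4 :=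
    fun n => ((continuous_deviation w₀ μ _).norm.pow 4).measurable
  induction n with
  | zero =>
    constructor
    · refine hν.mono' mx.aestronglyMeasurable (Eventually.of_forall fun W => ?_)
      rw [Real.norm_of_nonneg (by positivity)]
      gcongr
      exact norm_mean_le _
    · refine hν.mono' (my 0).aestronglyMeasurable (Eventually.of_forall fun W => ?_)
      rw [Real.norm_of_nonneg (by positivity)]
      gcongr
      simp only [deviation, drift, smul_zero, add_zero]
      exact AdvNet.norm_centre_le _
  | succ n ih =>
    have := S.isProbabilityMeasure_law (A₁ := A₁) (A₂ := A₂) (μ := μ) (B := B) (ν := ν) hm n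
    constructor
    · refine (S.law_integral_le hm n mx (fun W => by positivity) ?_
        (h.expect_mean_pow_four_le n)).1
      exact ((ih.1.const_mul _).add (ih.2.const_mul _)).add (integrable_const _)
    · refine (S.law_integral_le hm n (my (n + 1)) (fun W => by positivity) ?_
        (h.expect_deviation_pow_four_le n)).1
      exact ((ih.2.const_mul _).add (ih.1.const_mul _)).add (integrable_const _)

/-- Functions of at most quartic growth are integrable. -/
theorem StepBounds.integrable_of_growth
    (h : StepBounds (S.advGrad att) A₁ A₂ w₀ d H Hk C θ δ μ B)
    (hm : ∀ k i, Measurable fun w => S.advGrad att k w i) [IsProbabilityMeasure ν]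
    (hν : Integrable (fun W => ‖netError w₀ W‖ ^ 4) ν) (n : ℕ) {φ : State K M → ℝ}
    (hφ : Measurable φ) (c₁ : ℝ)
    (hb : ∀ W, |φ W| ≤ c₁ * (1 + ‖mean (netError w₀ W)‖ ^ 4
      + ‖deviation w₀ μ (drift A₁ A₂ d n) W‖ ^ 4)) :
    Integrable φ (S.law att A₁ A₂ μ B ν n) := by
  have := S.isProbabilityMeasure_law (A₁ := A₁) (A₂ := A₂) (μ := μ) (B := B) (ν := ν) hm n
  obtain ⟨h1, h2⟩ := h.integrable_pow_four hm hν n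
  exact ((((integrable_const 1).add h1).add h2).const_mul c₁).mono' hφ.aestronglyMeasurable
    (Eventually.of_forall hb)

theorem StepBounds.integrable_sq
    (h : StepBounds (S.advGrad att) A₁ A₂ w₀ d H Hk C θ δ μ B)
    (hm : ∀ k i, Measurable fun w => S.advGrad att k w i) [IsProbabilityMeasure ν]
    (hν : Integrable (fun W => ‖netError w₀ W‖ ^ 4) ν) (n : ℕ) :
    Integrable (fun W => ‖mean (netError w₀ W)‖ ^ 2) (S.law att A₁ A₂ μ B ν n) ∧
    Integrable (fun W => ‖deviation w₀ μ (drift A₁ A₂ d n) W‖ ^ 2)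
      (S.law att A₁ A₂ μ B ν n) := by
  have key : ∀ x y : ℝ, |x ^ 2| ≤ 1 * (1 + x ^ 4 + y ^ 4) := by
    intro x y
    rw [abs_of_nonneg (sq_nonneg x)]
    nlinarith [sq_nonneg (x ^ 2 - 1), sq_nonneg (y ^ 2), sq_nonneg (x ^ 2)]
  refine ⟨h.integrable_of_growth hm hν n ((continuous_mean_netError w₀).norm.pow 2).measurable 1
    fun W => key _ _, h.integrable_of_growth hm hν n
      ((continuous_deviation w₀ μ _).norm.pow 2).measurable 1 fun W => ?_⟩
  rw [add_right_comm]
  exact key _ _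

/-- Moments of centroid and deviation, uniformly over `O(1/μ)` steps. -/
theorem exists_moment_bound (K M : ℕ) [NeZero K] (C θ c : ℝ) (hθ0 : 0 ≤ θ)
    (hθ1 : θ < 1) (hc : 0 ≤ c) :
    ∃ Γ μ₀ : ℝ, 1 ≤ Γ ∧ 0 < μ₀ ∧ ∀ {D : ℕ} {Y : Type u} {S : Problem K M D Y} {att : S.Attack}
      {A₁ A₂ : Matrix (Fin K) (Fin K) ℝ} {w₀ : Vec M} {d : Net K (Vec M)}
      {H : Vec M →L[ℝ] Vec M} {Hk : Fin K → Vec M →L[ℝ] Vec M} {δ μ : ℝ} {B : ℕ}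
      {ν : Measure (State K M)} [IsProbabilityMeasure ν],
      StepBounds (S.advGrad att) A₁ A₂ w₀ d H Hk C θ δ μ B →
      (∀ k i, Measurable fun w => S.advGrad att k w i) →
      Integrable (fun W => ‖netError w₀ W‖ ^ 4) ν →
      ∫ W, ‖netError w₀ W‖ ^ 2 ∂ν ≤ δ ^ 2 * μ ^ 2 → ∫ W, ‖netError w₀ W‖ ^ 4 ∂ν ≤ μ ^ 3 →
      μ ≤ μ₀ → ∀ n : ℕ, (n : ℝ) ≤ c / μ + 1 →
      ∫ W, ‖mean (netError w₀ W)‖ ^ 2 ∂(S.law att A₁ A₂ μ B ν n) ≤ Γ * μ ^ 2 ∧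
      ∫ W, ‖deviation w₀ μ (drift A₁ A₂ d n) W‖ ^ 2 ∂(S.law att A₁ A₂ μ B ν n)
        ≤ Γ * (δ ^ 2 * μ ^ 2) ∧
      ∫ W, ‖mean (netError w₀ W)‖ ^ 4 ∂(S.law att A₁ A₂ μ B ν n) ≤ Γ * μ ^ 3 ∧
      ∫ W, ‖deviation w₀ μ (drift A₁ A₂ d n) W‖ ^ 4 ∂(S.law att A₁ A₂ μ B ν n) ≤ Γ * μ ^ 3 := by
  -- All constants are built from `K`, `C`, `θ`, `c` before the problem is introduced, which makes
  -- the bound uniform over problems, batch sizes and step sizes.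
  have hg : 0 < 1 - θ := by linarith
  set C₁ : ℝ := 16 * (K * C / (1 - θ)) ^ 6 with hC₁
  have hC₁0 : 0 ≤ C₁ := by positivity
  set Γ₀ : ℝ := 10 * C₁ ^ 2 + 7 * C₁ ^ 2 / (1 - θ) + 3000 * C₁ ^ 5 + 448 * C₁ ^ 4 / (1 - θ) ^ 3
    with hΓ₀
  have g1 : 10 * C₁ ^ 2 ≤ Γ₀ := by
    have : 0 ≤ 7 * C₁ ^ 2 / (1 - θ) + 3000 * C₁ ^ 5 + 448 * C₁ ^ 4 / (1 - θ) ^ 3 := by positivity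
    linarith
  have g2 : 7 * C₁ ^ 2 / (1 - θ) ≤ Γ₀ := by
    have : 0 ≤ 10 * C₁ ^ 2 + 3000 * C₁ ^ 5 + 448 * C₁ ^ 4 / (1 - θ) ^ 3 := by positivity
    linarith
  have g3 : 3000 * C₁ ^ 5 ≤ Γ₀ := by
    have : 0 ≤ 10 * C₁ ^ 2 + 7 * C₁ ^ 2 / (1 - θ) + 448 * C₁ ^ 4 / (1 - θ) ^ 3 := by positivity
    linarith
  have g4 : 448 * C₁ ^ 4 / (1 - θ) ^ 3 ≤ Γ₀ := by
    have : 0 ≤ 10 * C₁ ^ 2 + 7 * C₁ ^ 2 / (1 - θ) + 3000 * C₁ ^ 5 := by positivity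
    linarith
  have hΓ₀0 : 0 ≤ Γ₀ := le_trans (by positivity) g1
  -- Applied twice, at the forcing level $\mu^2$ for second and $\mu^3$ for fourth moments: a step
  -- adds $O(\mu)$ times that level.
  obtain ⟨Γ, μ₀, hΓ1, hμ₀, hrec⟩ := exists_bound_of_recursion hΓ₀0 hθ0 hθ1 hc
  have hΓ0 : 0 ≤ Γ := by linarith
  refine ⟨5 * Γ, μ₀, by linarith, hμ₀, ?_⟩
  intro D Y S att A₁ A₂ w₀ d H Hk δ μ B ν _ h hm hν hν2 hν4 hμμ₀ n hn
  have hμ := h.pos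
  have hμ1 := h.le_one
  have hprob := fun n =>
    S.isProbabilityMeasure_law (A₁ := A₁) (A₂ := A₂) (μ := μ) (B := B) (ν := ν) hm n
  have i4 := h.integrable_pow_four hm hν
  have i2 := h.integrable_sq hm hν
  have hν2i : Integrable (fun W => ‖netError w₀ W‖ ^ 2) ν := by
    refine (hν.add (integrable_const 1)).mono'
      ((continuous_netError w₀).norm.pow 2).measurable.aestronglyMeasurable
      (Eventually.of_forall fun W => ?_)
    rw [Real.norm_of_nonneg (by positivity)]
    simp only [Pi.add_apply]
    nlinarith [sq_nonneg (‖netError w₀ W‖ ^ 2 - 1), sq_nonneg (‖netError w₀ W‖ ^ 2)]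
  have hdev0 : ∀ W : State K M, ‖deviation w₀ μ (drift A₁ A₂ d 0) W‖ ≤ ‖netError w₀ W‖ := by
    intro W
    simp only [deviation, drift, smul_zero, add_zero]
    exact AdvNet.norm_centre_le _
  have st : ∀ j : ℕ, Integrable (fun W => ‖netError w₀ W‖ ^ j) ν →
      Integrable (fun W => ‖mean (netError w₀ W)‖ ^ j) ν →
      Integrable (fun W => ‖deviation w₀ μ (drift A₁ A₂ d 0) W‖ ^ j) ν →
      ∫ W, ‖mean (netError w₀ W)‖ ^ j ∂ν ≤ ∫ W, ‖netError w₀ W‖ ^ j ∂ν ∧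
      ∫ W, ‖deviation w₀ μ (drift A₁ A₂ d 0) W‖ ^ j ∂ν ≤ ∫ W, ‖netError w₀ W‖ ^ j ∂ν := by
    intro j a1 a2 a3
    exact ⟨integral_mono a2 a1 fun W => pow_le_pow_left₀ (norm_nonneg _) (norm_mean_le _) j,
      integral_mono a3 a1 fun W => pow_le_pow_left₀ (norm_nonneg _) (hdev0 W) j⟩
  obtain ⟨s2a, s2b⟩ := st 2 hν2i (i2 0).1 (i2 0).2
  obtain ⟨s4a, s4b⟩ := st 4 hν (i4 0).1 (i4 0).2
  -- second moments
  have r2 := hrec μ (μ ^ 2) hμ hμμ₀ (sq_nonneg μ)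
    (fun n => ∫ W, ‖mean (netError w₀ W)‖ ^ 2 ∂(S.law att A₁ A₂ μ B ν n))
    (fun n => ∫ W, ‖deviation w₀ μ (drift A₁ A₂ d n) W‖ ^ 2 ∂(S.law att A₁ A₂ μ B ν n))
    (fun n => integral_nonneg fun W => by positivity)
    (fun n => integral_nonneg fun W => by positivity)
    (fun n => S.law_integral_le_affine hm n
      (φ := fun W => ‖mean (netError w₀ W)‖ ^ 2)
      ((continuous_mean_netError w₀).norm.pow 2).measurable (fun W => by positivity) (i2 n).1 (i2 n).2
      fun W => (h.expect_mean_sq_le n W).trans (by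
        have : Γ₀ * μ * μ ^ 2 = Γ₀ * μ ^ 3 := by ring
        rw [this]
        gcongr))
    (fun n => S.law_integral_le_affine hm n
      (φ := fun W => ‖deviation w₀ μ (drift A₁ A₂ d (n + 1)) W‖ ^ 2)
      ((continuous_deviation w₀ μ _).norm.pow 2).measurable (fun W => by positivity) (i2 n).2 (i2 n).1
      fun W => (h.expect_deviation_sq_le n W).trans (by
        have : Γ₀ * μ * μ ^ 2 = Γ₀ * μ ^ 3 := by ring
        rw [this]
        gcongr))
    n hn
  -- fourth moments
  have r4 := hrec μ (μ ^ 3) hμ hμμ₀ (by positivity)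
    (fun n => ∫ W, ‖mean (netError w₀ W)‖ ^ 4 ∂(S.law att A₁ A₂ μ B ν n))
    (fun n => ∫ W, ‖deviation w₀ μ (drift A₁ A₂ d n) W‖ ^ 4 ∂(S.law att A₁ A₂ μ B ν n))
    (fun n => integral_nonneg fun W => by positivity)
    (fun n => integral_nonneg fun W => by positivity)
    (fun n => S.law_integral_le_affine hm n
      (φ := fun W => ‖mean (netError w₀ W)‖ ^ 4)
      ((continuous_mean_netError w₀).norm.pow 4).measurable (fun W => by positivity) (i4 n).1 (i4 n).2
      fun W => (h.expect_mean_pow_four_le n W).trans (by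
        have : Γ₀ * μ * μ ^ 3 = Γ₀ * μ ^ 4 := by ring
        rw [this]
        gcongr))
    (fun n => S.law_integral_le_affine hm n
      (φ := fun W => ‖deviation w₀ μ (drift A₁ A₂ d (n + 1)) W‖ ^ 4)
      ((continuous_deviation w₀ μ _).norm.pow 4).measurable (fun W => by positivity) (i4 n).2 (i4 n).1
      fun W => (h.expect_deviation_pow_four_le n W).trans (by
        have : Γ₀ * μ * μ ^ 3 = Γ₀ * μ ^ 4 := by ring
        rw [this]
        gcongr))
    n hn
  have hδ1 : δ ^ 2 * μ ^ 2 ≤ μ ^ 2 := by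
    have : δ ^ 2 ≤ 1 := pow_le_one₀ h.δ_pos.le h.δ_le
    nlinarith [sq_nonneg μ]
  -- The extra factor $\mu$ in the bound of the fast variable is converted into $\delta^2$, so the
  -- corrected deviation is $o(\mu^2)$ in mean square.
  have hμδ : μ * μ ^ 2 ≤ δ ^ 2 * μ ^ 2 := mul_le_mul_of_nonneg_right h.le_sq (sq_nonneg μ)
  have hμ43 : μ * μ ^ 3 ≤ 1 * μ ^ 3 := by gcongr
  simp only [Problem.law] at r2 r4
  refine ⟨r2.1.trans ?_, r2.2.trans ?_, r4.1.trans ?_, r4.2.trans ?_⟩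
  · calc _ ≤ Γ * (5 * μ ^ 2) := by gcongr; linarith [sq_nonneg μ]
      _ = _ := by ring
  · have : μ * ((∫ W, ‖mean (netError w₀ W)‖ ^ 2 ∂ν)
        + (∫ W, ‖deviation w₀ μ (drift A₁ A₂ d 0) W‖ ^ 2 ∂ν) + μ ^ 2) ≤ μ * (3 * μ ^ 2) := by
      gcongr; linarith
    calc _ ≤ Γ * (5 * (δ ^ 2 * μ ^ 2)) := by
          gcongr
          linarith [mul_nonneg (sq_nonneg δ) (sq_nonneg μ)]
      _ = _ := by ring
  · calc _ ≤ Γ * (5 * μ ^ 3) := by gcongr; linarith [pow_pos hμ 3]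
      _ = _ := by ring
  · have : μ * ((∫ W, ‖mean (netError w₀ W)‖ ^ 4 ∂ν)
        + (∫ W, ‖deviation w₀ μ (drift A₁ A₂ d 0) W‖ ^ 4 ∂ν) + μ ^ 3) ≤ μ * (3 * μ ^ 3) := by
      gcongr; linarith
    calc _ ≤ Γ * (5 * μ ^ 3) := by gcongr; linarith [pow_pos hμ 3]
      _ = _ := by ring

end Moments


/-! ### Linearity of the noise power and the telescoping sum -/

section NoisePower

variable {K : ℕ} {N : Fin K → ℕ} {F : Type*} [NormedAddCommGroup F] [InnerProductSpace ℝ F]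
  {g : ∀ k, F → Fin (N k) → F} {w₀ : F} {d : Net K F} {H : F →L[ℝ] F}
  {Hk : Fin K → F →L[ℝ] F} {C δ μ : ℝ}

theorem isLinearMap_noisePower (g : ∀ k, F → Fin (N k) → F) (W : Fin K → F) :
    IsLinearMap ℝ (noisePower g W) where
  map_add T T' := by
    simp only [noisePower, _root_.add_apply, inner_add_left, Finset.expect_add_distrib,
      Finset.sum_add_distrib, mul_add]
  map_smul a T := by
    simp only [noisePower, _root_.smul_apply, real_inner_smul_left, ← Finset.mul_expect,
      ← Finset.mul_sum, smul_eq_mul]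
    ring

theorem abs_noisePower_le [NeZero K] [∀ k, NeZero (N k)] (hg : GradBounds g w₀ d H Hk C δ μ)
    (T : F →L[ℝ] F) : |noisePower g (fun _ => w₀) T| ≤ ‖T‖ * C := by
  have hK : (1 : ℝ) ≤ K := one_le_cast_of_neZero
  have hC := hg.one_le
  have h1 : ∀ k, |𝔼 i, ⟪T (sampleNoise g k w₀ i), sampleNoise g k w₀ i⟫| ≤ ‖T‖ * C := by
    intro k
    have h2 : 𝔼 i, ‖T‖ * ‖sampleNoise g k w₀ i‖ ^ 2 ≤ ‖T‖ * C := by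
      rw [← Finset.mul_expect]
      gcongr
      simpa using expect_norm_sampleNoise_sq_le hg k w₀
    refine le_trans ?_ h2
    refine (abs_expect_le _).trans (expect_mono fun i => ?_)
    refine (abs_real_inner_le_norm _ _).trans ?_
    rw [sq, ← mul_assoc]
    gcongr
    exact T.le_opNorm _
  rw [noisePower, abs_mul, abs_of_nonneg (by positivity)]
  have h3 : |∑ k, 𝔼 i, ⟪T (sampleNoise g k w₀ i), sampleNoise g k w₀ i⟫| ≤ K * (‖T‖ * C) := by
    refine (Finset.abs_sum_le_sum_abs _ _).trans ((Finset.sum_le_sum fun k _ => h1 k).trans ?_)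
    simp
  calc _ ≤ (1 / (K : ℝ)) ^ 2 * (K * (‖T‖ * C)) := by gcongr
    _ = (1 / (K : ℝ)) * (‖T‖ * C) := by field_simp
    _ ≤ 1 * (‖T‖ * C) := by
      gcongr
      exact (div_le_one (by linarith)).2 hK
    _ = _ := one_mul _

end NoisePower

/-- Telescoped geometric sum of the squared contraction `1 - μ H`. -/
theorem sum_mul_contraction_pow {R : Type*} [Ring R] [Algebra ℝ R] (H : R) (μ : ℝ) (n : ℕ) :
    (2 * μ) • ∑ j ∈ Finset.range n, (1 - μ • H) ^ j * H * (1 - μ • H) ^ j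
      = (1 - (1 - μ • H) ^ (2 * n))
        + μ ^ 2 • ∑ j ∈ Finset.range n, H * H * (1 - μ • H) ^ (2 * j) := by
  have hc : Commute H (1 - μ • H) :=
    (Commute.one_right H).sub_right ((Commute.refl H).smul_right μ)
  have h1 : ∀ j : ℕ, (1 - μ • H) ^ j * H * (1 - μ • H) ^ j = H * (1 - μ • H) ^ (2 * j) := by
    intro j
    rw [← (hc.pow_right j).eq, mul_assoc, ← pow_add, two_mul]
  have h2 : (1 - μ • H) ^ 2 = 1 - (2 * μ) • H + μ ^ 2 • (H * H) := by
    rw [sq, sub_mul, mul_sub, mul_sub, smul_mul_smul_comm]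
    simp only [one_mul, mul_one]
    rw [two_mul, add_smul, sq]
    abel
  induction n with
  | zero => simp
  | succ n ih =>
    have e : (1 - μ • H) ^ (2 * (n + 1)) = (1 - μ • H) ^ 2 * (1 - μ • H) ^ (2 * n) := by
      rw [← pow_add]; ring_nf
    rw [Finset.sum_range_succ, Finset.sum_range_succ, smul_add, smul_add, ih, e, h2, h1]
    simp only [add_mul, sub_mul, one_mul, smul_mul_assoc]
    abel

/-! ### The quadratic form of the centroid over many steps -/

section Expansion

variable {K M D : ℕ} {Y : Type*} {S : Problem K M D Y} {att : S.Attack}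
  {A₁ A₂ : Matrix (Fin K) (Fin K) ℝ} {w₀ : Vec M} {d : Net K (Vec M)} {H : Vec M →L[ℝ] Vec M}
  {Hk : Fin K → Vec M →L[ℝ] Vec M} {C θ δ μ : ℝ} {B : ℕ} {ν : Measure (State K M)}

theorem size_sq_le (w₀ : Vec M) (μ : ℝ) (E : Net K (Vec M)) (W : State K M) :
    size w₀ μ E W ^ 2 ≤ 3 * (‖mean (netError w₀ W)‖ ^ 2 + ‖deviation w₀ μ E W‖ ^ 2 + μ ^ 2) :=
  add_add_sq_le _ _ _

theorem size_pow_four_le (w₀ : Vec M) (μ : ℝ) (E : Net K (Vec M)) (W : State K M) :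
    size w₀ μ E W ^ 4 ≤ 27 * (‖mean (netError w₀ W)‖ ^ 4 + ‖deviation w₀ μ E W‖ ^ 4 + μ ^ 4) :=
  add_add_pow_four_le _ _ _

theorem continuous_size (w₀ : Vec M) (μ : ℝ) (E : Net K (Vec M)) :
    Continuous (size w₀ μ E : State K M → ℝ) :=
  ((continuous_mean_netError w₀).norm.add (continuous_deviation w₀ μ E).norm).add continuous_const

variable [NeZero K]

theorem StepBounds.integrable_size (h : StepBounds (S.advGrad att) A₁ A₂ w₀ d H Hk C θ δ μ B)
    (hm : ∀ k i, Measurable fun w => S.advGrad att k w i) [IsProbabilityMeasure ν]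
    (hν : Integrable (fun W => ‖netError w₀ W‖ ^ 4) ν) (n : ℕ) :
    Integrable (fun W => δ * size w₀ μ (drift A₁ A₂ d n) W ^ 2
      + size w₀ μ (drift A₁ A₂ d n) W ^ 4 / δ) (S.law att A₁ A₂ μ B ν n) := by
  have hδ := h.δ_pos
  have hprob := S.isProbabilityMeasure_law (A₁ := A₁) (A₂ := A₂) (μ := μ) (B := B) (ν := ν) hm n
  obtain ⟨i4, j4⟩ := h.integrable_pow_four hm hν n
  obtain ⟨i2, j2⟩ := h.integrable_sq hm hν n
  have hc := continuous_size (K := K) w₀ μ (drift A₁ A₂ d n)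
  refine ((((i2.add j2).add (integrable_const (μ ^ 2))).const_mul (δ * 3)).add
    (((i4.add j4).add (integrable_const (μ ^ 4))).const_mul (27 / δ))).mono'
    (((hc.pow 2).const_smul δ).add ((hc.pow 4).div_const δ)).measurable.aestronglyMeasurable
    (Eventually.of_forall fun W => ?_)
  rw [Real.norm_of_nonneg (by positivity)]
  simp only [Pi.add_apply]
  have h1 := mul_le_mul_of_nonneg_left (size_sq_le w₀ μ (drift A₁ A₂ d n) W) hδ.le
  have h2 := div_le_div_of_nonneg_right (size_pow_four_le w₀ μ (drift A₁ A₂ d n) W) hδ.le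
  calc _ ≤ _ := add_le_add h1 h2
    _ = _ := by ring

/-- The quartic part costs $\mu^3/\delta$, which is at most $\delta\mu^2$ since $\mu\le\delta^2$.
Therefore the weak bound $O(\mu^3)$ on fourth moments suffices. -/
theorem StepBounds.integral_size_le (h : StepBounds (S.advGrad att) A₁ A₂ w₀ d H Hk C θ δ μ B)
    (hm : ∀ k i, Measurable fun w => S.advGrad att k w i) [IsProbabilityMeasure ν]
    (hν : Integrable (fun W => ‖netError w₀ W‖ ^ 4) ν) (n : ℕ) {Γ : ℝ} (hΓ : 1 ≤ Γ)
    (h1 : ∫ W, ‖mean (netError w₀ W)‖ ^ 2 ∂(S.law att A₁ A₂ μ B ν n) ≤ Γ * μ ^ 2)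
    (h2 : ∫ W, ‖deviation w₀ μ (drift A₁ A₂ d n) W‖ ^ 2 ∂(S.law att A₁ A₂ μ B ν n)
        ≤ Γ * (δ ^ 2 * μ ^ 2))
    (h3 : ∫ W, ‖mean (netError w₀ W)‖ ^ 4 ∂(S.law att A₁ A₂ μ B ν n) ≤ Γ * μ ^ 3)
    (h4 : ∫ W, ‖deviation w₀ μ (drift A₁ A₂ d n) W‖ ^ 4 ∂(S.law att A₁ A₂ μ B ν n)
      ≤ Γ * μ ^ 3) :
    ∫ W, (δ * size w₀ μ (drift A₁ A₂ d n) W ^ 2 + size w₀ μ (drift A₁ A₂ d n) W ^ 4 / δ)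
      ∂(S.law att A₁ A₂ μ B ν n) ≤ 90 * Γ * (δ * μ ^ 2) := by
  have hδ := h.δ_pos
  have hμ := h.pos
  have hμ1 := h.le_one
  have hprob := S.isProbabilityMeasure_law (A₁ := A₁) (A₂ := A₂) (μ := μ) (B := B) (ν := ν) hm n
  obtain ⟨i4, j4⟩ := h.integrable_pow_four hm hν n
  obtain ⟨i2, j2⟩ := h.integrable_sq hm hν n
  have e2 : ∫ W, (‖mean (netError w₀ W)‖ ^ 2 + ‖deviation w₀ μ (drift A₁ A₂ d n) W‖ ^ 2 + μ ^ 2)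
      ∂(S.law att A₁ A₂ μ B ν n) ≤ 3 * Γ * μ ^ 2 := by
    rw [integral_add (f := fun W => ‖mean (netError w₀ W)‖ ^ 2
      + ‖deviation w₀ μ (drift A₁ A₂ d n) W‖ ^ 2) (i2.add j2) (integrable_const _),
      integral_add i2 j2]
    have : Γ * (δ ^ 2 * μ ^ 2) ≤ Γ * (1 * μ ^ 2) := by
      gcongr
      exact pow_le_one₀ hδ.le h.δ_le
    have : 1 * μ ^ 2 ≤ Γ * μ ^ 2 := by gcongr
    simp only [integral_const, probReal_univ, one_smul]
    linarith
  have e4 : ∫ W, (‖mean (netError w₀ W)‖ ^ 4 + ‖deviation w₀ μ (drift A₁ A₂ d n) W‖ ^ 4 + μ ^ 4)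
      ∂(S.law att A₁ A₂ μ B ν n) ≤ 3 * Γ * μ ^ 3 := by
    rw [integral_add (f := fun W => ‖mean (netError w₀ W)‖ ^ 4
      + ‖deviation w₀ μ (drift A₁ A₂ d n) W‖ ^ 4) (i4.add j4) (integrable_const _),
      integral_add i4 j4]
    have : μ ^ 4 ≤ Γ * μ ^ 3 := by
      calc μ ^ 4 = μ * μ ^ 3 := by ring
        _ ≤ Γ * μ ^ 3 := by gcongr; linarith
    simp only [integral_const, probReal_univ, one_smul]
    linarith
  have k2 : Integrable (fun W => ‖mean (netError w₀ W)‖ ^ 2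
      + ‖deviation w₀ μ (drift A₁ A₂ d n) W‖ ^ 2 + μ ^ 2) (S.law att A₁ A₂ μ B ν n) :=
    (i2.add j2).add (integrable_const (μ ^ 2))
  have k4 : Integrable (fun W => ‖mean (netError w₀ W)‖ ^ 4
      + ‖deviation w₀ μ (drift A₁ A₂ d n) W‖ ^ 4 + μ ^ 4) (S.law att A₁ A₂ μ B ν n) :=
    (i4.add j4).add (integrable_const (μ ^ 4))
  have hle : ∫ W, (δ * size w₀ μ (drift A₁ A₂ d n) W ^ 2
      + size w₀ μ (drift A₁ A₂ d n) W ^ 4 / δ) ∂(S.law att A₁ A₂ μ B ν n)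
      ≤ (δ * 3) * (3 * Γ * μ ^ 2) + (27 / δ) * (3 * Γ * μ ^ 3) := by
    refine (integral_mono (h.integrable_size hm hν n)
      ((k2.const_mul (δ * 3)).add (k4.const_mul (27 / δ))) fun W => ?_).trans ?_
    · have h1 := mul_le_mul_of_nonneg_left (size_sq_le w₀ μ (drift A₁ A₂ d n) W) hδ.le
      have h2 := div_le_div_of_nonneg_right (size_pow_four_le w₀ μ (drift A₁ A₂ d n) W) hδ.le
      calc _ ≤ _ := add_le_add h1 h2
        _ = _ := by simp only [Pi.add_apply]; ring
    · simp only [Pi.add_apply]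
      rw [integral_add (k2.const_mul (δ * 3)) (k4.const_mul (27 / δ)), integral_const_mul,
        integral_const_mul]
      gcongr
  refine hle.trans ?_
  have : μ ^ 3 / δ ≤ δ * μ ^ 2 := by
    rw [div_le_iff₀ hδ]
    calc μ ^ 3 = μ * μ ^ 2 := by ring
      _ ≤ δ ^ 2 * μ ^ 2 := by gcongr; exact h.le_sq
      _ = _ := by ring
  calc _ = 9 * Γ * (δ * μ ^ 2) + 81 * Γ * (μ ^ 3 / δ) := by ring
    _ ≤ 9 * Γ * (δ * μ ^ 2) + 81 * Γ * (δ * μ ^ 2) := by gcongr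
    _ = _ := by ring

theorem StepBounds.integrable_quadratic
    (h : StepBounds (S.advGrad att) A₁ A₂ w₀ d H Hk C θ δ μ B)
    (hm : ∀ k i, Measurable fun w => S.advGrad att k w i) [IsProbabilityMeasure ν]
    (hν : Integrable (fun W => ‖netError w₀ W‖ ^ 4) ν) (n : ℕ) (T : Vec M →L[ℝ] Vec M) :
    Integrable (fun W => ⟪T (mean (netError w₀ W)), mean (netError w₀ W)⟫)
      (S.law att A₁ A₂ μ B ν n) := by
  have hc := continuous_mean_netError (K := K) w₀
  refine ((h.integrable_sq hm hν n).1.const_mul ‖T‖).mono'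
    ((T.continuous.comp hc).inner hc).measurable.aestronglyMeasurable
    (Eventually.of_forall fun W => ?_)
  refine (abs_real_inner_le_norm _ _).trans ?_
  rw [sq, ← mul_assoc]
  gcongr
  exact T.le_opNorm _

omit [NeZero K] in
theorem StepBounds.norm_contraction_le
    (h : StepBounds (S.advGrad att) A₁ A₂ w₀ d H Hk C θ δ μ B) :
    ‖(1 : Vec M →L[ℝ] Vec M) - μ • H‖ ≤ 1 + C * μ := by
  refine (norm_sub_le _ _).trans (add_le_add ContinuousLinearMap.norm_id_le ?_)
  rw [norm_smul, Real.norm_of_nonneg h.pos.le, mul_comm]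
  exact mul_le_mul_of_nonneg_right h.grad.norm_H h.pos.le

/-- The weighted second moment of the centroid after `n` steps. -/
theorem StepBounds.abs_integral_quadratic_sub_le
    (h : StepBounds (S.advGrad att) A₁ A₂ w₀ d H Hk C θ δ μ B)
    (hH : ∀ u v, ⟪H u, v⟫ = ⟪u, H v⟫)
    (hm : ∀ k i, Measurable fun w => S.advGrad att k w i) [IsProbabilityMeasure ν]
    (hν : Integrable (fun W => ‖netError w₀ W‖ ^ 4) ν) {E : ℝ} (hE : 0 ≤ E) (n : ℕ)
    (hs : ∀ j < n, ∫ W, (δ * size w₀ μ (drift A₁ A₂ d j) W ^ 2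
      + size w₀ μ (drift A₁ A₂ d j) W ^ 4 / δ) ∂(S.law att A₁ A₂ μ B ν j) ≤ E)
    (T : Vec M →L[ℝ] Vec M) :
    |∫ W, ⟪T (mean (netError w₀ W)), mean (netError w₀ W)⟫ ∂(S.law att A₁ A₂ μ B ν n)
      - ∫ W, ⟪T (((1 - μ • H) ^ n) (mean (netError w₀ W))),
          ((1 - μ • H) ^ n) (mean (netError w₀ W))⟫ ∂ν
      - μ ^ 2 * (1 / (B : ℝ)) * ∑ j ∈ Finset.range n,
          noisePower (S.advGrad att) (fun _ => w₀) ((1 - μ • H) ^ j * T * (1 - μ • H) ^ j)|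
      ≤ n * (1 + C * μ) ^ (2 * n) * ‖T‖ * (100 * (K * C / (1 - θ)) ^ 6 * μ * E) := by
  have hμ := h.pos
  have hC := h.grad.one_le
  have hP := h.one_le_gain.2.2
  set P := K * C / (1 - θ)
  set A := (1 : Vec M →L[ℝ] Vec M) - μ • H with hA
  have hAn : ‖A‖ ≤ 1 + C * μ := h.norm_contraction_le
  have hAs : ∀ u v, ⟪A u, v⟫ = ⟪u, A v⟫ := by
    intro u v
    simp only [hA, _root_.sub_apply, one_apply_eq_self, _root_.smul_apply, inner_sub_left,
      inner_sub_right, real_inner_smul_left, real_inner_smul_right, hH]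
  -- Conditioning on the last step replaces the weight `T` by `A * T * A`, so the induction has to
  -- run over all weights.
  induction n generalizing T with
  | zero => simp [Problem.law]
  | succ n ih =>
    have hprob := S.isProbabilityMeasure_law (A₁ := A₁) (A₂ := A₂) (μ := μ) (B := B) (ν := ν) hm n
    have ih' := ih (fun j hj => hs j (hj.trans n.lt_succ_self)) (A * T * A)
    have hcm := continuous_mean_netError (K := K) w₀
    have hT2 : ∀ v, ⟪(A * T * A) v, v⟫ = ⟪T (A v), A v⟫ := fun v => hAs _ _
    have iA := h.integrable_quadratic hm hν n (A * T * A)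
    have step := S.abs_law_integral_sub_le (A₁ := A₁) (A₂ := A₂) (μ := μ) (B := B) (ν := ν) hm n
      (φ := fun W => ⟪T (mean (netError w₀ W)), mean (netError w₀ W)⟫)
      (ψ := fun W => ⟪(A * T * A) (mean (netError w₀ W)), mean (netError w₀ W)⟫
        + μ ^ 2 * (1 / (B : ℝ)) * noisePower (S.advGrad att) (fun _ => w₀) T)
      (η := fun W => 100 * P ^ 6 * ‖T‖ * μ * (δ * size w₀ μ (drift A₁ A₂ d n) W ^ 2
        + size w₀ μ (drift A₁ A₂ d n) W ^ 4 / δ))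
      ((T.continuous.comp hcm).inner hcm).measurable ?_ (iA.add (integrable_const _))
      ((h.integrable_size hm hν n).const_mul _) fun W => ?_
    · rw [integral_add iA (integrable_const _)] at step
      simp only [integral_const, probReal_univ, one_smul, integral_const_mul] at step
      have e1 : ∀ v, ⟪(A * T * A) ((A ^ n) v), (A ^ n) v⟫
          = ⟪T ((A ^ (n + 1)) v), (A ^ (n + 1)) v⟫ := by
        intro v
        rw [hT2, pow_succ']
        rfl
      have e2 : ∀ j, A ^ j * (A * T * A) * A ^ j = A ^ (j + 1) * T * A ^ (j + 1) := by
        intro j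
        nth_rewrite 2 [pow_succ']
        simp only [pow_succ A j, mul_assoc]
      simp only [e1, e2] at ih'
      -- The latest noise is the summand `j = 0`; the induction hypothesis supplies the sum shifted
      -- by one.
      rw [Finset.sum_range_succ']
      simp only [pow_zero, one_mul, mul_one]
      have hTn : ‖A * T * A‖ ≤ (1 + C * μ) ^ 2 * ‖T‖ := by
        calc ‖A * T * A‖ ≤ ‖A‖ * ‖T‖ * ‖A‖ :=
              (norm_mul_le _ _).trans (by gcongr; exact norm_mul_le _ _)
          _ ≤ (1 + C * μ) * ‖T‖ * (1 + C * μ) := by gcongr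
          _ = _ := by ring
      set q := 1 + C * μ with hq
      have hq1 : 1 ≤ q := by rw [hq]; nlinarith
      set Z := 100 * P ^ 6 * μ * E with hZ
      have hZ0 : 0 ≤ Z := by positivity
      have b1 : (n : ℝ) * q ^ (2 * n) * ‖A * T * A‖ * Z ≤ n * q ^ (2 * (n + 1)) * ‖T‖ * Z := by
        calc _ ≤ (n : ℝ) * q ^ (2 * n) * (q ^ 2 * ‖T‖) * Z := by gcongr
          _ = _ := by ring
      have b2 : 100 * P ^ 6 * ‖T‖ * μ * (∫ W, (δ * size w₀ μ (drift A₁ A₂ d n) W ^ 2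
          + size w₀ μ (drift A₁ A₂ d n) W ^ 4 / δ) ∂(S.law att A₁ A₂ μ B ν n))
          ≤ 1 * q ^ (2 * (n + 1)) * ‖T‖ * Z := by
        calc _ ≤ 100 * P ^ 6 * ‖T‖ * μ * E := by gcongr; exact hs n n.lt_succ_self
          _ = 1 * 1 * ‖T‖ * Z := by rw [hZ]; ring
          _ ≤ _ := by gcongr; exact one_le_pow₀ hq1
      rw [Nat.cast_succ]
      rw [abs_le] at step ih' ⊢
      constructor <;> linarith [step.1, step.2, ih'.1, ih'.2]
    · intro ξ
      refine S.integrable_comp_gradStep hm n ((T.continuous.comp hcm).inner hcm).measurable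
        (φ' := fun W => ‖T‖ * ‖mean (netError w₀ W)‖ ^ 2) (fun W => ?_)
        ?_ (fun W => (Finset.mul_expect _ _ _).symm.trans_le
          (mul_le_mul_of_nonneg_left (h.expect_mean_sq_le n W) (norm_nonneg T))) ξ
      · refine (abs_real_inner_le_norm _ _).trans ?_
        rw [sq, ← mul_assoc]
        gcongr
        exact T.le_opNorm _
      · exact ((((h.integrable_sq hm hν n).1.const_mul _).add
          ((h.integrable_sq hm hν n).2.const_mul _)).add (integrable_const _)).const_mul ‖T‖
    · have := h.abs_expect_quadratic_sub_le n W T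
      rw [hT2, ← sub_sub]
      exact this

end Expansion


/-! ### Expansion of the average risk -/

section RiskExpansion

variable {K M D : ℕ} {Y : Type*} {S : Problem K M D Y} {att : S.Attack}
  {A₁ A₂ : Matrix (Fin K) (Fin K) ℝ} {w₀ : Vec M} {d : Net K (Vec M)} {H : Vec M →L[ℝ] Vec M}
  {Hk : Fin K → Vec M →L[ℝ] Vec M} {C θ δ μ : ℝ} {B : ℕ} {ν : Measure (State K M)}

theorem StepBounds.le_δ (h : StepBounds (S.advGrad att) A₁ A₂ w₀ d H Hk C θ δ μ B) : μ ≤ δ := by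
  have := h.le_sq
  nlinarith [h.δ_pos, h.δ_le]

theorem opNorm_one_le : ‖(1 : Vec M →L[ℝ] Vec M)‖ ≤ 1 := ContinuousLinearMap.norm_id_le

theorem opNorm_pow_le {a : Vec M →L[ℝ] Vec M} {q : ℝ} (h : ‖a‖ ≤ q) (n : ℕ) :
    ‖a ^ n‖ ≤ q ^ n := by
  have hq := (norm_nonneg a).trans h
  induction n with
  | zero => simpa using opNorm_one_le
  | succ n ih =>
    rw [pow_succ, pow_succ]
    exact (norm_mul_le _ _).trans (mul_le_mul ih h (norm_nonneg _) (pow_nonneg hq n))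

variable [NeZero K]

/-- The contribution of the gradient noise, in closed form. -/
theorem StepBounds.abs_sum_noisePower_sub_le
    (h : StepBounds (S.advGrad att) A₁ A₂ w₀ d H Hk C θ δ μ B) (n : ℕ) {X c : ℝ}
    (hX : (1 + C * μ) ^ (2 * n) ≤ X) (hn : n * μ ≤ c) :
    |1 / 2 * (μ ^ 2 * (1 / (B : ℝ)) * ∑ j ∈ Finset.range n, noisePower (S.advGrad att)
        (fun _ => w₀) ((1 - μ • H) ^ j * H * (1 - μ • H) ^ j))
      - μ / (B : ℝ) * (1 / 4 * noisePower (S.advGrad att) (fun _ => w₀)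
        (1 - (1 - μ • H) ^ (2 * n)))| ≤ c * C ^ 4 * X * (δ * μ ^ 2) := by
  have hμ := h.pos
  have hC := h.grad.one_le
  set f := (isLinearMap_noisePower (S.advGrad att) (fun _ => w₀)).mk' _ with hf
  have hfa : ∀ T, noisePower (S.advGrad att) (fun _ => w₀) T = f T := fun T => rfl
  simp only [hfa]
  rw [← map_sum]
  -- The telescoping identity produces the closed form. Its remainder `z` is a sum of `n` bounded
  -- terms and enters with the weight $\frac\mu B\mu^2$, hence contributes $O(\mu^3)$ as $n\mu$ is
  -- bounded.
  have key := congrArg f (sum_mul_contraction_pow H μ n)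
  rw [map_smul, map_add, map_smul, smul_eq_mul, smul_eq_mul] at key
  set s := f (∑ j ∈ Finset.range n, (1 - μ • H) ^ j * H * (1 - μ • H) ^ j)
  set t := f (1 - (1 - μ • H) ^ (2 * n))
  set z := f (∑ j ∈ Finset.range n, H * H * (1 - μ • H) ^ (2 * j)) with hz
  have hq : 1 ≤ 1 + C * μ := by nlinarith
  have hzb : |z| ≤ n * (C ^ 3 * X) := by
    rw [hz, map_sum]
    refine (Finset.abs_sum_le_sum_abs _ _).trans ((Finset.sum_le_sum fun j hj => ?_).trans
      (le_of_eq (by simp : ∑ j ∈ Finset.range n, C ^ 3 * X = _)))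
    have h1 : ‖H * H * (1 - μ • H) ^ (2 * j)‖ ≤ C * C * X := by
      have h2 : ‖((1 : Vec M →L[ℝ] Vec M) - μ • H) ^ (2 * j)‖ ≤ X :=
        (opNorm_pow_le h.norm_contraction_le _).trans
          ((pow_le_pow_right₀ hq (by have := Finset.mem_range.1 hj; omega)).trans hX)
      have hH := h.grad.norm_H
      refine (norm_mul_le _ _).trans (mul_le_mul ((norm_mul_le _ _).trans ?_) h2 (norm_nonneg _)
        (by positivity))
      gcongr
    calc |f (H * H * (1 - μ • H) ^ (2 * j))| ≤ ‖H * H * (1 - μ • H) ^ (2 * j)‖ * C :=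
          abs_noisePower_le h.grad _
      _ ≤ C * C * X * C := by gcongr
      _ = _ := by ring
  have hB := h.batch
  have hX0 : 0 ≤ X := le_trans (by positivity) hX
  have hB0 : 0 ≤ 1 / (B : ℝ) := by positivity
  have e : 1 / 2 * (μ ^ 2 * (1 / (B : ℝ)) * s) - μ / B * (1 / 4 * t)
      = μ * (1 / B) * (1 / 4) * (μ ^ 2 * z) := by
    have : 1 / 2 * (μ ^ 2 * (1 / (B : ℝ)) * s) = μ * (1 / B) * (1 / 4) * (2 * μ * s) := by ring
    rw [this, key]
    ring
  rw [e, abs_mul, abs_mul (μ ^ 2), abs_of_nonneg (by positivity : 0 ≤ μ * (1 / (B : ℝ)) * (1 / 4)),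
    abs_of_nonneg (sq_nonneg μ)]
  have hδ := h.δ_pos
  have hc : 0 ≤ c := le_trans (by positivity) hn
  calc _ ≤ μ * (C * μ) * 1 * (μ ^ 2 * (n * (C ^ 3 * X))) := by gcongr; norm_num
    _ = (n * μ) * C ^ 4 * X * (μ * μ ^ 2) := by ring
    _ ≤ c * C ^ 4 * X * (δ * μ ^ 2) := by gcongr; exact h.le_δ

/-- Unrolling with weight $\bar H$ leaves the transported starting error, the accumulated noise and
the step remainders. The starting error is $O(\delta^2\mu^2)$ because the transport factors are
bounded over the horizon, so the noise alone survives at order $\mu^2$. -/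
theorem StepBounds.abs_integral_hessian_sub_le
    (h : StepBounds (S.advGrad att) A₁ A₂ w₀ d H Hk C θ δ μ B)
    (hH : ∀ u v, ⟪H u, v⟫ = ⟪u, H v⟫)
    (hm : ∀ k i, Measurable fun w => S.advGrad att k w i) [IsProbabilityMeasure ν]
    (hν : Integrable (fun W => ‖netError w₀ W‖ ^ 4) ν)
    (hν2 : ∫ W, ‖mean (netError w₀ W)‖ ^ 2 ∂ν ≤ δ ^ 2 * μ ^ 2) {Γ : ℝ} (hΓ : 1 ≤ Γ) (n : ℕ)
    (hs : ∀ j < n, ∫ W, (δ * size w₀ μ (drift A₁ A₂ d j) W ^ 2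
      + size w₀ μ (drift A₁ A₂ d j) W ^ 4 / δ) ∂(S.law att A₁ A₂ μ B ν j) ≤ Γ * (δ * μ ^ 2))
    {X c : ℝ} (hX : (1 + C * μ) ^ (2 * n) ≤ X) (hn : n * μ ≤ c) :
    |1 / 2 * ∫ W, ⟪H (mean (netError w₀ W)), mean (netError w₀ W)⟫ ∂(S.law att A₁ A₂ μ B ν n)
      - μ / (B : ℝ) * (1 / 4 * noisePower (S.advGrad att) (fun _ => w₀)
        (1 - (1 - μ • H) ^ (2 * n)))|
      ≤ (c * X * C * (100 * (K * C / (1 - θ)) ^ 6 * Γ) + C * X + c * C ^ 4 * X) * (δ * μ ^ 2) := by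
  have hμ := h.pos
  have hC := h.grad.one_le
  have hP := h.one_le_gain.2.2
  have hδ := h.δ_pos
  have hX0 : 0 ≤ X := le_trans (by positivity) hX
  have hc : 0 ≤ c := le_trans (by positivity) hn
  have h1 := h.abs_integral_quadratic_sub_le hH hm hν (E := Γ * (δ * μ ^ 2)) (by positivity) n hs H
  have h2 := h.abs_sum_noisePower_sub_le n hX hn
  set P := K * C / (1 - θ)
  have i2 := (h.integrable_sq hm hν 0).1
  have h3 : |∫ W, ⟪H (((1 - μ • H) ^ n) (mean (netError w₀ W))),
          ((1 - μ • H) ^ n) (mean (netError w₀ W))⟫ ∂ν| ≤ C * X * (δ * μ ^ 2) := by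
    have hb : ∀ v : Vec M, |⟪H (((1 - μ • H) ^ n) v), ((1 - μ • H) ^ n) v⟫| ≤ C * X * ‖v‖ ^ 2 := by
      intro v
      have hv : ‖((1 - μ • H) ^ n) v‖ ≤ (1 + C * μ) ^ n * ‖v‖ :=
        ContinuousLinearMap.le_of_opNorm_le _ (opNorm_pow_le h.norm_contraction_le n) v
      calc _ ≤ ‖H (((1 - μ • H) ^ n) v)‖ * ‖((1 - μ • H) ^ n) v‖ := abs_real_inner_le_norm _ _
        _ ≤ (C * ‖((1 - μ • H) ^ n) v‖) * ‖((1 - μ • H) ^ n) v‖ := by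
          gcongr
          exact ContinuousLinearMap.le_of_opNorm_le _ h.grad.norm_H _
        _ ≤ (C * ((1 + C * μ) ^ n * ‖v‖)) * ((1 + C * μ) ^ n * ‖v‖) := by gcongr
        _ = C * (1 + C * μ) ^ (2 * n) * ‖v‖ ^ 2 := by ring
        _ ≤ _ := by gcongr
    calc _ ≤ ∫ W, C * X * ‖mean (netError w₀ W)‖ ^ 2 ∂ν := by
          rw [← Real.norm_eq_abs]
          exact norm_integral_le_of_norm_le (i2.const_mul _)
            (Eventually.of_forall fun W => hb _)
      _ = C * X * ∫ W, ‖mean (netError w₀ W)‖ ^ 2 ∂ν := integral_const_mul _ _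
      _ ≤ C * X * (δ ^ 2 * μ ^ 2) := by gcongr
      _ ≤ C * X * (δ * μ ^ 2) := by
        gcongr
        nlinarith [h.δ_le]
  have h4 : n * (1 + C * μ) ^ (2 * n) * ‖H‖ * (100 * P ^ 6 * μ * (Γ * (δ * μ ^ 2)))
      ≤ c * X * C * (100 * P ^ 6 * Γ) * (δ * μ ^ 2) := by
    calc _ ≤ n * X * C * (100 * P ^ 6 * μ * (Γ * (δ * μ ^ 2))) := by
          gcongr; exact h.grad.norm_H
      _ = (n * μ) * X * C * (100 * P ^ 6 * Γ) * (δ * μ ^ 2) := by ring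
      _ ≤ _ := by gcongr
  replace h1 := h1.trans h4
  have p1 : 0 ≤ c * X * C * (100 * P ^ 6 * Γ) * (δ * μ ^ 2) := by positivity
  have p2 : 0 ≤ C * X * (δ * μ ^ 2) := by positivity
  rw [abs_le] at h1 h2 h3 ⊢
  constructor <;> linarith [h1.1, h1.2, h2.1, h2.2, h3.1, h3.2]

/-- Pointwise expansion of the average risk around the centroid. -/
theorem StepBounds.abs_average_risk_sub_le
    (h : StepBounds (S.advGrad att) A₁ A₂ w₀ d H Hk C θ δ μ B) {R : Vec M → ℝ}
    (hR : ∀ w, |R w - R w₀ - 1 / 2 * ⟪H (w - w₀), w - w₀⟫| ≤ C * ‖w - w₀‖ ^ 3) (n : ℕ)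
    (hH : ∀ u v, ⟪H u, v⟫ = ⟪u, H v⟫) (W : State K M) :
    |(1 / (K : ℝ)) * ∑ k, R (W k) - R w₀
      - 1 / 2 * ⟪H (mean (netError w₀ W)), mean (netError w₀ W)⟫
      - μ ^ 2 * (1 / (2 * (K : ℝ)) * ∑ k, ⟪H (drift A₁ A₂ d n k), drift A₁ A₂ d n k⟫)|
      ≤ C * (K * C / (1 - θ)) ^ 3 * (δ * size w₀ μ (drift A₁ A₂ d n) W ^ 2
          + size w₀ μ (drift A₁ A₂ d n) W ^ 4 / δ)
        + C * (K * C / (1 - θ)) ^ 2 * (2 / δ * ‖deviation w₀ μ (drift A₁ A₂ d n) W‖ ^ 2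
          + δ * μ ^ 2) := by
  have hμ := h.pos
  have hC := h.grad.one_le
  have hP := h.one_le_gain.2.2
  have hδ := h.δ_pos
  have hδ1 := h.δ_le
  have hK : (1 : ℝ) ≤ K := one_le_cast_of_neZero
  have hK0 : (0 : ℝ) < K := by linarith
  have hD := h.norm_drift_le n
  have hnet := h.norm_netError_le n W
  set P := K * C / (1 - θ)
  set E := drift A₁ A₂ d n
  set v := deviation w₀ μ E W with hv
  set q := size w₀ μ E W
  have hq0 : 0 < q := hμ.trans_le (le_size _ _ _ _)
  set u := netError w₀ W with hu
  have huk : ∀ k, u k = W k - w₀ := fun k => rfl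
  have hq3 : q ^ 3 ≤ δ * q ^ 2 + q ^ 4 / δ := by
    rw [← sub_nonneg]
    have : δ * q ^ 2 + q ^ 4 / δ - q ^ 3 = q ^ 2 / δ * (δ ^ 2 - δ * q + q ^ 2) := by
      field_simp
      ring
    rw [this]
    have : 0 ≤ δ ^ 2 - δ * q + q ^ 2 := by nlinarith [sq_nonneg (δ - q)]
    positivity
  have r1 : |(1 / (K : ℝ)) * ∑ k, (R (W k) - R w₀ - 1 / 2 * ⟪H (u k), u k⟫)|
      ≤ C * P ^ 3 * (δ * q ^ 2 + q ^ 4 / δ) := by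
    have : ∀ k, |R (W k) - R w₀ - 1 / 2 * ⟪H (u k), u k⟫| ≤ C * (P * q) ^ 3 := by
      intro k
      refine (hR (W k)).trans ?_
      gcongr
      exact (PiLp.norm_apply_le u k).trans hnet
    rw [abs_mul, abs_of_pos (by positivity)]
    calc _ ≤ 1 / (K : ℝ) * ∑ k : Fin K, C * (P * q) ^ 3 := by
          gcongr
          exact (Finset.abs_sum_le_sum_abs _ _).trans (Finset.sum_le_sum fun k _ => this k)
      _ = C * P ^ 3 * q ^ 3 := by
          simp only [Finset.sum_const, Finset.card_univ, Fintype.card_fin, nsmul_eq_mul]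
          field_simp
      _ ≤ _ := by gcongr
  -- The raw deviation is the corrected one minus $\mu$ times the drift. The pure drift part is the
  -- heterogeneity term, and the parts that contain `v` are negligible.
  have r2 : ∑ k, ⟪H (centre u k), centre u k⟫ = ∑ k, ⟪H (v k), v k⟫
      - 2 * μ * ∑ k, ⟪H (v k), E k⟫ + μ ^ 2 * ∑ k, ⟪H (E k), E k⟫ := by
    rw [Finset.mul_sum, Finset.mul_sum, ← Finset.sum_sub_distrib, ← Finset.sum_add_distrib]
    refine Finset.sum_congr rfl fun k _ => ?_
    have : centre u k = v k - μ • E k := (add_sub_cancel_right (centre u k) (μ • E k)).symm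
    rw [this]
    simp only [map_sub, map_smul, inner_sub_left, inner_sub_right, real_inner_smul_left,
      real_inner_smul_right]
    rw [hH (E k) (v k), real_inner_comm (H (v k)) (E k)]
    ring
  have hHi : ∀ x y : Vec M, |⟪H x, y⟫| ≤ C * (‖x‖ * ‖y‖) := fun x y =>
    (abs_real_inner_le_norm _ _).trans (by
      rw [← mul_assoc]; gcongr; exact ContinuousLinearMap.le_of_opNorm_le _ h.grad.norm_H _)
  have r3 : |∑ k, ⟪H (v k), v k⟫| ≤ K * (C * (‖v‖ * ‖v‖)) := by
    refine (Finset.abs_sum_le_sum_abs _ _).trans ((Finset.sum_le_sum fun k _ => (hHi _ _).trans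
      (?_ : _ ≤ C * (‖v‖ * ‖v‖))).trans (by simp))
    gcongr <;> exact PiLp.norm_apply_le v k
  have r4 : |∑ k, ⟪H (v k), E k⟫| ≤ K * (C * (‖v‖ * P)) := by
    refine (Finset.abs_sum_le_sum_abs _ _).trans ((Finset.sum_le_sum fun k _ => (hHi _ _).trans
      (?_ : _ ≤ C * (‖v‖ * P))).trans (by simp))
    gcongr
    · exact PiLp.norm_apply_le v k
    · exact (PiLp.norm_apply_le E k).trans hD
  have r5 : |1 / (2 * (K : ℝ)) * (∑ k, ⟪H (v k), v k⟫ - 2 * μ * ∑ k, ⟪H (v k), E k⟫)|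
      ≤ C * P ^ 2 * (2 / δ * ‖v‖ ^ 2 + δ * μ ^ 2) := by
    have s1 : |∑ k, ⟪H (v k), v k⟫ - 2 * μ * ∑ k, ⟪H (v k), E k⟫|
        ≤ K * (C * (‖v‖ * ‖v‖)) + 2 * μ * (K * (C * (‖v‖ * P))) := by
      refine (abs_sub _ _).trans (add_le_add r3 ?_)
      rw [abs_mul, abs_of_pos (by positivity)]
      gcongr
    rw [abs_mul, abs_of_pos (by positivity)]
    -- Young's inequality with weight `δ`: as $\mathbb E\|v\|^2=O(\delta^2\mu^2)$, both terms have
    -- expectation $O(\delta\mu^2)$.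
    have s2 : ‖v‖ * μ ≤ 1 / δ * ‖v‖ ^ 2 + δ * μ ^ 2 := by
      have : 1 / δ * ‖v‖ ^ 2 + δ * μ ^ 2 - ‖v‖ * μ
          = 1 / δ * (‖v‖ ^ 2 - ‖v‖ * (δ * μ) + (δ * μ) ^ 2) := by
        field_simp
        ring
      rw [← sub_nonneg, this]
      have : 0 ≤ ‖v‖ ^ 2 - ‖v‖ * (δ * μ) + (δ * μ) ^ 2 := by
        nlinarith [sq_nonneg (‖v‖ - δ * μ), norm_nonneg v, mul_pos hδ hμ]
      positivity
    have s3 : 1 * ‖v‖ ^ 2 ≤ 1 / δ * ‖v‖ ^ 2 := by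
      gcongr
      exact (one_le_div hδ).2 hδ1
    calc _ ≤ 1 / (2 * (K : ℝ)) * (K * (C * (‖v‖ * ‖v‖)) + 2 * μ * (K * (C * (‖v‖ * P)))) := by
          gcongr
      _ = C * (1 / 2 * ‖v‖ ^ 2 + P * (‖v‖ * μ)) := by field_simp
      _ ≤ C * (P ^ 2 * ‖v‖ ^ 2 + P ^ 2 * (‖v‖ * μ)) := by
          have : P ≤ P ^ 2 := by nlinarith
          gcongr
          nlinarith
      _ = C * P ^ 2 * (1 * ‖v‖ ^ 2 + ‖v‖ * μ) := by ring
      _ ≤ C * P ^ 2 * (1 / δ * ‖v‖ ^ 2 + (1 / δ * ‖v‖ ^ 2 + δ * μ ^ 2)) := by gcongr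
      _ = _ := by ring
  have e : (1 / (K : ℝ)) * ∑ k, R (W k) - R w₀ - 1 / 2 * ⟪H (mean u), mean u⟫
      - μ ^ 2 * (1 / (2 * (K : ℝ)) * ∑ k, ⟪H (E k), E k⟫)
      = (1 / (K : ℝ)) * ∑ k, (R (W k) - R w₀ - 1 / 2 * ⟪H (u k), u k⟫)
        + 1 / (2 * (K : ℝ)) * (∑ k, ⟪H (v k), v k⟫ - 2 * μ * ∑ k, ⟪H (v k), E k⟫) := by
    rw [Finset.sum_sub_distrib, Finset.sum_sub_distrib, ← Finset.mul_sum, sum_quadratic_eq H u, r2]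
    simp only [Finset.sum_const, Finset.card_univ, Fintype.card_fin, nsmul_eq_mul]
    field_simp
    ring
  rw [e]
  exact (abs_add_le _ _).trans (add_le_add r1 r5)

theorem StepBounds.integrable_risk
    (h : StepBounds (S.advGrad att) A₁ A₂ w₀ d H Hk C θ δ μ B)
    (hm : ∀ k i, Measurable fun w => S.advGrad att k w i) [IsProbabilityMeasure ν]
    (hν : Integrable (fun W => ‖netError w₀ W‖ ^ 4) ν) {R : Vec M → ℝ} (hRm : Measurable R)
    (hR : ∀ w, |R w - R w₀ - 1 / 2 * ⟪H (w - w₀), w - w₀⟫| ≤ C * ‖w - w₀‖ ^ 3) (n : ℕ)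
    (k : Fin K) : Integrable (fun W : State K M => R (W k)) (S.law att A₁ A₂ μ B ν n) := by
  have hμ := h.pos
  have hC := h.grad.one_le
  have hP := h.one_le_gain.2.2
  set P := K * C / (1 - θ) with hPd
  have hk : Measurable fun W : State K M => W k := measurable_pi_apply k
  refine h.integrable_of_growth hm hν n (hRm.comp hk) (|R w₀| + 2 * C * (1 + 27 * P ^ 4))
    fun W => ?_
  have hnet : ‖W k - w₀‖ ≤ P * size w₀ μ (drift A₁ A₂ d n) W :=
    (PiLp.norm_apply_le (netError w₀ W) k).trans (h.norm_netError_le n W)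
  set e := ‖W k - w₀‖
  have he : 0 ≤ e := norm_nonneg _
  set x := ‖mean (netError w₀ W)‖
  set y := ‖deviation w₀ μ (drift A₁ A₂ d n) W‖
  have h4 : e ^ 4 ≤ 27 * P ^ 4 * (1 + x ^ 4 + y ^ 4) := by
    calc e ^ 4 ≤ (P * size w₀ μ (drift A₁ A₂ d n) W) ^ 4 := by gcongr
      _ = P ^ 4 * size w₀ μ (drift A₁ A₂ d n) W ^ 4 := by ring
      _ ≤ P ^ 4 * (27 * (x ^ 4 + y ^ 4 + μ ^ 4)) := by
        gcongr
        exact size_pow_four_le _ _ _ _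
      _ ≤ P ^ 4 * (27 * (x ^ 4 + y ^ 4 + 1)) := by
        gcongr
        exact pow_le_one₀ hμ.le h.le_one
      _ = _ := by ring
  have h2 : |⟪H (W k - w₀), W k - w₀⟫| ≤ C * e ^ 2 := by
    refine (abs_real_inner_le_norm _ _).trans ?_
    rw [sq, ← mul_assoc]
    gcongr
    exact ContinuousLinearMap.le_of_opNorm_le _ h.grad.norm_H _
  have h3 : 1 / 2 * e ^ 2 + e ^ 3 ≤ 2 * (1 + e ^ 4) := by
    nlinarith [sq_nonneg (e ^ 2 - 1), sq_nonneg (e ^ 2 - e), sq_nonneg e]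
  have h1 := hR (W k)
  have h5 : |R (W k)| ≤ |R w₀| + C * (1 / 2 * e ^ 2 + e ^ 3) := by
    have := abs_le.1 h1
    have := abs_le.1 h2
    rw [abs_le]
    constructor <;> linarith [neg_abs_le (R w₀), le_abs_self (R w₀)]
  have hS : 1 ≤ 1 + x ^ 4 + y ^ 4 := by
    have : 0 ≤ x ^ 4 + y ^ 4 := by positivity
    linarith
  calc |R (W k)| ≤ |R w₀| * 1 + C * (2 * (1 + e ^ 4)) := by
        rw [mul_one]; exact h5.trans (by gcongr)
    _ ≤ |R w₀| * (1 + x ^ 4 + y ^ 4) + C * (2 * (1 * (1 + x ^ 4 + y ^ 4)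
        + 27 * P ^ 4 * (1 + x ^ 4 + y ^ 4))) := by
        gcongr
        rw [one_mul]
        exact hS
    _ = _ := by ring

/-- The expansion of the average risk after `O(1/μ)` steps. -/
theorem exists_risk_expansion (K M : ℕ) [NeZero K] (C θ c : ℝ) (hθ0 : 0 ≤ θ)
    (hθ1 : θ < 1) (hc : 0 ≤ c) :
    ∃ Γ μ₀ : ℝ, 0 ≤ Γ ∧ 0 < μ₀ ∧ ∀ {D : ℕ} {Y : Type u} {S : Problem K M D Y} {att : S.Attack}
      {A₁ A₂ : Matrix (Fin K) (Fin K) ℝ} {w₀ : Vec M} {d : Net K (Vec M)}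
      {H : Vec M →L[ℝ] Vec M} {Hk : Fin K → Vec M →L[ℝ] Vec M} {δ μ : ℝ} {B : ℕ}
      {ν : Measure (State K M)} [IsProbabilityMeasure ν],
      StepBounds (S.advGrad att) A₁ A₂ w₀ d H Hk C θ δ μ B →
      (∀ u v, ⟪H u, v⟫ = ⟪u, H v⟫) →
      (∀ k i, Measurable fun w => S.advGrad att k w i) →
      Integrable (fun W => ‖netError w₀ W‖ ^ 4) ν →
      ∫ W, ‖netError w₀ W‖ ^ 2 ∂ν ≤ δ ^ 2 * μ ^ 2 → ∫ W, ‖netError w₀ W‖ ^ 4 ∂ν ≤ μ ^ 3 →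
      μ ≤ μ₀ → ∀ {R : Vec M → ℝ}, Measurable R →
      (∀ w, |R w - R w₀ - 1 / 2 * ⟪H (w - w₀), w - w₀⟫| ≤ C * ‖w - w₀‖ ^ 3) →
      ∀ n : ℕ, (n : ℝ) ≤ c / μ + 1 →
      |(1 / (K : ℝ)) * ∑ k, ∫ W, R (W k) ∂(S.law att A₁ A₂ μ B ν n) - R w₀
        - μ / (B : ℝ) * (1 / 4 * noisePower (S.advGrad att) (fun _ => w₀)
            (1 - (1 - μ • H) ^ (2 * n)))
        - μ ^ 2 * (1 / (2 * (K : ℝ)) * ∑ k, ⟪H (drift A₁ A₂ d n k), drift A₁ A₂ d n k⟫)|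
        ≤ Γ * (δ * μ ^ 2) := by
  obtain ⟨Γ, μ₀, hΓ, hμ₀, hmom⟩ := exists_moment_bound.{u} K M C θ c hθ0 hθ1 hc
  have hΓ0 : 0 ≤ Γ := by linarith
  -- The constants are fixed before `1 ≤ C` is available; the absolute value keeps them nonnegative.
  set C' := |C| with hC'
  set P := K * C' / (1 - θ) with hP
  set X := Real.exp (2 * (C' * (c + 1))) with hX
  have hg : 0 < 1 - θ := by linarith
  have hP0 : 0 ≤ P := by positivity
  refine ⟨C' * P ^ 3 * (90 * Γ) + C' * P ^ 2 * (2 * Γ + 1)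
    + ((c + 1) * X * C' * (100 * P ^ 6 * (90 * Γ)) + C' * X + (c + 1) * C' ^ 4 * X), μ₀,
    by positivity, hμ₀, ?_⟩
  intro D Y S att A₁ A₂ w₀ d H Hk δ μ B ν _ h hH hm hν hν2 hν4 hμμ R hRm hR n hn
  have hCC : C' = C := abs_of_nonneg (zero_le_one.trans h.grad.one_le)
  simp only [hP, hCC] at *
  have hC := h.grad.one_le
  have hμ := h.pos
  have hδ := h.δ_pos
  have hmom := fun (j : ℕ) (hj : (j : ℝ) ≤ c / μ + 1) => hmom h hm hν hν2 hν4 hμμ j hj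
  have hsz : ∀ j : ℕ, (j : ℝ) ≤ c / μ + 1 → ∫ W, (δ * size w₀ μ (drift A₁ A₂ d j) W ^ 2
      + size w₀ μ (drift A₁ A₂ d j) W ^ 4 / δ) ∂(S.law att A₁ A₂ μ B ν j)
      ≤ 90 * Γ * (δ * μ ^ 2) := fun j hj => by
    obtain ⟨m1, m2, m3, m4⟩ := hmom j hj
    exact h.integral_size_le hm hν j hΓ m1 m2 m3 m4
  have hnμ : n * μ ≤ c + 1 := by
    have := mul_le_mul_of_nonneg_right hn hμ.le
    rw [add_mul, div_mul_cancel₀ _ hμ.ne'] at this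
    linarith [h.le_one]
  have hXb : (1 + C * μ) ^ (2 * n) ≤ X := by
    calc (1 + C * μ) ^ (2 * n) ≤ Real.exp (C * μ) ^ (2 * n) := by
          gcongr
          linarith [Real.add_one_le_exp (C * μ)]
      _ = Real.exp (2 * (C * (n * μ))) := by
          rw [← Real.exp_nat_mul]
          push_cast
          ring_nf
      _ ≤ X := by
          rw [hX]
          gcongr
  have hprob := S.isProbabilityMeasure_law (A₁ := A₁) (A₂ := A₂) (μ := μ) (B := B) (ν := ν) hm n
  have q1 := h.abs_integral_hessian_sub_le hH hm hν
    ((integral_mono (h.integrable_sq hm hν 0).1 (by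
      refine (hν.add (integrable_const 1)).mono'
        ((continuous_netError w₀).norm.pow 2).measurable.aestronglyMeasurable
        (Eventually.of_forall fun W => ?_)
      rw [Real.norm_of_nonneg (by positivity)]
      simp only [Pi.add_apply]
      nlinarith [sq_nonneg (‖netError w₀ W‖ ^ 2 - 1), sq_nonneg (‖netError w₀ W‖ ^ 2)])
      fun W => pow_le_pow_left₀ (norm_nonneg _) (norm_mean_le _) 2).trans hν2)
    (Γ := 90 * Γ) (by linarith) n
    (fun j hj => hsz j (le_trans (Nat.cast_le.2 hj.le) hn)) hXb hnμ
  have iR := fun k => h.integrable_risk hm hν hRm hR n k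
  have iQ := h.integrable_quadratic hm hν n H
  have iS := h.integrable_size hm hν n
  have iV := (h.integrable_sq hm hν n).2
  have iF : Integrable (fun W : State K M => (1 / (K : ℝ)) * ∑ k, R (W k))
      (S.law att A₁ A₂ μ B ν n) := (integrable_finsetSum _ fun k _ => iR k).const_mul _
  set F := 1 / (2 * (K : ℝ)) * ∑ k, ⟪H (drift A₁ A₂ d n k), drift A₁ A₂ d n k⟫ with hF
  have q2 : |∫ W : State K M, ((1 / (K : ℝ)) * ∑ k, R (W k) - R w₀
      - 1 / 2 * ⟪H (mean (netError w₀ W)), mean (netError w₀ W)⟫ - μ ^ 2 * F)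
        ∂(S.law att A₁ A₂ μ B ν n)|
      ≤ C * (K * C / (1 - θ)) ^ 3 * (90 * Γ * (δ * μ ^ 2))
        + C * (K * C / (1 - θ)) ^ 2 * ((2 * Γ + 1) * (δ * μ ^ 2)) := by
    rw [← Real.norm_eq_abs]
    have iV' : Integrable (fun W => 2 / δ * ‖deviation w₀ μ (drift A₁ A₂ d n) W‖ ^ 2
        + δ * μ ^ 2) (S.law att A₁ A₂ μ B ν n) :=
      (iV.const_mul (2 / δ)).add (integrable_const (δ * μ ^ 2))
    refine (norm_integral_le_of_norm_le ((iS.const_mul _).add (iV'.const_mul _))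
      (Eventually.of_forall fun W => h.abs_average_risk_sub_le hR n hH W)).trans ?_
    simp only [Pi.add_apply]
    rw [integral_add (iS.const_mul _) (iV'.const_mul _), integral_const_mul, integral_const_mul,
      integral_add (iV.const_mul _) (integrable_const _), integral_const_mul]
    simp only [integral_const, probReal_univ, one_smul]
    have hv : 2 / δ * ∫ W, ‖deviation w₀ μ (drift A₁ A₂ d n) W‖ ^ 2 ∂(S.law att A₁ A₂ μ B ν n)
        ≤ 2 * Γ * (δ * μ ^ 2) := by
      calc _ ≤ 2 / δ * (Γ * (δ ^ 2 * μ ^ 2)) := by gcongr; exact (hmom n hn).2.1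
        _ = _ := by field_simp
    gcongr
    · exact hsz n hn
    · linarith
  have e : ∫ W : State K M, ((1 / (K : ℝ)) * ∑ k, R (W k) - R w₀
      - 1 / 2 * ⟪H (mean (netError w₀ W)), mean (netError w₀ W)⟫ - μ ^ 2 * F)
        ∂(S.law att A₁ A₂ μ B ν n)
      = (1 / (K : ℝ)) * ∑ k, ∫ W, R (W k) ∂(S.law att A₁ A₂ μ B ν n) - R w₀
        - 1 / 2 * ∫ W, ⟪H (mean (netError w₀ W)), mean (netError w₀ W)⟫
          ∂(S.law att A₁ A₂ μ B ν n) - μ ^ 2 * F := by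
    have j1 : Integrable (fun W : State K M => (1 / (K : ℝ)) * ∑ k, R (W k) - R w₀)
        (S.law att A₁ A₂ μ B ν n) := iF.sub (integrable_const _)
    have j2 : Integrable (fun W : State K M => (1 / (K : ℝ)) * ∑ k, R (W k) - R w₀
        - 1 / 2 * ⟪H (mean (netError w₀ W)), mean (netError w₀ W)⟫)
        (S.law att A₁ A₂ μ B ν n) := j1.sub (iQ.const_mul _)
    rw [integral_sub j2 (integrable_const _), integral_sub j1 (iQ.const_mul _),
      integral_sub iF (integrable_const _), integral_const_mul, integral_const_mul,
      integral_finsetSum _ fun k _ => iR k]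
    simp
  rw [e] at q2
  rw [abs_le] at q1 q2 ⊢
  constructor <;> linarith [q1.1, q1.2, q2.1, q2.2]

end RiskExpansion


/-! ### Taylor estimates with Lipschitz Hessian -/

section SecondOrder

variable {M : ℕ} {f f₁ f₂ : Vec M → ℝ} {w w₀ : Vec M} {r₀ a η : ℝ}

/-- The second derivative of `f` as a linear map. -/
noncomputable def hessMap (f : Vec M → ℝ) (w : Vec M) : Vec M →L[ℝ] Vec M :=
  LinearMap.toContinuousLinearMap
    { toFun := fun u => (InnerProductSpace.toDual ℝ (Vec M)).symm (hess f w u)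
      map_add' := fun u v => by simp
      map_smul' := fun c u => by simp }

theorem inner_hessMap (f : Vec M → ℝ) (w u v : Vec M) : ⟪hessMap f w u, v⟫ = hess f w u v :=
  InnerProductSpace.toDual_symm_apply

theorem hessMap_apply (f : Vec M → ℝ) (w u : Vec M) :
    hessMap f w u = (InnerProductSpace.toDual ℝ (Vec M)).symm (hess f w u) := rfl

theorem norm_hessMap_sub_le (f f' : Vec M → ℝ) (w w' : Vec M) :
    ‖hessMap f w - hessMap f' w'‖ ≤ ‖hess f w - hess f' w'‖ := by
  refine ContinuousLinearMap.opNorm_le_bound _ (ContinuousLinearMap.opNorm_nonneg _) fun u => ?_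
  rw [_root_.sub_apply, hessMap_apply, hessMap_apply, ← map_sub, LinearIsometryEquiv.norm_map]
  exact (hess f w - hess f' w').le_opNorm u

theorem inner_gradient (f : Vec M → ℝ) (w v : Vec M) : ⟪gradient f w, v⟫ = fderiv ℝ f w v :=
  InnerProductSpace.toDual_symm_apply

theorem norm_gradient_sub (w w' : Vec M) (f f' : Vec M → ℝ) :
    ‖gradient f w - gradient f' w'‖ = ‖fderiv ℝ f w - fderiv ℝ f' w'‖ := by
  rw [gradient, gradient, ← map_sub, LinearIsometryEquiv.norm_map]

theorem inner_hessMap_comm (hf : ContDiffOn ℝ 2 f (Metric.ball w₀ r₀)) (hr : 0 < r₀)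
    (u v : Vec M) : ⟪hessMap f w₀ u, v⟫ = ⟪u, hessMap f w₀ v⟫ := by
  have h : ContDiffAt ℝ 2 f w₀ := hf.contDiffAt (Metric.ball_mem_nhds w₀ hr)
  rw [real_inner_comm (hessMap f w₀ v) u, inner_hessMap, inner_hessMap]
  exact (h.isSymmSndFDerivAt (by simp)).eq u v

theorem hasFDerivAt_fderiv (hf : ContDiffOn ℝ 2 f (Metric.ball w₀ r₀))
    (hw : w ∈ Metric.ball w₀ r₀) : HasFDerivAt (fun v => fderiv ℝ f v) (hess f w) w := by
  have h : ContDiffAt ℝ 2 f w := hf.contDiffAt (Metric.isOpen_ball.mem_nhds hw)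
  have h1 : ContDiffAt ℝ 1 (fderiv ℝ f) w := h.fderiv_right (by norm_num)
  exact (h1.differentiableAt (by simp)).hasFDerivAt

theorem differentiableAt_of_ball (hf : ContDiffOn ℝ 2 f (Metric.ball w₀ r₀))
    (hw : w ∈ Metric.ball w₀ r₀) : DifferentiableAt ℝ f w :=
  (hf.contDiffAt (Metric.isOpen_ball.mem_nhds hw)).differentiableAt (by simp)

/-- Linearization of the gradient of a function with Lipschitz Hessian. -/
theorem norm_gradient_sub_le (hf : ContDiffOn ℝ 2 f (Metric.ball w₀ r₀))
    (hΛ : ∀ v ∈ Metric.ball w₀ r₀, ‖hess f v - hess f w₀‖ ≤ a * ‖v - w₀‖) (ha : 0 ≤ a)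
    (hw : w ∈ Metric.ball w₀ r₀) :
    ‖gradient f w - gradient f w₀ - hessMap f w₀ (w - w₀)‖ ≤ a * ‖w - w₀‖ ^ 2 := by
  have hr : 0 < r₀ := Metric.pos_of_mem_ball hw
  rw [gradient, gradient, hessMap_apply, ← map_sub, ← map_sub, LinearIsometryEquiv.norm_map]
  set R := ‖w - w₀‖ with hR
  have hR0 : R < r₀ := by rwa [hR, ← dist_eq_norm]
  have hsub : Metric.closedBall w₀ R ⊆ Metric.ball w₀ r₀ := Metric.closedBall_subset_ball hR0
  -- Mean value inequality on the closed ball of radius exactly $\|w-w_0\|$, where the Hessian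
  -- differs from its central value by at most `a * R`.
  have key := (convex_closedBall w₀ R).norm_image_sub_le_of_norm_hasFDerivWithin_le'
    (f := fun v => fderiv ℝ f v) (f' := fun v => hess f v) (φ := hess f w₀) (C := a * R)
    (fun v hv => (hasFDerivAt_fderiv hf (hsub hv)).hasFDerivWithinAt)
    (fun v hv => (hΛ v (hsub hv)).trans (by
      gcongr
      rw [← dist_eq_norm]
      exact Metric.mem_closedBall.1 hv))
    (Metric.mem_closedBall_self (norm_nonneg _)) (Metric.mem_closedBall.2 (dist_eq_norm w w₀).le)
  refine key.trans (le_of_eq ?_)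
  rw [← hR]
  ring

/-- Second-order Taylor expansion of a function with Lipschitz Hessian. -/
theorem abs_taylor_le (hf : ContDiffOn ℝ 2 f (Metric.ball w₀ r₀))
    (hΛ : ∀ v ∈ Metric.ball w₀ r₀, ‖hess f v - hess f w₀‖ ≤ a * ‖v - w₀‖) (ha : 0 ≤ a)
    (hw : w ∈ Metric.ball w₀ r₀) :
    |f w - f w₀ - ⟪gradient f w₀, w - w₀⟫ - 1 / 2 * ⟪hessMap f w₀ (w - w₀), w - w₀⟫|
      ≤ a * ‖w - w₀‖ ^ 3 := by
  have hr : 0 < r₀ := Metric.pos_of_mem_ball hw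
  set u := w - w₀ with hu
  have hball : ∀ t ∈ Set.Icc (0 : ℝ) 1, w₀ + t • u ∈ Metric.ball w₀ r₀ := by
    intro t ht
    rw [Metric.mem_ball, dist_eq_norm, add_sub_cancel_left, norm_smul, Real.norm_of_nonneg ht.1]
    have : ‖u‖ < r₀ := by rwa [hu, ← dist_eq_norm]
    nlinarith [ht.2, norm_nonneg u]
  set h : ℝ → ℝ := fun t => f (w₀ + t • u) - t * ⟪gradient f w₀, u⟫
    - t ^ 2 / 2 * ⟪hessMap f w₀ u, u⟫ with hh
  have hd : ∀ t ∈ Set.Icc (0 : ℝ) 1, HasDerivWithinAt h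
      (⟪gradient f (w₀ + t • u) - gradient f w₀ - hessMap f w₀ (t • u), u⟫) (Set.Icc 0 1) t := by
    intro t ht
    have d1 : HasDerivAt (fun s : ℝ => w₀ + s • u) u t := by
      simpa using ((hasDerivAt_id t).smul_const u).const_add w₀
    have d2 := ((differentiableAt_of_ball hf (hball t ht)).hasFDerivAt).comp_hasDerivAt t d1
    have d3 := (d2.sub ((hasDerivAt_id t).mul_const ⟪gradient f w₀, u⟫)).sub
      ((((hasDerivAt_id t).pow 2).div_const 2).mul_const ⟪hessMap f w₀ u, u⟫)
    refine (d3.congr_deriv ?_).hasDerivWithinAt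
    rw [inner_sub_left, inner_sub_left, inner_gradient, map_smul, real_inner_smul_left]
    simp
  have key := norm_image_sub_le_of_norm_deriv_le_segment_01' hd (C := a * ‖u‖ ^ 3) fun t ht => by
    have ht' : t ∈ Set.Icc (0 : ℝ) 1 := Set.Ico_subset_Icc_self ht
    have h1 := norm_gradient_sub_le hf hΛ ha (hball t ht')
    rw [add_sub_cancel_left] at h1
    refine (norm_inner_le_norm _ _).trans ?_
    calc _ ≤ a * ‖t • u‖ ^ 2 * ‖u‖ := by gcongr
      _ ≤ a * ‖u‖ ^ 2 * ‖u‖ := by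
        gcongr
        rw [norm_smul, Real.norm_of_nonneg ht'.1]
        nlinarith [ht'.2, norm_nonneg u]
      _ = _ := by ring
  rw [Real.norm_eq_abs] at key
  refine le_trans (le_of_eq ?_) key
  congr 1
  simp only [hh, hu]
  simp
  ring

/-- Bound of the Hessian by the behaviour of the gradient at a fixed distance. -/
theorem norm_hessMap_le {L : ℝ} (hf : ContDiffOn ℝ 2 f (Metric.ball w₀ r₀)) (hr : 0 < r₀)
    (hΛ : ∀ v ∈ Metric.ball w₀ r₀, ‖hess f v - hess f w₀‖ ≤ a * ‖v - w₀‖) (ha : 0 ≤ a)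
    (hL0 : 0 ≤ L) (hη : 0 ≤ η)
    (hL : ∀ v ∈ Metric.ball w₀ r₀, ‖gradient f v - gradient f w₀‖ ≤ L * ‖v - w₀‖ + η) :
    ‖hessMap f w₀‖ ≤ a * r₀ + L + 2 * η / r₀ := by
  refine ContinuousLinearMap.opNorm_le_of_unit_norm (by positivity) fun u hu => ?_
  -- At this fixed distance the gradient increment over `s` approximates the Hessian in direction
  -- `u`, with an error `a * s`; the offset `η` costs `η / s`.
  set s := r₀ / 2 with hs
  have hs0 : 0 < s := by positivity
  have hmem : w₀ + s • u ∈ Metric.ball w₀ r₀ := by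
    rw [Metric.mem_ball, dist_eq_norm, add_sub_cancel_left, norm_smul, hu,
      Real.norm_of_nonneg hs0.le]
    linarith
  have h1 := norm_gradient_sub_le hf hΛ ha hmem
  have h2 := hL _ hmem
  rw [add_sub_cancel_left] at h1 h2
  rw [norm_smul, hu, Real.norm_of_nonneg hs0.le, mul_one] at h1 h2
  have h3 : s * ‖hessMap f w₀ u‖ ≤ a * s ^ 2 + (L * s + η) := by
    have e : s • hessMap f w₀ u = (gradient f (w₀ + s • u) - gradient f w₀)
        - (gradient f (w₀ + s • u) - gradient f w₀ - hessMap f w₀ (s • u)) := by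
      rw [map_smul]; abel
    have : ‖s • hessMap f w₀ u‖ = s * ‖hessMap f w₀ u‖ := by
      rw [norm_smul, Real.norm_of_nonneg hs0.le]
    rw [← this, e]
    refine (norm_sub_le _ _).trans ?_
    linarith
  have h4 : ‖hessMap f w₀ u‖ ≤ a * s + L + η / s := by
    rw [← mul_le_mul_iff_of_pos_left hs0]
    refine h3.trans (le_of_eq ?_)
    field_simp
    ring
  have h5 : η / s = 2 * η / r₀ := by rw [hs]; field_simp
  have h6 : a * s ≤ a * r₀ := by gcongr; linarith
  linarith

/-- A Lipschitz bound controls the gradient. -/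
theorem norm_gradient_sub_le_of_lip (h₁ : DifferentiableAt ℝ f₁ w)
    (h₂ : DifferentiableAt ℝ f₂ w) (hη : 0 ≤ η)
    (h : ∀ v v', |(f₁ v - f₂ v) - (f₁ v' - f₂ v')| ≤ η * ‖v - v'‖) :
    ‖gradient f₁ w - gradient f₂ w‖ ≤ η := by
  rw [norm_gradient_sub]
  exact (h₁.hasFDerivAt.sub h₂.hasFDerivAt).le_of_lip' hη
    (Eventually.of_forall fun v => h v w)

/-- First-order expansion of a function with Lipschitz gradient. -/
theorem abs_sub_inner_gradient_le {L : ℝ} (hf : Differentiable ℝ f) (hL0 : 0 ≤ L)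
    (hL : ∀ v, ‖gradient f v - gradient f w₀‖ ≤ L * ‖v - w₀‖) (w : Vec M) :
    |f w - f w₀ - ⟪gradient f w₀, w - w₀⟫| ≤ L * ‖w - w₀‖ ^ 2 := by
  set R := ‖w - w₀‖ with hR
  have key := (convex_closedBall w₀ R).norm_image_sub_le_of_norm_hasFDerivWithin_le'
    (f := f) (f' := fun v => fderiv ℝ f v) (φ := fderiv ℝ f w₀) (C := L * R)
    (fun v _ => (hf v).hasFDerivAt.hasFDerivWithinAt)
    (fun v hv => by
      rw [← norm_gradient_sub]
      refine (hL v).trans ?_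
      gcongr
      rw [← dist_eq_norm]
      exact Metric.mem_closedBall.1 hv)
    (Metric.mem_closedBall_self (norm_nonneg _)) (Metric.mem_closedBall.2 (dist_eq_norm w w₀).le)
  rw [inner_gradient]
  refine key.trans (le_of_eq ?_)
  rw [← hR]
  ring

/-- The Hessian at a local minimizer is positive semidefinite. -/
theorem inner_nonneg_of_isLocalMin {H : Vec M →L[ℝ] Vec M} {C : ℝ}
    (hmin : IsLocalMin f w₀)
    (h : ∀ w, |f w - f w₀ - 1 / 2 * ⟪H (w - w₀), w - w₀⟫| ≤ C * ‖w - w₀‖ ^ 3) (v : Vec M) :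
    0 ≤ ⟪H v, v⟫ := by
  have h1 : Tendsto (fun t : ℝ => w₀ + t • v) (𝓝[>] 0) (𝓝 w₀) := by
    have : Continuous fun t : ℝ => w₀ + t • v := by fun_prop
    simpa using (this.tendsto 0).mono_left nhdsWithin_le_nhds
  -- Minimality along the ray $w_0+tv$, divided by $t^2/2$; the cubic error then vanishes as
  -- $t\downarrow0$.
  have h2 : ∀ᶠ t : ℝ in 𝓝[>] 0, -(2 * C * t * ‖v‖ ^ 3) ≤ ⟪H v, v⟫ := by
    filter_upwards [h1.eventually hmin, self_mem_nhdsWithin] with t ht ht0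
    have ht0 : 0 < t := ht0
    have := h (w₀ + t • v)
    rw [add_sub_cancel_left, map_smul, real_inner_smul_left, real_inner_smul_right, norm_smul,
      Real.norm_of_nonneg ht0.le] at this
    have := (abs_le.1 this).2
    have h3 : 0 ≤ t ^ 2 * (⟪H v, v⟫ + 2 * C * t * ‖v‖ ^ 3) := by linarith
    have := nonneg_of_mul_nonneg_right h3 (by positivity)
    linarith
  have h3 : Tendsto (fun t : ℝ => -(2 * C * t * ‖v‖ ^ 3)) (𝓝[>] 0) (𝓝 0) := by
    have : Continuous fun t : ℝ => -(2 * C * t * ‖v‖ ^ 3) := by fun_prop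
    simpa using (this.tendsto 0).mono_left nhdsWithin_le_nhds
  exact le_of_tendsto h3 h2

end SecondOrder


/-! ### Comparison of robust and unperturbed risks -/

section Regularity

/-- Every coordinate is bounded by the $\ell_p$ norm. The dimension factor is harmless since $D$ is
fixed. -/
theorem norm_le_of_mem_pBall {D : ℕ} {p : ℝ≥0∞} [Fact (1 ≤ p)] {ε : ℝ} {z : Vec D}
    (hz : z ∈ pBall D p ε) : ‖z‖ ≤ D * ε := by
  have h : ∀ i, ‖z i‖ ≤ ε := fun i =>
    (PiLp.norm_apply_le (WithLp.toLp p (WithLp.ofLp z) : PiLp p (fun _ : Fin D => ℝ)) i).trans hz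
  calc ‖z‖ ≤ ∑ i, ‖z i‖ := norm_net_le_sum z
    _ ≤ ∑ _i : Fin D, ε := Finset.sum_le_sum fun i _ => h i
    _ = D * ε := by simp

variable {K M D : ℕ} {Y : Type*} {S : Problem K M D Y} {p : ℝ≥0∞} {ε L L' : ℝ} {att : S.Attack}
  {w₀ : Vec M}

theorem Problem.Smooth.mono (h : S.Smooth L) (hL : L ≤ L') : S.Smooth L' where
  diff_w := h.diff_w
  diff_x := h.diff_x
  lip_ww k w₁ w₂ x y := (h.lip_ww k w₁ w₂ x y).trans (by gcongr)
  lip_wx k w x₁ x₂ y := (h.lip_wx k w x₁ x₂ y).trans (by gcongr)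
  lip_xw k w₁ w₂ x y := (h.lip_xw k w₁ w₂ x y).trans (by gcongr)
  lip_xx k w x₁ x₂ y := (h.lip_xx k w x₁ x₂ y).trans (by gcongr)

theorem Problem.Smooth.continuous_gradW (h : S.Smooth L) (k : Fin K) (y : Y) :
    Continuous fun q : Vec M × Vec D => S.gradW k q.1 q.2 y := by
  have hL : S.Smooth |L| := h.mono (le_abs_self L)
  refine continuous_iff_continuousAt.2 fun q => tendsto_iff_norm_sub_tendsto_zero.2 ?_
  have h1 : Tendsto (fun r : Vec M × Vec D => |L| * ‖r.1 - q.1‖ + |L| * ‖r.2 - q.2‖)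
      (𝓝 q) (𝓝 0) := by
    have : Continuous fun r : Vec M × Vec D => |L| * ‖r.1 - q.1‖ + |L| * ‖r.2 - q.2‖ := by
      fun_prop
    simpa using this.tendsto q
  refine squeeze_zero (fun _ => norm_nonneg _) (fun r => ?_) h1
  calc _ ≤ ‖S.gradW k r.1 r.2 y - S.gradW k q.1 r.2 y‖
        + ‖S.gradW k q.1 r.2 y - S.gradW k q.1 q.2 y‖ := norm_sub_le_norm_sub_add_norm_sub _ _ _
    _ ≤ _ := add_le_add (hL.lip_ww k _ _ _ _) (hL.lip_wx k _ _ _ _)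

theorem Problem.Smooth.measurable_advGrad (h : S.Smooth L) (ha : S.IsAttack p ε att)
    (k : Fin K) (i : Fin (S.N k)) : Measurable fun w => S.advGrad att k w i :=
  (h.continuous_gradW k (S.y k i)).measurable.comp
    (measurable_id.prodMk (measurable_const.add (ha.meas k i)))

/-- The gradient at the unperturbed samples. -/
noncomputable def Problem.nominalGrad (S : Problem K M D Y) (k : Fin K) (w : Vec M)
    (i : Fin (S.N k)) : Vec M :=
  S.gradW k w (S.x k i) (S.y k i)

/-- The empirical risk at the unperturbed samples. -/
noncomputable def Problem.nominalRisk (S : Problem K M D Y) (k : Fin K) (w : Vec M) : ℝ :=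
  (1 / (S.N k : ℝ)) * ∑ i, S.Q k w (S.x k i) (S.y k i)

theorem Problem.Smooth.differentiable_nominalRisk (h : S.Smooth L) (k : Fin K) :
    Differentiable ℝ (S.nominalRisk k) := by
  unfold Problem.nominalRisk
  exact (Differentiable.fun_sum fun i _ => h.diff_w k (S.x k i) (S.y k i)).const_mul _

theorem Problem.Smooth.gradient_nominalRisk (h : S.Smooth L) (k : Fin K) (w : Vec M) :
    gradient (S.nominalRisk k) w = meanField S.nominalGrad k w := by
  have h1 : HasFDerivAt (S.nominalRisk k) ((1 / (S.N k : ℝ)) •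
      ∑ i, fderiv ℝ (fun v => S.Q k v (S.x k i) (S.y k i)) w) w := by
    unfold Problem.nominalRisk
    exact (HasFDerivAt.fun_sum fun i _ => (h.diff_w k (S.x k i) (S.y k i) w).hasFDerivAt).const_mul _
  refine ext_inner_right ℝ fun v => ?_
  rw [inner_gradient, h1.fderiv, meanField, real_inner_smul_left, sum_inner]
  simp only [_root_.smul_apply, _root_.sum_apply, smul_eq_mul]
  congr 1
  exact Finset.sum_congr rfl fun i _ => (inner_gradient _ _ _).symm

theorem norm_meanField_sub_le {N : Fin K → ℕ} [∀ k, NeZero (N k)]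
    {g g' : ∀ k, Vec M → Fin (N k) → Vec M} {k : Fin K} {w w' : Vec M} {b : ℝ}
    (h : ∀ i, ‖g k w i - g' k w' i‖ ≤ b) : ‖meanField g k w - meanField g' k w'‖ ≤ b := by
  have e : meanField g k w - meanField g' k w'
      = (1 / (Fintype.card (Fin (N k)) : ℝ)) • ∑ i, (g k w i - g' k w' i) := by
    simp [meanField, Finset.sum_sub_distrib, smul_sub]
  rw [e]
  refine (norm_average_le _).trans ((expect_mono h).trans (le_of_eq ?_))
  simp

section Perturbed

variable [Fact (1 ≤ p)]

theorem Problem.Smooth.norm_advGrad_sub_nominalGrad_le (h : S.Smooth L) (hL : 0 ≤ L)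
    (ha : S.IsAttack p ε att) (k : Fin K) (w : Vec M) (i : Fin (S.N k)) :
    ‖S.advGrad att k w i - S.nominalGrad k w i‖ ≤ L * (D * ε) := by
  refine (h.lip_wx k w (S.x k i) (S.x k i + att k w i) (S.y k i)).trans ?_
  rw [add_sub_cancel_left]
  gcongr
  exact norm_le_of_mem_pBall (ha.mem_ball k w i)

/-- A mixed difference in $w$ and $x$: the $w$-gradient moves by at most $L\|z\|$ under a shift of
the sample, and the mean value inequality integrates this. -/
theorem Problem.Smooth.sub_sub_sub_le (h : S.Smooth L) (hL : 0 ≤ L) {z : Vec D}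
    (hz : z ∈ pBall D p ε) (k : Fin K) (x : Vec D) (y : Y) (w w' : Vec M) :
    |(S.Q k w (x + z) y - S.Q k w x y) - (S.Q k w' (x + z) y - S.Q k w' x y)|
      ≤ L * (D * ε) * ‖w - w'‖ := by
  refine convex_univ.norm_image_sub_le_of_norm_hasFDerivWithin_le
    (f := fun v => S.Q k v (x + z) y - S.Q k v x y)
    (f' := fun v => fderiv ℝ (fun v => S.Q k v (x + z) y) v - fderiv ℝ (fun v => S.Q k v x y) v)
    (fun v _ => ((h.diff_w k (x + z) y v).hasFDerivAt.sub
      (h.diff_w k x y v).hasFDerivAt).hasFDerivWithinAt) (fun v _ => ?_)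
    (Set.mem_univ w') (Set.mem_univ w)
  rw [← norm_gradient_sub]
  refine (h.lip_wx k v x (x + z) y).trans ?_
  rw [add_sub_cancel_left]
  gcongr
  exact norm_le_of_mem_pBall hz

omit [Fact (1 ≤ p)] in
/-- The maximal loss is attained. -/
theorem Problem.UniquePerturbation.exists_iSup_eq (hu : S.UniquePerturbation p ε) (k : Fin K)
    (i : Fin (S.N k)) (w : Vec M) : ∃ z ∈ pBall D p ε,
      (⨆ z' : pBall D p ε, S.Q k w (S.x k i + z') (S.y k i)) = S.Q k w (S.x k i + z) (S.y k i) ∧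
      ∀ z' ∈ pBall D p ε, S.Q k w (S.x k i + z') (S.y k i)
        ≤ S.Q k w (S.x k i + z) (S.y k i) := by
  obtain ⟨z, ⟨hz, hmax⟩, -⟩ := hu k i w
  have hne : Nonempty (pBall D p ε) := ⟨⟨z, hz⟩⟩
  refine ⟨z, hz, le_antisymm (ciSup_le fun z' => hmax z' z'.2) ?_, hmax⟩
  exact le_ciSup (f := fun z' : pBall D p ε => S.Q k w (S.x k i + z') (S.y k i))
    ⟨_, Set.forall_mem_range.2 fun z' => hmax z' z'.2⟩ ⟨z, hz⟩

/-- A substitute for the envelope theorem. The maximizer at `v` is an admissible perturbation at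
`v'`, so the difference of the maxima is bounded by a difference at one common perturbation.
Exchanging the two models gives the other sign. -/
theorem Problem.Smooth.abs_localRisk_sub_nominalRisk_sub_le (h : S.Smooth L) (hL : 0 ≤ L)
    (hu : S.UniquePerturbation p ε) (k : Fin K) (w w' : Vec M) :
    |(S.localRisk p ε k w - S.nominalRisk k w) - (S.localRisk p ε k w' - S.nominalRisk k w')|
      ≤ L * (D * ε) * ‖w - w'‖ := by
  set q := L * (D * ε) with hq
  have h1 : ∀ (i : Fin (S.N k)) (v v' : Vec M),
      ((⨆ z : pBall D p ε, S.Q k v (S.x k i + z) (S.y k i)) - S.Q k v (S.x k i) (S.y k i))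
      - ((⨆ z : pBall D p ε, S.Q k v' (S.x k i + z) (S.y k i)) - S.Q k v' (S.x k i) (S.y k i))
      ≤ q * ‖v - v'‖ := by
    intro i v v'
    obtain ⟨z, hz, e, -⟩ := hu.exists_iSup_eq k i v
    obtain ⟨z', -, e', hmax⟩ := hu.exists_iSup_eq k i v'
    rw [e, e']
    have := (abs_le.1 (h.sub_sub_sub_le hL hz k (S.x k i) (S.y k i) v v')).2
    linarith [hmax z hz]
  have h2 : ∀ v v' : Vec M, (S.localRisk p ε k v - S.nominalRisk k v)
      - (S.localRisk p ε k v' - S.nominalRisk k v') ≤ q * ‖v - v'‖ := by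
    intro v v'
    have hN : (0 : ℝ) < S.N k := Nat.cast_pos.2 (S.N_pos k)
    have e : (S.localRisk p ε k v - S.nominalRisk k v)
        - (S.localRisk p ε k v' - S.nominalRisk k v') = (1 / (S.N k : ℝ)) * ∑ i,
        (((⨆ z : pBall D p ε, S.Q k v (S.x k i + z) (S.y k i)) - S.Q k v (S.x k i) (S.y k i))
        - ((⨆ z : pBall D p ε, S.Q k v' (S.x k i + z) (S.y k i))
          - S.Q k v' (S.x k i) (S.y k i))) := by
      simp only [Problem.localRisk, Problem.nominalRisk, Finset.sum_sub_distrib]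
      ring
    rw [e]
    calc _ ≤ (1 / (S.N k : ℝ)) * ∑ _i : Fin (S.N k), q * ‖v - v'‖ := by
          gcongr with i
          exact h1 i v v'
      _ = _ := by
        simp only [Finset.sum_const, Finset.card_univ, Fintype.card_fin, nsmul_eq_mul]
        field_simp
  rw [abs_le]
  have := h2 w' w
  rw [norm_sub_rev] at this
  exact ⟨by linarith, h2 w w'⟩

theorem Problem.Smooth.continuous_localRisk (h : S.Smooth L) (hu : S.UniquePerturbation p ε)
    (k : Fin K) : Continuous (S.localRisk p ε k) := by
  have hL := h.mono (le_abs_self L)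
  have h1 : Continuous fun w => S.localRisk p ε k w - S.nominalRisk k w := by
    refine continuous_iff_continuousAt.2 fun w => tendsto_iff_norm_sub_tendsto_zero.2 ?_
    refine squeeze_zero (fun _ => norm_nonneg _)
      (fun v => hL.abs_localRisk_sub_nominalRisk_sub_le (abs_nonneg L) hu k v w) ?_
    have : Continuous fun v : Vec M => |L| * (D * ε) * ‖v - w‖ := by fun_prop
    simpa using this.tendsto w
  exact (h1.add (h.differentiable_nominalRisk k).continuous).congr fun w => sub_add_cancel _ _

theorem Problem.Smooth.continuous_risk (h : S.Smooth L) (hu : S.UniquePerturbation p ε) :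
    Continuous (S.risk p ε) :=
  continuous_const.mul (continuous_finsetSum _ fun k _ => h.continuous_localRisk hu k)

end Perturbed

end Regularity


/-! ### Regularity of each agent at the minimizer -/

section AgentBounds

variable {K M D : ℕ} {Y : Type*} {S : Problem K M D Y} {p : ℝ≥0∞} {ε L a η₁ r₀ G μ : ℝ}
  {att : S.Attack} {w₀ : Vec M}

/-- The regularity of an agent's risk and gradients at `w₀`. -/
structure Problem.Regular (S : Problem K M D Y) (p : ℝ≥0∞) (ε : ℝ) (att : S.Attack) (w₀ : Vec M)
    (L a η₁ r₀ G μ : ℝ) : Prop where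
  smooth : S.Smooth L
  attack : S.IsAttack p ε att
  unique : S.UniquePerturbation p ε
  L_nonneg : 0 ≤ L
  a_nonneg : 0 ≤ a
  ε_nonneg : 0 ≤ ε
  r₀_pos : 0 < r₀
  contDiff : ∀ k, ContDiffOn ℝ 2 (S.localRisk p ε k) (Metric.ball w₀ r₀)
  hess_lip : ∀ k, ∀ w ∈ Metric.ball w₀ r₀,
    ‖hess (S.localRisk p ε k) w - hess (S.localRisk p ε k) w₀‖ ≤ a * ‖w - w₀‖
  pow_four : ∀ k, (1 / (S.N k : ℝ)) * ∑ i, ‖S.gradW k w₀ (S.x k i) (S.y k i)‖ ^ 4 ≤ G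
  le_sq : L * (D * ε) ≤ η₁ * μ ^ 2
  pos : 0 < μ
  le_one : μ ≤ 1

/-- A bound for the Hessians at `w₀`. -/
noncomputable def hessBound (L a η₁ r₀ : ℝ) : ℝ := a * r₀ + L + 4 * η₁ / r₀

/-- A bound for the second-order remainders. -/
noncomputable def remainderBound (L a η₁ r₀ : ℝ) : ℝ :=
  a + (L + hessBound L a η₁ r₀) / r₀ + 2 * η₁ / r₀ ^ 2

namespace Problem.Regular

variable (h : S.Regular p ε att w₀ L a η₁ r₀ G μ)
include h

theorem η_nonneg : 0 ≤ L * (D * ε) := by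
  have := h.L_nonneg
  have := h.ε_nonneg
  positivity

theorem η₁_nonneg : 0 ≤ η₁ :=
  nonneg_of_mul_nonneg_left (h.η_nonneg.trans h.le_sq) (pow_pos h.pos 2)

theorem η_le : L * (D * ε) ≤ η₁ :=
  h.le_sq.trans (mul_le_of_le_one_right h.η₁_nonneg (pow_le_one₀ h.pos.le h.le_one))

theorem hessBound_nonneg : 0 ≤ hessBound L a η₁ r₀ := by
  have := h.L_nonneg
  have := h.a_nonneg
  have := h.r₀_pos
  have := h.η₁_nonneg
  unfold hessBound
  positivity

theorem remainderBound_nonneg : 0 ≤ remainderBound L a η₁ r₀ := by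
  have := h.L_nonneg
  have := h.a_nonneg
  have := h.r₀_pos
  have := h.η₁_nonneg
  have := h.hessBound_nonneg
  unfold remainderBound
  positivity

theorem G_nonneg (k : Fin K) : 0 ≤ G := le_trans (by positivity) (h.pow_four k)

theorem norm_nominal_sub_le (k : Fin K) (w w' : Vec M) :
    ‖meanField S.nominalGrad k w - meanField S.nominalGrad k w'‖ ≤ L * ‖w - w'‖ :=
  norm_meanField_sub_le fun i => h.smooth.lip_ww k w' w (S.x k i) (S.y k i)

variable [Fact (1 ≤ p)]

theorem norm_adv_sub_nominal_le (k : Fin K) (w : Vec M) :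
    ‖meanField (S.advGrad att) k w - meanField S.nominalGrad k w‖ ≤ L * (D * ε) :=
  norm_meanField_sub_le fun i =>
    h.smooth.norm_advGrad_sub_nominalGrad_le h.L_nonneg h.attack k w i

/-- A differentiable function with a small Lipschitz constant has a small gradient; the maximum
itself never has to be differentiated. -/
theorem norm_gradient_sub_nominal_le (k : Fin K) {w : Vec M} (hw : w ∈ Metric.ball w₀ r₀) :
    ‖gradient (S.localRisk p ε k) w - meanField S.nominalGrad k w‖ ≤ L * (D * ε) := by
  rw [← h.smooth.gradient_nominalRisk]
  exact norm_gradient_sub_le_of_lip (differentiableAt_of_ball (h.contDiff k) hw)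
    (h.smooth.differentiable_nominalRisk k w) h.η_nonneg
    (h.smooth.abs_localRisk_sub_nominalRisk_sub_le h.L_nonneg h.unique k)

theorem norm_adv_sub_gradient_le (k : Fin K) {w : Vec M} (hw : w ∈ Metric.ball w₀ r₀) :
    ‖meanField (S.advGrad att) k w - gradient (S.localRisk p ε k) w‖ ≤ 2 * (L * (D * ε)) := by
  have h1 := h.norm_adv_sub_nominal_le k w
  have h2 := h.norm_gradient_sub_nominal_le k hw
  rw [norm_sub_rev] at h2
  have := norm_sub_le_norm_sub_add_norm_sub (meanField (S.advGrad att) k w)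
    (meanField S.nominalGrad k w) (gradient (S.localRisk p ε k) w)
  linarith

theorem norm_gradient_sub_gradient_le (k : Fin K) {w : Vec M} (hw : w ∈ Metric.ball w₀ r₀) :
    ‖gradient (S.localRisk p ε k) w - gradient (S.localRisk p ε k) w₀‖
      ≤ L * ‖w - w₀‖ + 2 * (L * (D * ε)) := by
  have h1 := h.norm_gradient_sub_nominal_le k hw
  have h2 := h.norm_gradient_sub_nominal_le k (Metric.mem_ball_self h.r₀_pos)
  have h3 := h.norm_nominal_sub_le k w w₀
  rw [norm_sub_rev] at h2
  have a1 := norm_sub_le_norm_sub_add_norm_sub (gradient (S.localRisk p ε k) w)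
    (meanField S.nominalGrad k w) (gradient (S.localRisk p ε k) w₀)
  have a2 := norm_sub_le_norm_sub_add_norm_sub (meanField S.nominalGrad k w)
    (meanField S.nominalGrad k w₀) (gradient (S.localRisk p ε k) w₀)
  linarith

theorem norm_hessMap_le (k : Fin K) : ‖hessMap (S.localRisk p ε k) w₀‖ ≤ hessBound L a η₁ r₀ := by
  have hη := h.η_nonneg
  have hr := h.r₀_pos
  refine (AdvNet.norm_hessMap_le (h.contDiff k) hr (h.hess_lip k) h.a_nonneg h.L_nonneg
    (by positivity) fun v hv => h.norm_gradient_sub_gradient_le k hv).trans ?_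
  unfold hessBound
  have : 2 * (2 * (L * (D * ε))) ≤ 4 * η₁ := by linarith [h.η_le]
  gcongr

theorem norm_adv_sub_le (k : Fin K) (w : Vec M) :
    ‖meanField (S.advGrad att) k w - gradient (S.localRisk p ε k) w₀‖
      ≤ L * ‖w - w₀‖ + 2 * (L * (D * ε)) := by
  have h1 := h.norm_adv_sub_nominal_le k w
  have h2 := h.norm_gradient_sub_nominal_le k (Metric.mem_ball_self h.r₀_pos)
  have h3 := h.norm_nominal_sub_le k w w₀
  rw [norm_sub_rev] at h2
  have a1 := norm_sub_le_norm_sub_add_norm_sub (meanField (S.advGrad att) k w)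
    (meanField S.nominalGrad k w) (gradient (S.localRisk p ε k) w₀)
  have a2 := norm_sub_le_norm_sub_add_norm_sub (meanField S.nominalGrad k w)
    (meanField S.nominalGrad k w₀) (gradient (S.localRisk p ε k) w₀)
  linarith

/-- Valid for all models, not only near `w₀`. Outside the ball both the gradient increment and the
linear term grow at most linearly, and $\|w-w_0\|\ge r_0$ turns linear growth into quadratic growth.
The global form spares any control of the event that an iterate leaves the ball. -/
theorem norm_adv_linearization_le (k : Fin K) (w : Vec M) :
    ‖meanField (S.advGrad att) k w - gradient (S.localRisk p ε k) w₀
        - hessMap (S.localRisk p ε k) w₀ (w - w₀)‖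
      ≤ remainderBound L a η₁ r₀ * ‖w - w₀‖ ^ 2 + 2 * (L * (D * ε)) := by
  have hr := h.r₀_pos
  have ha := h.a_nonneg
  have hL := h.L_nonneg
  have hη₁ := h.η₁_nonneg
  have hη := h.η_nonneg
  have hb := h.hessBound_nonneg
  by_cases hw : w ∈ Metric.ball w₀ r₀
  · have h1 := h.norm_adv_sub_gradient_le k hw
    have h2 := norm_gradient_sub_le (h.contDiff k) (h.hess_lip k) ha hw
    have h3 : a * ‖w - w₀‖ ^ 2 ≤ remainderBound L a η₁ r₀ * ‖w - w₀‖ ^ 2 := by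
      gcongr
      unfold remainderBound
      have : 0 ≤ (L + hessBound L a η₁ r₀) / r₀ + 2 * η₁ / r₀ ^ 2 := by positivity
      linarith
    have e : meanField (S.advGrad att) k w - gradient (S.localRisk p ε k) w₀
        - hessMap (S.localRisk p ε k) w₀ (w - w₀)
        = (meanField (S.advGrad att) k w - gradient (S.localRisk p ε k) w)
        + (gradient (S.localRisk p ε k) w - gradient (S.localRisk p ε k) w₀
        - hessMap (S.localRisk p ε k) w₀ (w - w₀)) := by abel
    rw [e]
    refine (norm_add_le _ _).trans ?_
    linarith
  · have hR : r₀ ≤ ‖w - w₀‖ := by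
      rw [← dist_eq_norm]; exact not_lt.1 fun h' => hw (Metric.mem_ball.2 h')
    have h1 := h.norm_adv_sub_le k w
    have h2 := ContinuousLinearMap.le_of_opNorm_le _ (h.norm_hessMap_le k) (w - w₀)
    set R := ‖w - w₀‖
    set b := hessBound L a η₁ r₀
    have h3 : (L + b) * R ≤ (L + b) / r₀ * R ^ 2 := by
      have : (L + b) * R = (L + b) / r₀ * (r₀ * R) := by field_simp
      rw [this, sq]
      gcongr
    have h4 : (L + b) / r₀ * R ^ 2 ≤ remainderBound L a η₁ r₀ * R ^ 2 := by
      gcongr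
      unfold remainderBound
      have : 0 ≤ 2 * η₁ / r₀ ^ 2 := by positivity
      linarith
    refine (norm_sub_le _ _).trans ?_
    linarith

/-- The cubic remainder is global as well. Far from `w₀` the risk is compared with the unperturbed
one, whose growth is quadratic, and powers of $\|w-w_0\|/r_0\ge1$ raise every term to cubic order.
-/
theorem abs_taylor_le (k : Fin K) (w : Vec M) :
    |S.localRisk p ε k w - S.localRisk p ε k w₀ - ⟪gradient (S.localRisk p ε k) w₀, w - w₀⟫
        - 1 / 2 * ⟪hessMap (S.localRisk p ε k) w₀ (w - w₀), w - w₀⟫|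
      ≤ remainderBound L a η₁ r₀ * ‖w - w₀‖ ^ 3 := by
  have hr := h.r₀_pos
  have ha := h.a_nonneg
  have hL := h.L_nonneg
  have hη₁ := h.η₁_nonneg
  have hη := h.η_nonneg
  have hb := h.hessBound_nonneg
  by_cases hw : w ∈ Metric.ball w₀ r₀
  · refine (AdvNet.abs_taylor_le (h.contDiff k) (h.hess_lip k) ha hw).trans ?_
    gcongr
    unfold remainderBound
    have : 0 ≤ (L + hessBound L a η₁ r₀) / r₀ + 2 * η₁ / r₀ ^ 2 := by positivity
    linarith
  · have hR : r₀ ≤ ‖w - w₀‖ := by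
      rw [← dist_eq_norm]; exact not_lt.1 fun h' => hw (Metric.mem_ball.2 h')
    have h1 := h.smooth.abs_localRisk_sub_nominalRisk_sub_le h.L_nonneg h.unique k w w₀
    have h2 := abs_sub_inner_gradient_le (f := S.nominalRisk k) (w₀ := w₀)
      (h.smooth.differentiable_nominalRisk k) hL (fun v => by
        rw [h.smooth.gradient_nominalRisk, h.smooth.gradient_nominalRisk]
        exact h.norm_nominal_sub_le k v w₀) w
    rw [h.smooth.gradient_nominalRisk] at h2
    have h3 : |⟪gradient (S.localRisk p ε k) w₀, w - w₀⟫
        - ⟪meanField S.nominalGrad k w₀, w - w₀⟫| ≤ L * (D * ε) * ‖w - w₀‖ := by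
      rw [← inner_sub_left]
      refine (abs_real_inner_le_norm _ _).trans ?_
      gcongr
      exact h.norm_gradient_sub_nominal_le k (Metric.mem_ball_self hr)
    have h4 : |⟪hessMap (S.localRisk p ε k) w₀ (w - w₀), w - w₀⟫|
        ≤ hessBound L a η₁ r₀ * ‖w - w₀‖ ^ 2 := by
      refine (abs_real_inner_le_norm _ _).trans ?_
      rw [sq, ← mul_assoc]
      gcongr
      exact ContinuousLinearMap.le_of_opNorm_le _ (h.norm_hessMap_le k) _
    set R := ‖w - w₀‖
    have hR0 : 0 ≤ R := hr.le.trans hR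
    set b := hessBound L a η₁ r₀
    have h5 : (L + b) * R ^ 2 ≤ (L + b) / r₀ * R ^ 3 := by
      have : (L + b) * R ^ 2 = (L + b) / r₀ * (r₀ * R ^ 2) := by field_simp
      rw [this, pow_succ' R 2]
      gcongr
    have h6 : 2 * η₁ * R ≤ 2 * η₁ / r₀ ^ 2 * R ^ 3 := by
      have : 2 * η₁ * R = 2 * η₁ / r₀ ^ 2 * (r₀ ^ 2 * R) := by field_simp
      rw [this, pow_succ R 2]
      gcongr
    have h7 : L * (D * ε) * R ≤ η₁ * R := by gcongr; exact h.η_le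
    have h8 : 0 ≤ a * R ^ 3 := by positivity
    have h9 : 0 ≤ b * R ^ 2 := by positivity
    have e : remainderBound L a η₁ r₀ * R ^ 3
        = a * R ^ 3 + (L + b) / r₀ * R ^ 3 + 2 * η₁ / r₀ ^ 2 * R ^ 3 := by
      unfold remainderBound
      ring
    rw [e]
    rw [abs_le] at h1 h2 h3 h4 ⊢
    constructor <;> linarith [h1.1, h1.2, h2.1, h2.2, h3.1, h3.2, h4.1, h4.2]

theorem norm_advGrad_sub_le (k : Fin K) (w : Vec M) (i : Fin (S.N k)) :
    ‖S.advGrad att k w i - S.advGrad att k w₀ i‖ ≤ L * ‖w - w₀‖ + 2 * (L * (D * ε)) := by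
  have h1 := h.smooth.norm_advGrad_sub_nominalGrad_le h.L_nonneg h.attack k w i
  have h2 := h.smooth.norm_advGrad_sub_nominalGrad_le h.L_nonneg h.attack k w₀ i
  have h3 := h.smooth.lip_ww k w₀ w (S.x k i) (S.y k i)
  have e : S.advGrad att k w i - S.advGrad att k w₀ i
      = (S.advGrad att k w i - S.nominalGrad k w i)
      + (S.nominalGrad k w i - S.nominalGrad k w₀ i)
      - (S.advGrad att k w₀ i - S.nominalGrad k w₀ i) := by abel
  rw [e]
  refine (norm_sub_le _ _).trans ?_
  have := norm_add_le (S.advGrad att k w i - S.nominalGrad k w i)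
    (S.nominalGrad k w i - S.nominalGrad k w₀ i)
  have h4 : ‖S.nominalGrad k w i - S.nominalGrad k w₀ i‖ ≤ L * ‖w - w₀‖ := h3
  linarith

theorem expect_norm_advGrad_pow_four_le (k : Fin K) (w : Vec M) :
    𝔼 i, ‖S.advGrad att k w i‖ ^ 4
      ≤ 27 * (G + η₁ ^ 4 + L ^ 4) * (1 + ‖w - w₀‖ ^ 4) := by
  have hL := h.L_nonneg
  have hη₁ := h.η₁_nonneg
  have hG := h.G_nonneg k
  have h1 : ∀ i, ‖S.advGrad att k w i‖ ^ 4 ≤ 27 * (‖S.nominalGrad k w₀ i‖ ^ 4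
      + (η₁ ^ 4 + L ^ 4 * ‖w - w₀‖ ^ 4)) := by
    intro i
    have b1 := (h.smooth.norm_advGrad_sub_nominalGrad_le h.L_nonneg h.attack k w i).trans h.η_le
    have b2 : ‖S.nominalGrad k w i - S.nominalGrad k w₀ i‖ ≤ L * ‖w - w₀‖ :=
      h.smooth.lip_ww k w₀ w (S.x k i) (S.y k i)
    have e : S.advGrad att k w i = S.nominalGrad k w₀ i
      + (S.advGrad att k w i - S.nominalGrad k w i)
      + (S.nominalGrad k w i - S.nominalGrad k w₀ i) := by abel
    have : ‖S.advGrad att k w i‖ ≤ ‖S.nominalGrad k w₀ i‖ + η₁ + L * ‖w - w₀‖ := by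
      rw [e]
      exact (norm_add₃_le).trans (by gcongr)
    calc _ ≤ (‖S.nominalGrad k w₀ i‖ + η₁ + L * ‖w - w₀‖) ^ 4 := by gcongr
      _ ≤ 27 * (‖S.nominalGrad k w₀ i‖ ^ 4 + η₁ ^ 4 + (L * ‖w - w₀‖) ^ 4) :=
        add_add_pow_four_le _ _ _
      _ = _ := by ring
  refine (expect_mono h1).trans ?_
  rw [← Finset.mul_expect, Finset.expect_add_distrib, Fintype.expect_const, mul_assoc]
  have h2 : 𝔼 i, ‖S.nominalGrad k w₀ i‖ ^ 4 ≤ G := by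
    rw [Fintype.expect_eq_sum_div_card, Fintype.card_fin, div_eq_inv_mul, ← one_div]
    exact h.pow_four k
  gcongr 27 * ?_
  have : 0 ≤ (G + η₁ ^ 4) * ‖w - w₀‖ ^ 4 := by positivity
  have : 0 ≤ L ^ 4 := by positivity
  linarith

theorem norm_gradient_le (k : Fin K) : ‖gradient (S.localRisk p ε k) w₀‖ ≤ 1 + G + η₁ := by
  have h1 := h.norm_gradient_sub_nominal_le k (Metric.mem_ball_self h.r₀_pos)
  have h2 : ‖meanField S.nominalGrad k w₀‖ ≤ 1 + G := by
    have e : meanField S.nominalGrad k w₀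
        = (1 / (Fintype.card (Fin (S.N k)) : ℝ)) • ∑ i, S.nominalGrad k w₀ i := by
      simp [meanField]
    rw [e]
    have h3 : 𝔼 i, ‖S.nominalGrad k w₀ i‖ ^ 4 ≤ G := by
      rw [Fintype.expect_eq_sum_div_card, Fintype.card_fin, div_eq_inv_mul, ← one_div]
      exact h.pow_four k
    refine (norm_average_le _).trans ((expect_mono (g := fun i =>
      1 + ‖S.nominalGrad k w₀ i‖ ^ 4) fun i => ?_).trans ?_)
    · nlinarith [sq_nonneg (‖S.nominalGrad k w₀ i‖ ^ 2 - 1 / 2),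
        sq_nonneg (‖S.nominalGrad k w₀ i‖ - 1 / 2)]
    · rw [Finset.expect_add_distrib, Fintype.expect_const]
      linarith
  have := norm_le_norm_add_norm_sub (meanField S.nominalGrad k w₀)
    (gradient (S.localRisk p ε k) w₀)
  rw [norm_sub_rev] at this
  linarith [h.η_le]

end Problem.Regular

end AgentBounds


/-! ### From the agents to the global risk -/

section GlobalBounds

variable {K M D : ℕ} {Y : Type*} {S : Problem K M D Y} {p : ℝ≥0∞} {ε L a η₁ r₀ G μ δ : ℝ}
  {att : S.Attack} {w₀ : Vec M}

/-- The gradients of the local risks at `w₀`, as a network vector. -/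
noncomputable def Problem.netGradient (S : Problem K M D Y) (p : ℝ≥0∞) (ε : ℝ) (w₀ : Vec M) :
    Net K (Vec M) :=
  WithLp.toLp 2 fun k => gradient (S.localRisk p ε k) w₀

/-- A bound for all the constants that describe the regularity of the problem at `w₀`. -/
noncomputable def gradConst (L a η₁ r₀ G : ℝ) : ℝ :=
  (1 + G + η₁) + hessBound L a η₁ r₀ + (L + 2 * η₁) + remainderBound L a η₁ r₀
    + 27 * (G + η₁ ^ 4 + L ^ 4)

namespace Problem.Regular

variable (h : S.Regular p ε att w₀ L a η₁ r₀ G μ)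
include h

theorem hasFDerivAt_risk {w : Vec M} (hw : w ∈ Metric.ball w₀ r₀) :
    HasFDerivAt (S.risk p ε) ((1 / (K : ℝ)) • ∑ k, fderiv ℝ (S.localRisk p ε k) w) w := by
  unfold Problem.risk
  exact (HasFDerivAt.fun_sum fun k _ =>
    (differentiableAt_of_ball (h.contDiff k) hw).hasFDerivAt).const_mul _

theorem contDiffOn_risk : ContDiffOn ℝ 2 (S.risk p ε) (Metric.ball w₀ r₀) := by
  unfold Problem.risk
  exact contDiffOn_const.mul (ContDiffOn.sum fun k _ => h.contDiff k)

theorem hess_risk : hess (S.risk p ε) w₀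
    = (1 / (K : ℝ)) • ∑ k, hess (S.localRisk p ε k) w₀ := by
  have h1 : (fun v => fderiv ℝ (S.risk p ε) v)
      =ᶠ[𝓝 w₀] fun v => (1 / (K : ℝ)) • ∑ k, fderiv ℝ (S.localRisk p ε k) v := by
    filter_upwards [Metric.ball_mem_nhds w₀ h.r₀_pos] with v hv
    exact (h.hasFDerivAt_risk hv).fderiv
  rw [hess, h1.fderiv_eq]
  exact ((HasFDerivAt.fun_sum fun k _ => hasFDerivAt_fderiv (h.contDiff k)
    (Metric.mem_ball_self h.r₀_pos)).const_smul (1 / (K : ℝ))).fderiv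

variable [NeZero K]

theorem sum_hessMap : ∑ k, hessMap (S.localRisk p ε k) w₀
    = (K : ℝ) • hessMap (S.risk p ε) w₀ := by
  ext1 u
  refine ext_inner_right ℝ fun v => ?_
  rw [_root_.smul_apply, real_inner_smul_left, inner_hessMap, h.hess_risk, _root_.sum_apply,
    sum_inner]
  simp only [inner_hessMap, _root_.smul_apply, _root_.sum_apply, smul_eq_mul]
  rw [← mul_assoc, mul_one_div_cancel (NeZero.ne _), one_mul]

/-- The first-order condition for the global risk: local gradients balance without vanishing
individually. -/
theorem sum_gradient (hmin : IsLocalMin (S.risk p ε) w₀) :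
    ∑ k, S.netGradient p ε w₀ k = 0 := by
  have h1 := hmin.fderiv_eq_zero
  rw [(h.hasFDerivAt_risk (Metric.mem_ball_self h.r₀_pos)).fderiv] at h1
  refine ext_inner_right ℝ fun v => ?_
  have h2 := congrArg (fun T : Vec M →L[ℝ] ℝ => T v) h1
  simp only [_root_.smul_apply, _root_.sum_apply, smul_eq_mul, _root_.zero_apply] at h2
  have hK : (1 / (K : ℝ)) ≠ 0 := one_div_ne_zero (NeZero.ne _)
  rw [sum_inner, inner_zero_left]
  simp only [Problem.netGradient, inner_gradient]
  exact (mul_eq_zero.1 h2).resolve_left hK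

theorem hessMap_risk : hessMap (S.risk p ε) w₀
    = (1 / (K : ℝ)) • ∑ k, hessMap (S.localRisk p ε k) w₀ := by
  rw [h.sum_hessMap, smul_smul, one_div_mul_cancel (NeZero.ne _), one_smul]

theorem remainderBound_le : remainderBound L a η₁ r₀ ≤ gradConst L a η₁ r₀ G := by
  have := h.G_nonneg 0
  have := h.L_nonneg
  have := h.η₁_nonneg
  have := h.hessBound_nonneg
  have : 0 ≤ (1 + G + η₁) + hessBound L a η₁ r₀ + (L + 2 * η₁)
    + 27 * (G + η₁ ^ 4 + L ^ 4) := by positivity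
  unfold gradConst
  linarith

variable [Fact (1 ≤ p)]

theorem norm_hessMap_risk_le : ‖hessMap (S.risk p ε) w₀‖ ≤ hessBound L a η₁ r₀ := by
  rw [h.hessMap_risk, norm_smul, Real.norm_of_nonneg (by positivity)]
  have : ‖∑ k, hessMap (S.localRisk p ε k) w₀‖ ≤ K * hessBound L a η₁ r₀ :=
    (norm_sum_le _ _).trans ((Finset.sum_le_sum fun k _ => h.norm_hessMap_le k).trans
      (le_of_eq (by simp)))
  calc _ ≤ 1 / (K : ℝ) * (K * hessBound L a η₁ r₀) := by gcongr
    _ = _ := by rw [← mul_assoc, one_div_mul_cancel (NeZero.ne _), one_mul]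

/-- In the average of the local Taylor expansions the linear terms cancel. -/
theorem abs_risk_sub_le (hmin : IsLocalMin (S.risk p ε) w₀) (w : Vec M) :
    |S.risk p ε w - S.risk p ε w₀ - 1 / 2 * ⟪hessMap (S.risk p ε) w₀ (w - w₀), w - w₀⟫|
      ≤ remainderBound L a η₁ r₀ * ‖w - w₀‖ ^ 3 := by
  have hd := h.sum_gradient hmin
  have hd' : ∑ k, ⟪gradient (S.localRisk p ε k) w₀, w - w₀⟫ = 0 := by
    rw [← sum_inner]
    simp only [Problem.netGradient] at hd
    rw [hd, inner_zero_left]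
  have hK : (0 : ℝ) < K := Nat.cast_pos.2 (NeZero.pos K)
  have e : S.risk p ε w - S.risk p ε w₀
      - 1 / 2 * ⟪hessMap (S.risk p ε) w₀ (w - w₀), w - w₀⟫
      = (1 / (K : ℝ)) * ∑ k, (S.localRisk p ε k w - S.localRisk p ε k w₀
        - ⟪gradient (S.localRisk p ε k) w₀, w - w₀⟫
        - 1 / 2 * ⟪hessMap (S.localRisk p ε k) w₀ (w - w₀), w - w₀⟫) := by
    rw [h.hessMap_risk, _root_.smul_apply, real_inner_smul_left, _root_.sum_apply, sum_inner]
    simp only [Finset.sum_sub_distrib, hd', Problem.risk, ← Finset.mul_sum]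
    ring
  rw [e, abs_mul, abs_of_pos (by positivity)]
  calc _ ≤ 1 / (K : ℝ) * ∑ _k : Fin K, remainderBound L a η₁ r₀ * ‖w - w₀‖ ^ 3 := by
        gcongr
        exact (Finset.abs_sum_le_sum_abs _ _).trans
          (Finset.sum_le_sum fun k _ => h.abs_taylor_le k w)
    _ = _ := by
      simp only [Finset.sum_const, Finset.card_univ, Fintype.card_fin, nsmul_eq_mul]
      rw [← mul_assoc, one_div_mul_cancel hK.ne', one_mul]

theorem gradBounds (hmin : IsLocalMin (S.risk p ε) w₀)
    (hdis : ∀ k, ‖hess (S.localRisk p ε k) w₀ - hess (S.risk p ε) w₀‖ ≤ δ) :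
    GradBounds (S.advGrad att) w₀ (S.netGradient p ε w₀) (hessMap (S.risk p ε) w₀)
      (fun k => hessMap (S.localRisk p ε k) w₀) (gradConst L a η₁ r₀ G) δ μ := by
  have hG := h.G_nonneg 0
  have hL := h.L_nonneg
  have hη₁ := h.η₁_nonneg
  have hη := h.le_sq
  have hb := h.hessBound_nonneg
  have hr := h.remainderBound_nonneg
  have hμ := h.pos
  have h4 : 0 ≤ 27 * (G + η₁ ^ 4 + L ^ 4) := by positivity
  have hC : gradConst L a η₁ r₀ G = (1 + G + η₁) + hessBound L a η₁ r₀ + (L + 2 * η₁)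
    + remainderBound L a η₁ r₀ + 27 * (G + η₁ ^ 4 + L ^ 4) := rfl
  set C := gradConst L a η₁ r₀ G
  have hlip : ∀ x : ℝ, 0 ≤ x → L * x + 2 * (L * (D * ε)) ≤ C * (x + μ ^ 2) := by
    intro x hx
    have h1 : (L + 2 * η₁) * (x + μ ^ 2) ≤ C * (x + μ ^ 2) := by gcongr; linarith
    have h2 : 0 ≤ L * μ ^ 2 + 2 * η₁ * x := by positivity
    linarith
  refine ⟨by linarith, h.sum_gradient hmin, fun k => (h.norm_gradient_le k).trans (by linarith),
    h.norm_hessMap_risk_le.trans (by linarith), h.sum_hessMap,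
    fun k => (norm_hessMap_sub_le _ _ _ _).trans (hdis k),
    fun k w => (h.norm_adv_sub_le k w).trans (hlip _ (norm_nonneg _)),
    fun k w => (h.norm_adv_linearization_le k w).trans ?_,
    fun k w => (h.expect_norm_advGrad_pow_four_le k w).trans ?_,
    fun k w i => (h.norm_advGrad_sub_le k w i).trans (hlip _ (norm_nonneg _))⟩
  · have h1 : (remainderBound L a η₁ r₀ + 2 * η₁) * (‖w - w₀‖ ^ 2 + μ ^ 2)
        ≤ C * (‖w - w₀‖ ^ 2 + μ ^ 2) := by gcongr; linarith
    have h2 : 0 ≤ remainderBound L a η₁ r₀ * μ ^ 2 + 2 * η₁ * ‖w - w₀‖ ^ 2 := by positivity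
    linarith
  · gcongr
    linarith

end Problem.Regular

end GlobalBounds


/-! ### Closed forms of noise and heterogeneity -/

section ClosedForms

variable {K M D : ℕ} {Y : Type*} {S : Problem K M D Y} {p : ℝ≥0∞} {ε : ℝ} {att : S.Attack}
  {w₀ : Vec M} {A : Matrix (Fin K) (Fin K) ℝ} {V : Matrix (Fin K) (Fin (K - 1)) ℝ}
  {lam : Fin (K - 1) → ℝ}

theorem hess_eq_sum (f : Vec M → ℝ) (w u v : Vec M) :
    hess f w u v = ∑ i, ∑ j, u i * (hessMatrix f w i j * v j) := by
  have hu : ∀ x : Vec M, x = ∑ i, x i • EuclideanSpace.single i (1 : ℝ) := fun x => by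
    simpa using ((EuclideanSpace.basisFun (Fin M) ℝ).sum_repr x).symm
  conv_lhs => rw [hu u, hu v]
  simp only [map_sum, map_smul, _root_.sum_apply, _root_.smul_apply, smul_eq_mul, hessMatrix,
    Matrix.of_apply, Finset.mul_sum]
  rw [Finset.sum_comm]
  refine Finset.sum_congr rfl fun i _ => Finset.sum_congr rfl fun j _ => ?_
  ring

theorem inner_hessMap_eq (f : Vec M → ℝ) (w u v : Vec M) :
    ⟪hessMap f w u, v⟫ = u.ofLp ⬝ᵥ (hessMatrix f w *ᵥ v.ofLp) := by
  rw [inner_hessMap, hess_eq_sum]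
  simp only [dotProduct, Matrix.mulVec, Finset.mul_sum]

/-- Symmetry is required because the matrix acts on the second argument of the bilinear form,
whereas `hessMap` is defined through the first. -/
theorem toEuclideanCLM_hessMatrix {f : Vec M → ℝ} {w : Vec M}
    (hs : ∀ u v, ⟪hessMap f w u, v⟫ = ⟪u, hessMap f w v⟫) :
    Matrix.toEuclideanCLM (𝕜 := ℝ) (hessMatrix f w) = hessMap f w := by
  ext1 v
  refine ext_inner_left ℝ fun u => ?_
  rw [← hs, inner_hessMap_eq, real_inner_comm]
  rw [EuclideanSpace.inner_eq_star_dotProduct, Matrix.ofLp_toEuclideanCLM]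
  simp

theorem inner_toEuclideanCLM (T : Matrix (Fin M) (Fin M) ℝ) (s : Vec M) :
    ⟪Matrix.toEuclideanCLM (𝕜 := ℝ) T s, s⟫ = s.ofLp ⬝ᵥ (T *ᵥ s.ofLp) := by
  rw [EuclideanSpace.inner_eq_star_dotProduct, Matrix.ofLp_toEuclideanCLM]
  simp

/-- The trace against a rank-one matrix is a quadratic form, and independence across agents reduces
it to a sum of one-agent averages. -/
theorem trace_mul_noiseCov (T : Matrix (Fin M) (Fin M) ℝ) :
    (T * S.noiseCov att w₀).trace = noisePower (S.advGrad att) (fun _ => w₀)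
      (Matrix.toEuclideanCLM (𝕜 := ℝ) T) := by
  have h1 := expect_quadratic_sum (Ω := fun k => Fin (S.N k)) (Matrix.toEuclideanCLM (𝕜 := ℝ) T)
    (fun k i => sampleNoise (S.advGrad att) k w₀ i)
    fun k => sum_sampleNoise (S.advGrad att) k w₀
  rw [noisePower, ← h1, Problem.noiseCov, Matrix.mul_smul, Matrix.trace_smul, Matrix.mul_sum,
    Matrix.trace_sum, smul_eq_mul, Fintype.expect_eq_sum_div_card, Finset.sum_div,
    Finset.mul_sum, Finset.mul_sum]
  refine Finset.sum_congr rfl fun i _ => ?_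
  rw [Matrix.mul_vecMulVec, Matrix.trace_vecMulVec, dotProduct_comm]
  have h2 : (fun a => ((1 / (K : ℝ)) • ∑ k, S.noise att k w₀ (i k)) a)
      = ((1 / (K : ℝ)) • ∑ k, sampleNoise (S.advGrad att) k w₀ (i k)).ofLp := rfl
  rw [h2, ← inner_toEuclideanCLM, map_smul, real_inner_smul_left, real_inner_smul_right]
  ring

theorem Problem.eFun_eq {μ : ℝ} (n : ℕ)
    (hs : ∀ u v, ⟪hessMap (S.risk p ε) w₀ u, v⟫ = ⟪u, hessMap (S.risk p ε) w₀ v⟫) :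
    S.eFun p ε att μ w₀ n = 1 / 4 * noisePower (S.advGrad att) (fun _ => w₀)
      (1 - (1 - μ • hessMap (S.risk p ε) w₀) ^ (2 * (n + 1))) := by
  rw [Problem.eFun, trace_mul_noiseCov, Problem.Hbar, map_sub, map_pow, map_sub, map_smul,
    map_one, toEuclideanCLM_hessMatrix hs]

/-- The row `j` of a stacked vector. -/
noncomputable def stackRow {ι : Type*} (u : ι × Fin M → ℝ) (j : ι) : Vec M :=
  WithLp.toLp 2 fun m => u (j, m)

theorem wSq_kronecker {ι : Type*} [Fintype ι] [DecidableEq ι] (f : Vec M → ℝ) (w : Vec M)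
    (u : ι × Fin M → ℝ) : wSq ((1 : Matrix ι ι ℝ) ⊗ₖ hessMatrix f w) u
      = ∑ j, ⟪hessMap f w (stackRow u j), stackRow u j⟫ := by
  simp only [inner_hessMap_eq, wSq, dotProduct, Matrix.mulVec, Fintype.sum_prod_type, stackRow,
    Matrix.kroneckerMap_apply, Matrix.one_apply]
  refine Finset.sum_congr rfl fun j _ => Finset.sum_congr rfl fun m _ => ?_
  congr 1
  rw [Finset.sum_eq_single j]
  · simp
  · intro i _ hi
    simp [hi.symm]
  · simp

/-- The geometric sums of the eigenvalues. -/
noncomputable def geomSum (lam : Fin (K - 1) → ℝ) (n : ℕ) (j : Fin (K - 1)) : ℝ :=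
  (1 - lam j)⁻¹ * (1 - lam j ^ n)

theorem bigP_eq_diagonal : Problem.bigP M lam = Matrix.diagonal fun q => lam q.1 := by
  rw [Problem.bigP, ← Matrix.diagonal_one, Matrix.diagonal_kronecker_diagonal]
  simp

theorem inv_one_sub_bigP (hlam : ∀ j, |lam j| < 1) :
    (1 - Problem.bigP M lam)⁻¹ = Matrix.diagonal fun q => (1 - lam q.1)⁻¹ := by
  refine Matrix.inv_eq_right_inv ?_
  rw [bigP_eq_diagonal, ← Matrix.diagonal_one, Matrix.diagonal_sub, Matrix.diagonal_mul_diagonal]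
  congr 1
  ext q
  have : 1 - lam q.1 ≠ 0 := (sub_pos.2 (lt_of_abs_lt (hlam q.1))).ne'
  exact mul_inv_cancel₀ this

theorem one_sub_bigP_pow (n : ℕ) :
    1 - Problem.bigP M lam ^ n = Matrix.diagonal fun q => 1 - lam q.1 ^ n := by
  rw [bigP_eq_diagonal, ← Matrix.diagonal_one, Matrix.diagonal_pow, Matrix.diagonal_sub]
  rfl

/-- Translates the Kronecker notation of the closed forms into eigencoefficients multiplied by
scalars. -/
theorem stackRow_vecMul_diagonal (u : Fin K × Fin M → ℝ) (γ : Fin (K - 1) → ℝ)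
    (j : Fin (K - 1)) : stackRow (u ᵥ* (Problem.bigV M V *
      (Matrix.diagonal fun q => γ q.1 :
        Matrix (Fin (K - 1) × Fin M) (Fin (K - 1) × Fin M) ℝ))) j
      = γ j • coeffs V (WithLp.toLp 2 (stackRow u)) j := by
  ext m
  rw [← Matrix.vecMul_vecMul, stackRow, PiLp.toLp_apply, Matrix.vecMul_diagonal]
  simp only [Problem.bigV, Matrix.vecMul, dotProduct, Fintype.sum_prod_type,
    Matrix.kroneckerMap_apply, Matrix.one_apply, coeffs, PiLp.smul_apply, smul_eq_mul,
    WithLp.ofLp_sum, Finset.sum_apply]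
  rw [mul_comm]
  congr 1
  refine Finset.sum_congr rfl fun k _ => ?_
  rw [Finset.sum_eq_single m]
  · simp [stackRow, mul_comm]
  · intro i _ hi
    simp [hi]
  · simp

theorem stackRow_dVec : WithLp.toLp 2 (stackRow (S.dVec p ε w₀)) = S.netGradient p ε w₀ := rfl

/-- The weighted energy of the eigencomponent `j` of the local gradients. -/
noncomputable def Problem.energy (S : Problem K M D Y) (p : ℝ≥0∞) (ε : ℝ) (w₀ : Vec M)
    (V : Matrix (Fin K) (Fin (K - 1)) ℝ) (j : Fin (K - 1)) : ℝ :=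
  ⟪hessMap (S.risk p ε) w₀ (coeffs V (S.netGradient p ε w₀) j),
    coeffs V (S.netGradient p ε w₀) j⟫

theorem Problem.fCon_eq (hlam : ∀ j, |lam j| < 1) (n : ℕ) : S.fCon p ε V lam w₀ n
    = 1 / (2 * (K : ℝ)) * ∑ j, geomSum lam (n + 1) j ^ 2 * S.energy p ε w₀ V j := by
  rw [Problem.fCon, Problem.Hbar, wSq_kronecker, inv_one_sub_bigP hlam, one_sub_bigP_pow,
    Matrix.mul_assoc, Matrix.diagonal_mul_diagonal]
  congr 1
  refine Finset.sum_congr rfl fun j _ => ?_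
  have := stackRow_vecMul_diagonal (V := V) (S.dVec p ε w₀) (geomSum lam (n + 1)) j
  unfold geomSum at this
  rw [this, stackRow_dVec, map_smul, real_inner_smul_left, real_inner_smul_right,
    Problem.energy, geomSum]
  ring

theorem Problem.fDif_eq (hlam : ∀ j, |lam j| < 1) (n : ℕ) : S.fDif p ε V lam w₀ n
    = 1 / (2 * (K : ℝ)) * ∑ j, (lam j * geomSum lam (n + 1) j) ^ 2 * S.energy p ε w₀ V j := by
  rw [Problem.fDif, Problem.Hbar, wSq_kronecker, inv_one_sub_bigP hlam, one_sub_bigP_pow,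
    bigP_eq_diagonal, Matrix.mul_assoc, Matrix.mul_assoc, Matrix.diagonal_mul_diagonal,
    Matrix.diagonal_mul_diagonal]
  congr 1
  refine Finset.sum_congr rfl fun j _ => ?_
  have := stackRow_vecMul_diagonal (V := V) (S.dVec p ε w₀)
    (fun j => lam j * geomSum lam (n + 1) j) j
  unfold geomSum at this
  rw [this, stackRow_dVec, map_smul, real_inner_smul_left, real_inner_smul_right,
    Problem.energy, geomSum]
  ring

theorem synth_add_smul {F : Type*} [NormedAddCommGroup F] [InnerProductSpace ℝ F]
    (c : Fin (K - 1) → F) (a b : Fin (K - 1) → ℝ) :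
    synth V (fun j => a j • c j) + synth V (fun j => b j • c j)
      = synth V fun j => (a j + b j) • c j := by
  ext k
  simp [synth, add_smul, Finset.sum_add_distrib]

theorem geomSum_succ (hlam : ∀ j, |lam j| < 1) (n : ℕ) (j : Fin (K - 1)) :
    geomSum lam (n + 1) j = lam j * geomSum lam n j + 1 := by
  have : 1 - lam j ≠ 0 := (sub_pos.2 (lt_of_abs_lt (hlam j))).ne'
  unfold geomSum
  field_simp
  ring

section Drift

variable [NeZero K] (hA : IsCombination A) (hV : IsSpectral A V lam) {d : Net K (Vec M)}
  (hd : mean d = 0)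
include hA hV hd

/-- The recursion $D_{n+1}=AD_n+d$ decouples in the eigenbasis into scalar geometric sums. -/
theorem drift_consensus (n : ℕ) :
    drift A 1 d n = synth V fun j => geomSum lam n j • coeffs V d j := by
  have hlam := hV.abs_lt_one hA
  have hc := hV.synth_coeffs hd
  induction n with
  | zero => ext k; simp [drift, synth, geomSum]
  | succ n ih =>
    rw [drift, mix_one, mix_one, ih, hV.mix_synth hA]
    nth_rewrite 2 [← hc]
    have := synth_add_smul (V := V) (coeffs V d) (fun j => lam j * geomSum lam n j) fun _ => 1
    simp only [one_smul] at this
    simp only [smul_smul, this, geomSum_succ hlam]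

/-- Here the gradients are mixed as well, $D_{n+1}=AD_n+Ad$. The resulting extra eigenvalue is the
entire difference from consensus, and the source of the ordering. -/
theorem drift_diffusion (n : ℕ) :
    drift 1 A d n = synth V fun j => (lam j * geomSum lam n j) • coeffs V d j := by
  have hlam := hV.abs_lt_one hA
  have hc := hV.synth_coeffs hd
  induction n with
  | zero => ext k; simp [drift, synth, geomSum]
  | succ n ih =>
    rw [drift, mix_one, ih, hV.mix_synth hA]
    nth_rewrite 2 [← hc]
    rw [hV.mix_synth hA]
    simp only [smul_smul]
    rw [synth_add_smul]
    congr 1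
    ext1 j
    rw [geomSum_succ hlam]
    congr 1
    ring

omit [NeZero K] hA hV in
theorem drift_centralized (n : ℕ) :
    drift 1 (Matrix.of fun _ _ => (1 : ℝ) / K) d n = 0 := by
  induction n with
  | zero => rfl
  | succ n ih =>
    rw [drift, ih, mix_one, mix_uniform d hd, map_zero, add_zero]

end Drift

theorem mixing_centralized [NeZero K] {F : Type*} [NormedAddCommGroup F] [InnerProductSpace ℝ F]
    {θ : ℝ} (hθ0 : 0 ≤ θ) (hθ1 : θ < 1) :
    Mixing F (1 : Matrix (Fin K) (Fin K) ℝ) (Matrix.of fun _ _ => (1 : ℝ) / K) θ where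
  col₁ k := by simp [Matrix.one_apply]
  row₁ k := by simp [Matrix.one_apply]
  col₂ k := by simp
  row₂ k := by simp
  nonneg := hθ0
  lt_one := hθ1
  contr u hu := by
    rw [mix_one, mix_uniform u hu, norm_zero]
    positivity
  nonexp u hu := by
    rw [mix_uniform u hu, norm_zero]
    positivity

theorem mixing_consensus {F : Type*} [NormedAddCommGroup F] [InnerProductSpace ℝ F]
    (hA : IsCombination A) (hV : IsSpectral A V lam) {θ : ℝ} (hθ0 : 0 ≤ θ) (hθ1 : θ < 1)
    (hθ : ∀ j, |lam j| ≤ θ) : Mixing F A 1 θ where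
  col₁ := hA.col_sum
  row₁ := hA.row_sum
  col₂ k := by simp [Matrix.one_apply]
  row₂ k := by simp [Matrix.one_apply]
  nonneg := hθ0
  lt_one := hθ1
  contr u hu := by
    rw [mix_one]
    exact hV.norm_mix_le hA hθ hθ0 hu
  nonexp u hu := by rw [mix_one]

theorem mixing_diffusion {F : Type*} [NormedAddCommGroup F] [InnerProductSpace ℝ F]
    (hA : IsCombination A) (hV : IsSpectral A V lam) {θ : ℝ} (hθ0 : 0 ≤ θ) (hθ1 : θ < 1)
    (hθ : ∀ j, |lam j| ≤ θ) : Mixing F 1 A θ where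
  col₁ k := by simp [Matrix.one_apply]
  row₁ k := by simp [Matrix.one_apply]
  col₂ := hA.col_sum
  row₂ := hA.row_sum
  nonneg := hθ0
  lt_one := hθ1
  contr u hu := by
    rw [mix_one]
    exact hV.norm_mix_le hA hθ hθ0 hu
  nonexp u hu := (hV.norm_mix_le hA hθ hθ0 hu).trans (mul_le_of_le_one_left (norm_nonneg _) hθ1.le)

/-! ### Comparison of the heterogeneity terms -/

/-- The first sum is $1$. For exponents at least two,
$1-x^m\ge1-|x|^2=(1-|x|)(1+|x|)\ge(1-|x|)(1-x)$, uniformly in $m$ and also for negative eigenvalues.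
-/
theorem one_sub_le_geomSum {θ : ℝ} (hθ1 : θ < 1) (hθ : ∀ j, |lam j| ≤ θ) (n : ℕ)
    (j : Fin (K - 1)) : 1 - θ ≤ geomSum lam (n + 1) j := by
  have ht0 := abs_nonneg (lam j)
  have h1 := neg_abs_le (lam j)
  have h2 := le_abs_self (lam j)
  have h3 := hθ j
  unfold geomSum
  set x := lam j
  set t := |x|
  have hx : 0 < 1 - x := by linarith
  rw [inv_mul_eq_div, le_div_iff₀ hx]
  have h4 : (1 - t) * (1 - x) ≤ 1 - x ^ (n + 1) := by
    rcases n with _ | n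
    · simp only [zero_add, pow_one]
      nlinarith
    · have h5 : x ^ (n + 1 + 1) ≤ t ^ 2 := by
        calc x ^ (n + 1 + 1) ≤ |x ^ (n + 1 + 1)| := le_abs_self _
          _ = t ^ (n + 2) := abs_pow _ _
          _ ≤ t ^ 2 := pow_le_pow_of_le_one ht0 (by linarith) (by omega)
      nlinarith
  nlinarith

section Comparison

variable [NeZero K]

theorem Problem.wSq_dVec_eq (hV : IsSpectral A V lam) (hd : mean (S.netGradient p ε w₀) = 0) :
    wSq ((1 : Matrix (Fin K) (Fin K) ℝ) ⊗ₖ S.Hbar p ε w₀) (S.dVec p ε w₀)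
      = ∑ j, S.energy p ε w₀ V j := by
  rw [Problem.Hbar, wSq_kronecker]
  have := hV.sum_quadratic_synth (hessMap (S.risk p ε) w₀) (coeffs V (S.netGradient p ε w₀))
  rw [hV.synth_coeffs hd] at this
  exact this

theorem Problem.wSq_mulVec_dVec_eq (hA : IsCombination A) (hV : IsSpectral A V lam)
    (hd : mean (S.netGradient p ε w₀) = 0) :
    wSq ((1 : Matrix (Fin K) (Fin K) ℝ) ⊗ₖ S.Hbar p ε w₀)
      ((A ⊗ₖ (1 : Matrix (Fin M) (Fin M) ℝ)) *ᵥ S.dVec p ε w₀)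
      = ∑ j, lam j ^ 2 * S.energy p ε w₀ V j := by
  rw [Problem.Hbar, wSq_kronecker]
  have h1 := hV.sum_quadratic_synth (hessMap (S.risk p ε) w₀)
    fun j => lam j • coeffs V (S.netGradient p ε w₀) j
  rw [← hV.mix_synth hA, hV.synth_coeffs hd] at h1
  have h2 : ∀ k, stackRow ((A ⊗ₖ (1 : Matrix (Fin M) (Fin M) ℝ)) *ᵥ S.dVec p ε w₀) k
      = mix A (S.netGradient p ε w₀) k := by
    intro k
    ext m
    simp only [stackRow, Matrix.mulVec, dotProduct, Fintype.sum_prod_type,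
      Matrix.kroneckerMap_apply, Matrix.one_apply, mix_apply, WithLp.ofLp_sum, Finset.sum_apply,
      PiLp.smul_apply, smul_eq_mul]
    refine Finset.sum_congr rfl fun l _ => ?_
    rw [Finset.sum_eq_single m]
    · simp [Problem.dVec, Problem.netGradient, hA.symm k l]
    · intro i _ hi
      simp [hi.symm]
    · simp
  simp only [h2]
  rw [h1]
  refine Finset.sum_congr rfl fun j _ => ?_
  rw [map_smul, real_inner_smul_left, real_inner_smul_right, Problem.energy]
  ring

/-- Bounds for the heterogeneity terms and their difference. -/
theorem Problem.fDif_bounds {θ : ℝ} (hpsd : ∀ v, 0 ≤ ⟪hessMap (S.risk p ε) w₀ v, v⟫)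
    (hA : IsCombination A) (hV : IsSpectral A V lam)
    (hd : mean (S.netGradient p ε w₀) = 0) (hθ0 : 0 ≤ θ) (hθ1 : θ < 1)
    (hθ : ∀ j, |lam j| ≤ θ) (n : ℕ) :
    1 / (2 * (K : ℝ)) * (1 - θ) ^ 3 * wSq ((1 : Matrix (Fin K) (Fin K) ℝ) ⊗ₖ S.Hbar p ε w₀)
      (S.dVec p ε w₀) ≤ S.fCon p ε V lam w₀ n - S.fDif p ε V lam w₀ n ∧
    1 / (2 * (K : ℝ)) * (1 - θ) ^ 3 * wSq ((1 : Matrix (Fin K) (Fin K) ℝ) ⊗ₖ S.Hbar p ε w₀)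
      ((A ⊗ₖ (1 : Matrix (Fin M) (Fin M) ℝ)) *ᵥ S.dVec p ε w₀) ≤ S.fDif p ε V lam w₀ n ∧
    0 ≤ wSq ((1 : Matrix (Fin K) (Fin K) ℝ) ⊗ₖ S.Hbar p ε w₀)
      ((A ⊗ₖ (1 : Matrix (Fin M) (Fin M) ℝ)) *ᵥ S.dVec p ε w₀) ∧
    wSq ((1 : Matrix (Fin K) (Fin K) ℝ) ⊗ₖ S.Hbar p ε w₀)
      ((A ⊗ₖ (1 : Matrix (Fin M) (Fin M) ℝ)) *ᵥ S.dVec p ε w₀)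
      ≤ wSq ((1 : Matrix (Fin K) (Fin K) ℝ) ⊗ₖ S.Hbar p ε w₀) (S.dVec p ε w₀) := by
  have hlam := hV.abs_lt_one hA
  have hg : ∀ j, (1 - θ) ^ 2 ≤ geomSum lam (n + 1) j ^ 2 := fun j =>
    pow_le_pow_left₀ (by linarith) (one_sub_le_geomSum hθ1 hθ n j) 2
  have hl : ∀ j, lam j ^ 2 ≤ θ := fun j => by
    rw [← sq_abs]
    have := hθ j
    nlinarith [abs_nonneg (lam j)]
  have he : ∀ j, 0 ≤ S.energy p ε w₀ V j := fun j => hpsd _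
  have hθ3 : (1 - θ) ^ 3 ≤ (1 - θ) ^ 2 := pow_le_pow_of_le_one (by linarith) (by linarith)
    (by norm_num)
  rw [S.fCon_eq hlam, S.fDif_eq hlam, S.wSq_dVec_eq hV hd, S.wSq_mulVec_dVec_eq hA hV hd]
  refine ⟨?_, ?_, Finset.sum_nonneg fun j _ => mul_nonneg (sq_nonneg _) (he j),
    Finset.sum_le_sum fun j _ => ?_⟩
  · rw [← mul_sub, ← Finset.sum_sub_distrib, mul_assoc, Finset.mul_sum]
    refine mul_le_mul_of_nonneg_left (Finset.sum_le_sum fun j _ => ?_) (by positivity)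
    rw [← sub_mul]
    refine mul_le_mul_of_nonneg_right ?_ (he j)
    -- One factor comes from $1-\lambda_j^2\ge1-\theta$, the other two from the squared geometric
    -- sum.
    calc (1 - θ) ^ 3 = (1 - θ) * (1 - θ) ^ 2 := by ring
      _ ≤ (1 - lam j ^ 2) * geomSum lam (n + 1) j ^ 2 :=
        mul_le_mul (by linarith [hl j]) (hg j) (sq_nonneg _) (by linarith [hl j])
      _ = _ := by ring
  · rw [mul_assoc, Finset.mul_sum]
    refine mul_le_mul_of_nonneg_left (Finset.sum_le_sum fun j _ => ?_) (by positivity)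
    rw [← mul_assoc]
    refine mul_le_mul_of_nonneg_right ?_ (he j)
    calc (1 - θ) ^ 3 * lam j ^ 2 ≤ geomSum lam (n + 1) j ^ 2 * lam j ^ 2 := by
          gcongr
          exact hθ3.trans (hg j)
      _ = _ := by ring
  · exact mul_le_of_le_one_left (he j) ((hl j).trans hθ1.le)

end Comparison

end ClosedForms


/-! ### Excess risk of the three strategies with explicit remainder -/

section MainExpansion

/-- The drift of a strategy in terms of the closed forms. -/
noncomputable def Strategy.heterogeneity {K M D : ℕ} {Y : Type*} (S : Problem K M D Y) (p : ℝ≥0∞)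
    (ε : ℝ) (V : Matrix (Fin K) (Fin (K - 1)) ℝ) (lam : Fin (K - 1) → ℝ) (w₀ : Vec M) (n : ℕ) :
    Strategy → ℝ
  | .centralized => 0
  | .consensus => S.fCon p ε V lam w₀ n
  | .diffusion => S.fDif p ε V lam w₀ n

theorem Strategy.sum_drift_eq {K M D : ℕ} [NeZero K] {Y : Type*} {S : Problem K M D Y} {p : ℝ≥0∞}
    {ε : ℝ} {A : Matrix (Fin K) (Fin K) ℝ} {V : Matrix (Fin K) (Fin (K - 1)) ℝ}
    {lam : Fin (K - 1) → ℝ} {w₀ : Vec M} (hA : IsCombination A) (hV : IsSpectral A V lam)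
    (hd : mean (S.netGradient p ε w₀) = 0) (n : ℕ) (s : Strategy) :
    1 / (2 * (K : ℝ)) * ∑ k, ⟪hessMap (S.risk p ε) w₀
        (drift (s.A₁ A) (s.A₂ A) (S.netGradient p ε w₀) (n + 1) k),
        drift (s.A₁ A) (s.A₂ A) (S.netGradient p ε w₀) (n + 1) k⟫
      = s.heterogeneity S p ε V lam w₀ n := by
  have hlam := hV.abs_lt_one hA
  cases s with
  | centralized =>
    simp only [Strategy.A₁, Strategy.A₂, Strategy.heterogeneity, drift_centralized hd]
    simp
  | consensus =>
    simp only [Strategy.A₁, Strategy.A₂, Strategy.heterogeneity, drift_consensus hA hV hd,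
      S.fCon_eq hlam, hV.sum_quadratic_synth]
    congr 1
    refine Finset.sum_congr rfl fun j _ => ?_
    rw [map_smul, real_inner_smul_left, real_inner_smul_right, Problem.energy]
    ring
  | diffusion =>
    simp only [Strategy.A₁, Strategy.A₂, Strategy.heterogeneity, drift_diffusion hA hV hd,
      S.fDif_eq hlam, hV.sum_quadratic_synth]
    congr 1
    refine Finset.sum_congr rfl fun j _ => ?_
    rw [map_smul, real_inner_smul_left, real_inner_smul_right, Problem.energy]
    ring

theorem Strategy.mixing {K : ℕ} [NeZero K] {F : Type*} [NormedAddCommGroup F]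
    [InnerProductSpace ℝ F] {A : Matrix (Fin K) (Fin K) ℝ} {V : Matrix (Fin K) (Fin (K - 1)) ℝ}
    {lam : Fin (K - 1) → ℝ} (hA : IsCombination A) (hV : IsSpectral A V lam) {θ : ℝ}
    (hθ0 : 0 ≤ θ) (hθ1 : θ < 1) (hθ : ∀ j, |lam j| ≤ θ) (s : Strategy) :
    Mixing F (s.A₁ A) (s.A₂ A) θ :=
  match s with
  | .centralized => mixing_centralized hθ0 hθ1
  | .consensus => mixing_consensus hA hV hθ0 hθ1 hθ
  | .diffusion => mixing_diffusion hA hV hθ0 hθ1 hθ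

/-- The excess risk of all strategies, with an explicit remainder. -/
theorem exists_excessRisk_bound {K M : ℕ} (p : ℝ≥0∞) [Fact (1 ≤ p)]
    {A : Matrix (Fin K) (Fin K) ℝ} (hA : IsCombination A)
    {V : Matrix (Fin K) (Fin (K - 1)) ℝ} {lam : Fin (K - 1) → ℝ} (hV : IsSpectral A V lam)
    (L a η₁ r₀ G : ℝ) {c : ℝ} (hc : 0 ≤ c) :
    ∃ Γ κ μ₀ : ℝ, 0 ≤ Γ ∧ 0 < κ ∧ 0 < μ₀ ∧ ∀ {D : ℕ} {Y : Type u} {S : Problem K M D Y} {ε : ℝ}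
      {B : ℕ} {att : S.Attack} {w₀ : Vec M} {ν : Strategy → Measure (State K M)} {δ μ : ℝ}
      [∀ s, IsProbabilityMeasure (ν s)],
      S.Regular p ε att w₀ L a η₁ r₀ G μ → IsLocalMin (S.risk p ε) w₀ →
      (∀ k, ‖hess (S.localRisk p ε k) w₀ - hess (S.risk p ε) w₀‖ ≤ δ) →
      1 ≤ B → 1 / (B : ℝ) ≤ G * μ → μ ≤ δ ^ 2 → 0 < δ → δ ≤ 1 →
      (∀ s, Integrable (fun W => ‖netError w₀ W‖ ^ 4) (ν s)) →
      (∀ s, ∫ W, ‖netError w₀ W‖ ^ 2 ∂(ν s) ≤ δ ^ 2 * μ ^ 2) →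
      (∀ s, ∫ W, ‖netError w₀ W‖ ^ 4 ∂(ν s) ≤ μ ^ 3) →
      μ ≤ μ₀ → ∀ n : ℕ, (n : ℝ) ≤ c / μ →
      (∀ s k, Integrable (fun W : State K M => S.risk p ε (W k))
        (S.iterLaw att A s μ B (ν s) n)) ∧
      (∀ s, |S.excessRisk p ε att A s μ B (ν s) w₀ n - (μ / (B : ℝ) * S.eFun p ε att μ w₀ n
        + μ ^ 2 * s.heterogeneity S p ε V lam w₀ n)| ≤ Γ * (δ * μ ^ 2)) ∧
      κ * wSq ((1 : Matrix (Fin K) (Fin K) ℝ) ⊗ₖ S.Hbar p ε w₀) (S.dVec p ε w₀)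
        ≤ S.fCon p ε V lam w₀ n - S.fDif p ε V lam w₀ n ∧
      κ * wSq ((1 : Matrix (Fin K) (Fin K) ℝ) ⊗ₖ S.Hbar p ε w₀)
        ((A ⊗ₖ (1 : Matrix (Fin M) (Fin M) ℝ)) *ᵥ S.dVec p ε w₀) ≤ S.fDif p ε V lam w₀ n ∧
      0 ≤ wSq ((1 : Matrix (Fin K) (Fin K) ℝ) ⊗ₖ S.Hbar p ε w₀)
        ((A ⊗ₖ (1 : Matrix (Fin M) (Fin M) ℝ)) *ᵥ S.dVec p ε w₀) ∧
      wSq ((1 : Matrix (Fin K) (Fin K) ℝ) ⊗ₖ S.Hbar p ε w₀)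
        ((A ⊗ₖ (1 : Matrix (Fin M) (Fin M) ℝ)) *ᵥ S.dVec p ε w₀)
        ≤ wSq ((1 : Matrix (Fin K) (Fin K) ℝ) ⊗ₖ S.Hbar p ε w₀) (S.dVec p ε w₀) := by
  have := hA.neZero
  obtain ⟨θ, hθ0, hθ1, hθ⟩ := hV.exists_bound hA
  obtain ⟨Γ, μ₀, hΓ, hμ₀, key⟩ :=
    exists_risk_expansion.{u} K M (gradConst L a η₁ r₀ G) θ c hθ0 hθ1 hc
  have hK : (0 : ℝ) < K := Nat.cast_pos.2 (NeZero.pos K)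
  have hg : 0 < 1 - θ := by linarith
  refine ⟨Γ, 1 / (2 * (K : ℝ)) * (1 - θ) ^ 3, μ₀, hΓ, by positivity, hμ₀, ?_⟩
  intro D Y S ε B att w₀ ν δ μ _ h hmin hdis hB1 hB hμδ hδ hδ1 hint h2 h4 hμμ₀ n hn
  have hsymm := inner_hessMap_comm h.contDiffOn_risk h.r₀_pos
  have hC : G ≤ gradConst L a η₁ r₀ G := by
    have := h.G_nonneg 0
    have := h.L_nonneg
    have := h.η₁_nonneg
    have := h.hessBound_nonneg
    have := h.remainderBound_nonneg
    have : 0 ≤ 1 + η₁ + hessBound L a η₁ r₀ + (L + 2 * η₁) + remainderBound L a η₁ r₀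
      + 27 * (G + η₁ ^ 4 + L ^ 4) := by positivity
    unfold gradConst
    linarith
  have hstep : ∀ s : Strategy, StepBounds (S.advGrad att) (s.A₁ A) (s.A₂ A) w₀
      (S.netGradient p ε w₀) (hessMap (S.risk p ε) w₀)
      (fun k => hessMap (S.localRisk p ε k) w₀) (gradConst L a η₁ r₀ G) θ δ μ B := fun s =>
    ⟨h.gradBounds hmin hdis, s.mixing hA hV hθ0 hθ1 hθ, hB1,
      hB.trans (mul_le_mul_of_nonneg_right hC h.pos.le), h.pos, hμδ, hδ, hδ1⟩
  have hd := (hstep .centralized).mean_d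
  have hm := h.smooth.measurable_advGrad h.attack
  have hRm := (h.smooth.continuous_risk h.unique).measurable
  have hR : ∀ w, |S.risk p ε w - S.risk p ε w₀
      - 1 / 2 * ⟪hessMap (S.risk p ε) w₀ (w - w₀), w - w₀⟫|
      ≤ gradConst L a η₁ r₀ G * ‖w - w₀‖ ^ 3 := fun w =>
    (h.abs_risk_sub_le hmin w).trans
      (mul_le_mul_of_nonneg_right h.remainderBound_le (by positivity))
  have hpsd := inner_nonneg_of_isLocalMin hmin hR
  refine ⟨fun s k => (hstep s).integrable_risk hm (hint s) hRm hR (n + 1) k, fun s => ?_,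
    S.fDif_bounds hpsd hA hV hd hθ0 hθ1 hθ n⟩
  -- The starting point carries the index $-1$, so iterate `n` has made `n + 1` steps; the horizon
  -- `c / μ + 1` of the expansion leaves room for this.
  have h5 := key (hstep s) hsymm hm (hint s) (h2 s) (h4 s) hμμ₀ hRm hR (n + 1)
    (by push_cast; linarith)
  rw [s.sum_drift_eq hA hV hd, ← S.eFun_eq n hsymm] at h5
  rw [Problem.excessRisk, ← sub_sub]
  exact h5

end MainExpansion

/-! ### Starting conditions and the vanishing rate -/

section Asymptotics

theorem norm_netError_sq {K M : ℕ} (w₀ : Vec M) (W : State K M) :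
    ‖netError w₀ W‖ ^ 2 = ∑ k, ‖W k - w₀‖ ^ 2 :=
  PiLp.norm_sq_eq_of_L2 _ _

theorem norm_netError_pow_four_le {K M : ℕ} (w₀ : Vec M) (W : State K M) :
    ‖netError w₀ W‖ ^ 4 ≤ K * ∑ k, ‖W k - w₀‖ ^ 4 := by
  have h := sq_sum_le_card_mul_sum_sq (s := Finset.univ) (f := fun k => ‖W k - w₀‖ ^ 2)
  calc ‖netError w₀ W‖ ^ 4 = (∑ k, ‖W k - w₀‖ ^ 2) ^ 2 := by rw [← norm_netError_sq]; ring
    _ ≤ _ := by simpa [← pow_mul] using h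

theorem netError_moments {K M : ℕ} {w₀ : Vec M} {ν : Measure (State K M)}
    [IsProbabilityMeasure ν] {b₂ b₄ : ℝ}
    (hi : ∀ k, Integrable (fun W : State K M => ‖W k - w₀‖ ^ 4) ν)
    (h2 : ∀ k, ∫ W, ‖W k - w₀‖ ^ 2 ∂ν ≤ b₂) (h4 : ∀ k, ∫ W, ‖W k - w₀‖ ^ 4 ∂ν ≤ b₄) :
    Integrable (fun W => ‖netError w₀ W‖ ^ 4) ν ∧ ∫ W, ‖netError w₀ W‖ ^ 2 ∂ν ≤ K * b₂ ∧
    ∫ W, ‖netError w₀ W‖ ^ 4 ∂ν ≤ K * (K * b₄) := by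
  have hsum : Integrable (fun W : State K M => K * ∑ k, ‖W k - w₀‖ ^ 4) ν :=
    (integrable_finsetSum _ fun k _ => hi k).const_mul _
  have i4 : Integrable (fun W => ‖netError w₀ W‖ ^ 4) ν :=
    hsum.mono' ((continuous_netError w₀).norm.pow 4).measurable.aestronglyMeasurable
      (Eventually.of_forall fun W => by
        rw [Real.norm_of_nonneg (by positivity)]
        exact norm_netError_pow_four_le w₀ W)
  have hi2 : ∀ k, Integrable (fun W : State K M => ‖W k - w₀‖ ^ 2) ν := fun k => by
    have hk : Continuous fun W : State K M => ‖W k - w₀‖ ^ 2 := by fun_prop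
    refine ((hi k).add (integrable_const 1)).mono' hk.measurable.aestronglyMeasurable
      (Eventually.of_forall fun W => ?_)
    rw [Real.norm_of_nonneg (by positivity)]
    simp only [Pi.add_apply]
    nlinarith [sq_nonneg (‖W k - w₀‖ ^ 2 - 1), sq_nonneg (‖W k - w₀‖ ^ 2)]
  refine ⟨i4, ?_, ?_⟩
  · simp only [norm_netError_sq]
    rw [integral_finsetSum _ fun k _ => hi2 k]
    exact (Finset.sum_le_sum fun k _ => h2 k).trans (le_of_eq (by simp))
  · refine (integral_mono i4 hsum fun W => norm_netError_pow_four_le w₀ W).trans ?_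
    rw [integral_const_mul, integral_finsetSum _ fun k _ => hi k]
    gcongr
    exact (Finset.sum_le_sum fun k _ => h4 k).trans (le_of_eq (by simp))

theorem isLittleO_pow_nhdsGT {m n : ℕ} (h : m < n) :
    (fun μ : ℝ => μ ^ n) =o[𝓝[>] 0] fun μ => μ ^ m :=
  (isLittleO_pow_pow h).mono nhdsWithin_le_nhds

/-- A power of a quantity of order `μ ^ 2`. -/
theorem isBigO_rpow_of_isBigO_sq {ε : ℝ → ℝ} (h : ε =O[𝓝[>] 0] fun μ => μ ^ 2) {s : ℝ} {m : ℕ}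
    (hs : (m : ℝ) ≤ 2 * s) (hs0 : 0 ≤ s) : (fun μ => ε μ ^ s) =O[𝓝[>] 0] fun μ : ℝ => μ ^ m := by
  refine (h.rpow hs0 (Eventually.of_forall fun μ => sq_nonneg μ)).trans ?_
  refine IsBigO.of_bound 1 ?_
  filter_upwards [Ioo_mem_nhdsGT (zero_lt_one (α := ℝ))] with μ hμ
  have hμ0 := hμ.1
  rw [one_mul, Real.norm_of_nonneg (by positivity), Real.norm_of_nonneg (by positivity),
    ← Real.rpow_natCast μ m, ← Real.rpow_natCast μ 2, ← Real.rpow_mul hμ0.le]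
  exact Real.rpow_le_rpow_of_exponent_ge hμ0 hμ.2.le (by push_cast; exact hs)

end Asymptotics


/-- A vanishing rate that dominates the given quantities. -/
theorem exists_rate {ρ b : ℝ → ℝ} (hρ : Tendsto ρ (𝓝[>] 0) (𝓝 0))
    (hb : b =o[𝓝[>] 0] fun μ => μ ^ 2) :
    ∃ δ : ℝ → ℝ, Tendsto δ (𝓝[>] 0) (𝓝 0) ∧ ∀ᶠ μ in 𝓝[>] (0 : ℝ),
      0 < δ μ ∧ δ μ ≤ 1 ∧ μ ≤ δ μ ^ 2 ∧ ρ μ ≤ δ μ ∧ b μ ≤ δ μ ^ 2 * μ ^ 2 := by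
  have h1 : Tendsto (fun μ : ℝ => √μ) (𝓝[>] 0) (𝓝 0) := by
    simpa using (Real.continuous_sqrt.tendsto 0).mono_left nhdsWithin_le_nhds
  have h2 : Tendsto (fun μ => |ρ μ|) (𝓝[>] 0) (𝓝 0) := by simpa using hρ.abs
  have h3 : Tendsto (fun μ => √|b μ / μ ^ 2|) (𝓝[>] 0) (𝓝 0) := by
    simpa using hb.tendsto_div_nhds_zero.abs.sqrt
  have h4 : Tendsto (fun μ => √μ + |ρ μ| + √|b μ / μ ^ 2|) (𝓝[>] 0) (𝓝 0) := by
    simpa using (h1.add h2).add h3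
  -- Each summand of the rate serves one demand: the first dominates $\sqrt\mu$, the second `ρ`, and
  -- the third the starting error relative to $\mu^2$.
  refine ⟨_, h4, ?_⟩
  filter_upwards [self_mem_nhdsWithin, h4.eventually (gt_mem_nhds one_pos)] with μ hμ hlt
  have hμ : 0 < μ := hμ
  have a1 := Real.sqrt_pos.2 hμ
  have a2 := abs_nonneg (ρ μ)
  have a3 := Real.sqrt_nonneg |b μ / μ ^ 2|
  refine ⟨by positivity, hlt.le, ?_, by linarith [le_abs_self (ρ μ)], ?_⟩
  · calc μ = √μ ^ 2 := (Real.sq_sqrt hμ.le).symm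
      _ ≤ _ := by gcongr; linarith
  · rw [← div_le_iff₀ (by positivity)]
    calc b μ / μ ^ 2 ≤ |b μ / μ ^ 2| := le_abs_self _
      _ = √|b μ / μ ^ 2| ^ 2 := (Real.sq_sqrt (abs_nonneg _)).symm
      _ ≤ _ := by gcongr; linarith

/-- With $1/B=O(\mu)$ the starting terms are $o(\mu^2)$ and $o(\mu^4)$. With $\epsilon=O(\mu^2)$ the
exponents $7/4$ and $7/2$ give $O(\mu^3)$ and $O(\mu^4)$ with room to spare. The factors `k` account
for the passage from single agents to the network norm. -/
theorem isLittleO_start {B : ℝ → ℕ} {ε a₂ a₄ : ℝ → ℝ} (C k : ℝ)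
    (ha₂ : a₂ =o[𝓝[>] 0] fun μ => μ / (B μ : ℝ))
    (ha₄ : a₄ =o[𝓝[>] 0] fun μ => μ ^ 2 / (B μ : ℝ) ^ 2)
    (hlarge : (fun μ => 1 / (B μ : ℝ)) =O[𝓝[>] 0] fun μ => μ)
    (hsmall : ε =O[𝓝[>] 0] fun μ => μ ^ 2) :
    ((fun μ => k * (a₂ μ + C * ε μ ^ (7 / 4 : ℝ))) =o[𝓝[>] 0] fun μ => μ ^ 2) ∧
    ((fun μ => k * (k * (a₄ μ + C * ε μ ^ (7 / 2 : ℝ)))) =o[𝓝[>] 0] fun μ => μ ^ 3) := by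
  have e1 : (fun μ : ℝ => μ / (B μ : ℝ)) =O[𝓝[>] 0] fun μ => μ ^ 2 := by
    have := (isBigO_refl (fun μ : ℝ => μ) (𝓝[>] 0)).mul hlarge
    simpa [sq, div_eq_mul_inv] using this
  have e2 : (fun μ : ℝ => μ ^ 2 / (B μ : ℝ) ^ 2) =O[𝓝[>] 0] fun μ => μ ^ 4 := by
    have := e1.pow 2
    simpa [div_pow, ← pow_mul] using this
  have e3 : (fun μ => ε μ ^ (7 / 4 : ℝ)) =o[𝓝[>] 0] fun μ => μ ^ 2 :=
    (isBigO_rpow_of_isBigO_sq hsmall (m := 3) (by norm_num) (by norm_num)).trans_isLittleO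
      (isLittleO_pow_nhdsGT (by norm_num))
  have e4 : (fun μ => ε μ ^ (7 / 2 : ℝ)) =o[𝓝[>] 0] fun μ => μ ^ 3 :=
    (isBigO_rpow_of_isBigO_sq hsmall (m := 4) (by norm_num) (by norm_num)).trans_isLittleO
      (isLittleO_pow_nhdsGT (by norm_num))
  have e5 : a₄ =o[𝓝[>] 0] fun μ => μ ^ 3 :=
    (ha₄.trans_isBigO e2).trans (isLittleO_pow_nhdsGT (by norm_num))
  exact ⟨((ha₂.trans_isBigO e1).add (e3.const_mul_left C)).const_mul_left k,
    ((e5.add (e4.const_mul_left C)).const_mul_left k).const_mul_left k⟩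

end AdvNet

/-! ### The asymptotic expansions and the ordering -/

theorem theorem1 {K M D : ℕ} {Y : Type*} (p : ℝ≥0∞) [Fact (1 ≤ p)]
    -- the network: combination matrix and its spectral decomposition
    (A : Matrix (Fin K) (Fin K) ℝ) (hA : AdvNet.IsCombination A)
    (V : Matrix (Fin K) (Fin (K - 1)) ℝ) (lam : Fin (K - 1) → ℝ)
    (hV : AdvNet.IsSpectral A V lam)
    -- the setting, indexed by the step size `μ → 0⁺`
    (S : ℝ → AdvNet.Problem K M D Y) (ε : ℝ → ℝ) (B : ℝ → ℕ)
    (att : ∀ μ, (S μ).Attack) (wStar : ℝ → AdvNet.Vec M)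
    (ν : AdvNet.Strategy → ℝ → Measure (AdvNet.State K M))
    [∀ s μ, IsProbabilityMeasure (ν s μ)]
    -- perturbation bound, attack, batch size
    (hε : ∀ᶠ μ in 𝓝[>] (0 : ℝ), 0 ≤ ε μ)
    (hatt : ∀ᶠ μ in 𝓝[>] (0 : ℝ), (S μ).IsAttack p (ε μ) (att μ))
    (hB : ∀ᶠ μ in 𝓝[>] (0 : ℝ), 1 ≤ B μ)
    -- unique optimal perturbation
    (huniq : ∀ᶠ μ in 𝓝[>] (0 : ℝ), (S μ).UniquePerturbation p (ε μ))
    -- smooth losses, with gradients at `w⋆` of order one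
    (L G : ℝ)
    (hL : ∀ᶠ μ in 𝓝[>] (0 : ℝ), (S μ).Smooth L)
    (hG : ∀ᶠ μ in 𝓝[>] (0 : ℝ), ∀ k,
      (1 / ((S μ).N k : ℝ)) *
        ∑ i, ‖(S μ).gradW k (wStar μ) ((S μ).x k i) ((S μ).y k i)‖ ^ 4 ≤ G)
    -- `w⋆` is a local minimizer, near which the local risks have a Lipschitz Hessian
    (hmin : ∀ᶠ μ in 𝓝[>] (0 : ℝ), IsLocalMin ((S μ).risk p (ε μ)) (wStar μ))
    (r₀ Λ : ℝ) (hr₀ : 0 < r₀)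
    (hreg : ∀ᶠ μ in 𝓝[>] (0 : ℝ), ∀ k,
      ContDiffOn ℝ 2 ((S μ).localRisk p (ε μ) k) (Metric.ball (wStar μ) r₀) ∧
      ∀ w ∈ Metric.ball (wStar μ) r₀,
        ‖AdvNet.hess ((S μ).localRisk p (ε μ) k) w
          - AdvNet.hess ((S μ).localRisk p (ε μ) k) (wStar μ)‖ ≤ Λ * ‖w - wStar μ‖)
    -- small Hessian disagreement
    (ρ : ℝ → ℝ) (hρ : Tendsto ρ (𝓝[>] 0) (𝓝 0))
    (hdis : ∀ᶠ μ in 𝓝[>] (0 : ℝ), ∀ k,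
      ‖AdvNet.hess ((S μ).localRisk p (ε μ) k) (wStar μ)
        - AdvNet.hess ((S μ).risk p (ε μ)) (wStar μ)‖ ≤ ρ μ)
    -- starting points close to `w⋆`
    (C : ℝ) (a₂ a₄ : ℝ → ℝ)
    (ha₂ : a₂ =o[𝓝[>] 0] fun μ => μ / (B μ : ℝ))
    (ha₄ : a₄ =o[𝓝[>] 0] fun μ => μ ^ 2 / (B μ : ℝ) ^ 2)
    (hint : ∀ᶠ μ in 𝓝[>] (0 : ℝ), ∀ s k,
      Integrable (fun W : AdvNet.State K M => ‖W k - wStar μ‖ ^ 4) (ν s μ))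
    (hstart₂ : ∀ᶠ μ in 𝓝[>] (0 : ℝ), ∀ s k,
      ∫ W, ‖W k - wStar μ‖ ^ 2 ∂(ν s μ) ≤ a₂ μ + C * ε μ ^ (7 / 4 : ℝ))
    (hstart₄ : ∀ᶠ μ in 𝓝[>] (0 : ℝ), ∀ s k,
      ∫ W, ‖W k - wStar μ‖ ^ 4 ∂(ν s μ) ≤ a₄ μ + C * ε μ ^ (7 / 2 : ℝ))
    -- large batches and a small perturbation bound
    (hlarge : (fun μ => 1 / (B μ : ℝ)) =O[𝓝[>] 0] fun μ => μ)
    (hsmall : ε =O[𝓝[>] 0] fun μ => μ ^ 2)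
    -- horizon `n ≤ c / μ`
    (c : ℝ) (hc : 0 < c) :
    let ER : AdvNet.Strategy → ℝ → ℕ → ℝ := fun s μ n =>
      (S μ).excessRisk p (ε μ) (att μ) A s μ (B μ) (ν s μ) (wStar μ) n
    let e : ℝ → ℕ → ℝ := fun μ n => (S μ).eFun p (ε μ) (att μ) μ (wStar μ) n
    let f_con : ℝ → ℕ → ℝ := fun μ n => (S μ).fCon p (ε μ) V lam (wStar μ) n
    let f_dif : ℝ → ℕ → ℝ := fun μ n => (S μ).fDif p (ε μ) V lam (wStar μ) n
    let H : ℝ → Matrix (Fin K × Fin M) (Fin K × Fin M) ℝ := fun μ =>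
      (1 : Matrix (Fin K) (Fin K) ℝ) ⊗ₖ (S μ).Hbar p (ε μ) (wStar μ)
    let d : ℝ → Fin K × Fin M → ℝ := fun μ => (S μ).dVec p (ε μ) (wStar μ)
    -- the expectations in `ER` are finite
    (∀ᶠ μ in 𝓝[>] (0 : ℝ), ∀ s (n : ℕ), (n : ℝ) ≤ c / μ → ∀ k,
      Integrable (fun W : AdvNet.State K M => (S μ).risk p (ε μ) (W k))
        ((S μ).iterLaw (att μ) A s μ (B μ) (ν s μ) n)) ∧
    -- the expansions, and the ordering up to the same remainder
    (∃ r : ℝ → ℝ, r =o[𝓝[>] 0] (fun μ => μ ^ 2) ∧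
      ∀ᶠ μ in 𝓝[>] (0 : ℝ), ∀ n : ℕ, (n : ℝ) ≤ c / μ →
        |ER .centralized μ n - μ / (B μ : ℝ) * e μ n| ≤ r μ ∧
        |ER .consensus μ n - (μ / (B μ : ℝ) * e μ n + μ ^ 2 * f_con μ n)| ≤ r μ ∧
        |ER .diffusion μ n - (μ / (B μ : ℝ) * e μ n + μ ^ 2 * f_dif μ n)| ≤ r μ ∧
        0 ≤ f_dif μ n ∧ f_dif μ n ≤ f_con μ n ∧
        ER .centralized μ n ≤ ER .diffusion μ n + r μ ∧
        ER .diffusion μ n ≤ ER .consensus μ n + r μ) ∧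
    -- the exact ordering, when the heterogeneity terms do not degenerate
    (∀ c₀ > 0, (∀ᶠ μ in 𝓝[>] (0 : ℝ), c₀ ≤ AdvNet.wSq (H μ) (d μ)) →
      ∀ᶠ μ in 𝓝[>] (0 : ℝ), ∀ n : ℕ, (n : ℝ) ≤ c / μ →
        ER .diffusion μ n ≤ ER .consensus μ n) ∧
    (∀ c₀ > 0, (∀ᶠ μ in 𝓝[>] (0 : ℝ), c₀ ≤ AdvNet.wSq (H μ)
        ((A ⊗ₖ (1 : Matrix (Fin M) (Fin M) ℝ)) *ᵥ d μ)) →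
      ∀ᶠ μ in 𝓝[>] (0 : ℝ), ∀ n : ℕ, (n : ℝ) ≤ c / μ →
        ER .centralized μ n ≤ ER .diffusion μ n ∧
        ER .diffusion μ n ≤ ER .consensus μ n) := by
  intro ER e f_con f_dif H d
  have hA' := hA.neZero
  obtain ⟨c₁, hc₁⟩ := hlarge.bound
  obtain ⟨c₂, hc₂⟩ := hsmall.bound
  obtain ⟨o₂, o₄⟩ := AdvNet.isLittleO_start C K ha₂ ha₄ hlarge hsmall
  obtain ⟨δ, hδ0, hδ⟩ := AdvNet.exists_rate hρ o₂
  -- The argument `|L| * (D * |c₂|)` bounds $LD\epsilon/\mu^2$, and `max G c₁` serves both as the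
  -- fourth-moment bound and as the constant in $1/B=O(\mu)$.
  obtain ⟨Γ, κ, μ₀, hΓ, hκ, hμ₀, key⟩ := AdvNet.exists_excessRisk_bound (M := M) p hA hV |L| |Λ|
    (|L| * (D * |c₂|)) r₀ (max G c₁) hc.le
  have main : ∀ᶠ μ in 𝓝[>] (0 : ℝ), ∀ n : ℕ, (n : ℝ) ≤ c / μ →
      (∀ s k, Integrable (fun W : AdvNet.State K M => (S μ).risk p (ε μ) (W k))
        ((S μ).iterLaw (att μ) A s μ (B μ) (ν s μ) n)) ∧
      (∀ s, |ER s μ n - (μ / (B μ : ℝ) * e μ n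
        + μ ^ 2 * s.heterogeneity (S μ) p (ε μ) V lam (wStar μ) n)| ≤ Γ * (δ μ * μ ^ 2)) ∧
      κ * AdvNet.wSq (H μ) (d μ) ≤ f_con μ n - f_dif μ n ∧
      κ * AdvNet.wSq (H μ) ((A ⊗ₖ (1 : Matrix (Fin M) (Fin M) ℝ)) *ᵥ d μ) ≤ f_dif μ n ∧
      0 ≤ AdvNet.wSq (H μ) ((A ⊗ₖ (1 : Matrix (Fin M) (Fin M) ℝ)) *ᵥ d μ) ∧
      AdvNet.wSq (H μ) ((A ⊗ₖ (1 : Matrix (Fin M) (Fin M) ℝ)) *ᵥ d μ)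
        ≤ AdvNet.wSq (H μ) (d μ) := by
    filter_upwards [hε, hatt, hB, huniq, hL, hG, hmin, hreg, hdis, hint, hstart₂, hstart₄, hc₁,
      hc₂, hδ, o₄.bound one_pos, Ioo_mem_nhdsGT (lt_min hμ₀ one_pos)] with
      μ hε hatt hB huniq hL hG hmin hreg hdis hint hs₂ hs₄ hc₁ hc₂ hδ ho₄ hμ
    obtain ⟨hμ0, hμ1⟩ := hμ
    obtain ⟨d1, d2, d3, d4, d5⟩ := hδ
    rw [Real.norm_of_nonneg (by positivity), Real.norm_of_nonneg hμ0.le] at hc₁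
    rw [Real.norm_of_nonneg hε, Real.norm_of_nonneg (by positivity)] at hc₂
    rw [Real.norm_of_nonneg (by positivity : 0 ≤ μ ^ 3), one_mul] at ho₄
    have hmom := fun s => AdvNet.netError_moments (hint s) (hs₂ s) (hs₄ s)
    refine key ?_ hmin (fun k => (hdis k).trans d4) hB
      (hc₁.trans (mul_le_mul_of_nonneg_right (le_max_right _ _) hμ0.le)) d3 d1 d2
      (fun s => (hmom s).1) (fun s => (hmom s).2.1.trans d5)
      (fun s => (hmom s).2.2.trans ((le_abs_self _).trans ho₄)) (hμ1.trans_le (min_le_left _ _)).le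
    exact
      { smooth := hL.mono (le_abs_self L)
        attack := hatt
        unique := huniq
        L_nonneg := abs_nonneg L
        a_nonneg := abs_nonneg Λ
        ε_nonneg := hε
        r₀_pos := hr₀
        contDiff := fun k => (hreg k).1
        hess_lip := fun k w hw => ((hreg k).2 w hw).trans
          (mul_le_mul_of_nonneg_right (le_abs_self Λ) (norm_nonneg _))
        pow_four := fun k => (hG k).trans (le_max_left _ _)
        le_sq := by
          have : ε μ ≤ |c₂| * μ ^ 2 := hc₂.trans (by gcongr; exact le_abs_self c₂)
          calc |L| * (D * ε μ) ≤ |L| * (D * (|c₂| * μ ^ 2)) := by gcongr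
            _ = _ := by ring
        pos := hμ0
        le_one := (hμ1.trans_le (min_le_right _ _)).le }
  have hpos : ∀ᶠ μ in 𝓝[>] (0 : ℝ), 0 < μ := self_mem_nhdsWithin
  -- As $\delta\to0$, two remainders together fall below a gap of order $\mu^2$.
  have hgap : ∀ c₀ > 0, ∀ᶠ μ in 𝓝[>] (0 : ℝ), 2 * Γ * (δ μ * μ ^ 2) ≤ κ * c₀ * μ ^ 2 := by
    intro c₀ hc₀
    have h1 : Tendsto (fun μ => 2 * Γ * δ μ) (𝓝[>] 0) (𝓝 0) := by
      simpa using hδ0.const_mul (2 * Γ)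
    filter_upwards [h1.eventually (gt_mem_nhds (mul_pos hκ hc₀))] with μ hμ
    calc 2 * Γ * (δ μ * μ ^ 2) = 2 * Γ * δ μ * μ ^ 2 := by ring
      _ ≤ _ := by gcongr
  -- The factor 2 lets the same remainder cover a comparison of two strategies, which uses two
  -- expansions.
  refine ⟨?_, ⟨fun μ => 2 * Γ * (δ μ * μ ^ 2), ?_, ?_⟩, ?_, ?_⟩
  · filter_upwards [main] with μ h s n hn k
    exact (h n hn).1 s k
  · have h1 : (fun μ => δ μ * μ ^ 2) =o[𝓝[>] 0] fun μ => (1 : ℝ) * μ ^ 2 :=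
      ((isLittleO_one_iff ℝ).2 hδ0).mul_isBigO (isBigO_refl _ _)
    simp only [one_mul] at h1
    exact h1.const_mul_left _
  · filter_upwards [main, hδ, hpos] with μ h hδ hμ n hn
    obtain ⟨-, hER, hgap₁, hgap₂, hw₀, hw⟩ := h n hn
    have hr : 0 ≤ Γ * (δ μ * μ ^ 2) := by
      have := hδ.1
      positivity
    have h1 := hER .centralized
    have h2 := hER .consensus
    have h3 := hER .diffusion
    simp only [AdvNet.Strategy.heterogeneity, mul_zero, add_zero] at h1 h2 h3
    have hf₀ : 0 ≤ f_dif μ n := (mul_nonneg hκ.le hw₀).trans hgap₂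
    have hf : f_dif μ n ≤ f_con μ n :=
      sub_nonneg.1 ((mul_nonneg hκ.le (hw₀.trans hw)).trans hgap₁)
    have m1 : 0 ≤ μ ^ 2 * f_dif μ n := by positivity
    have m2 : μ ^ 2 * f_dif μ n ≤ μ ^ 2 * f_con μ n := by gcongr
    refine ⟨h1.trans (by linarith), h2.trans (by linarith), h3.trans (by linarith), hf₀, hf, ?_, ?_⟩
    · linarith [(abs_le.1 h1).2, (abs_le.1 h3).1]
    · linarith [(abs_le.1 h2).1, (abs_le.1 h3).2]
  · intro c₀ hc₀ hd
    filter_upwards [main, hpos, hgap c₀ hc₀, hd] with μ h hμ hg hd n hn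
    obtain ⟨-, hER, hgap₁, -⟩ := h n hn
    have h2 := hER .consensus
    have h3 := hER .diffusion
    simp only [AdvNet.Strategy.heterogeneity] at h2 h3
    have m : κ * c₀ * μ ^ 2 ≤ (f_con μ n - f_dif μ n) * μ ^ 2 := by
      gcongr
      exact (mul_le_mul_of_nonneg_left hd hκ.le).trans hgap₁
    linarith [(abs_le.1 h2).1, (abs_le.1 h3).2]
  · intro c₀ hc₀ hd
    filter_upwards [main, hpos, hgap c₀ hc₀, hd] with μ h hμ hg hd n hn
    obtain ⟨-, hER, hgap₁, hgap₂, -, hw⟩ := h n hn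
    have h1 := hER .centralized
    have h2 := hER .consensus
    have h3 := hER .diffusion
    simp only [AdvNet.Strategy.heterogeneity, mul_zero, add_zero] at h1 h2 h3
    -- Mixing does not increase the weighted energy, so nondegeneracy of the mixed gradients implies
    -- that of the gradients themselves.
    have m₁ : κ * c₀ * μ ^ 2 ≤ (f_con μ n - f_dif μ n) * μ ^ 2 := by
      gcongr
      exact (mul_le_mul_of_nonneg_left (hd.trans hw) hκ.le).trans hgap₁
    have m₂ : κ * c₀ * μ ^ 2 ≤ f_dif μ n * μ ^ 2 := by
      gcongr
      exact (mul_le_mul_of_nonneg_left hd hκ.le).trans hgap₂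
    constructor
    · linarith [(abs_le.1 h1).2, (abs_le.1 h3).1]
    · linarith [(abs_le.1 h2).1, (abs_le.1 h3).2]
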